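/- A parity game has finitely many positions, each owned by player $0$ or $1$, labelled by a priority in $\mathbb N$ and with at least one move; the player of the parity of the largest priority seen infinitely often wins a play. For $k\ge 1$ the core game $G^C_k$ has positions $\alpha_i,\beta_i,\gamma_i$ ($0\le i\le 2k$); $\alpha_i,\beta_i$ belong to player $i \bmod 2$ and $\gamma_i$ to player $(i+1)\bmod 2$; their priorities are $2k+i+1$, $i$, $i$; the moves are $\alpha_i\to\beta_i$, $\beta_i\to\gamma_i$, $\beta_i\to\alpha_{i-1}$ (if $i>0$), $\gamma_i\to\beta_i$, $\gamma_i\to\gamma_i$, $\gamma_i\to\alpha_{i+1}$ (if $i<2k$). The game $G^S_k$ of the SCC family is obtained from $G^C_k$ by adding positions $\delta^{p}_{\{i,j\}}$ ($p\in\{0,1\}$, $i\ne j$ in $\{0,\dots,2k\}$, and $p\equiv i \pmod 2$ if $i\equiv j\pmod 2$), of owner $p$ and priority $0$, with moves $\gamma_i\leftrightarrow\delta^p_{\{i,j\}}$ if $i\equiv p \pmod 2$, and $\delta^0_{\{i,j\}}\leftrightarrow\delta^1_{\{i,j\}}$ if $i\not\equiv j \pmod 2$. A game $G$ is a core extension of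 $G^C_k$ if, $P$ being its set of positions outside the core, (1) $G\setminus P=G^C_k$; (2) positions of $P$ have priority smaller than $\alpha_0$; (3) no move connects $P$ with any $\alpha_i$ or $\beta_i$; (4) if $\gamma_i$ moves to $v\in P$, then $v$ belongs to player $i\bmod 2$, has a move back to $\gamma_i$ and has priority at most $i$. Here $U\setminus X$ is the maximal subgame of $U$ avoiding $X$. The induced subgame tree of $G^S_k$ consists of the subgames $G_w$ ($w\in\{L,R\}^{\le k}$) and $\hat G_w$ ($w\in\{L,R\}^{\le k+1}$, $w\neq\varepsilon$) defined by $G_\varepsilon=G^S_k$ and, with $z=2(k-|w|)$, $\hat G_{wL}=G_w\setminus \mathrm{Atr}^1_{G_w}(\{\alpha_z\})$, $\hat G_{wR}=G_w\setminus \mathrm{Atr}^0_{G_w}(\mathrm{Win}_0(\hat G_{wL}))$, and $G_w=\hat G_w\setminus \mathrm{Atr}^0_{\hat G_w}(\{\alpha_{z+1}\})$ for $w\ne\varepsilon$, where $\mathrm{Atr}^p$ and $\mathrm{Win}_p$ denote the attractor and the winning region of player $p$. The Recursive algorithm with SCC decomposition solves a game as follows. A game that is not strongly connected is solved by solving a terminal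 strongly connected component, attracting to the computed winning regions, removing these positions and proceeding with the rest; the order in which components are chosen is arbitrary. On a single strongly connected component $U$, with $p$ the parity of its maximal priority and $q=1-p$, a recursive call is executed: the left subgame (remove the $p$-attractor to the positions of maximal priority) is solved; if player $q$ can force no position outside its winning region $W_q$ of the left subgame into $W_q$ in one move, then $q$ wins exactly $W_q$; otherwise the right subgame (remove the $q$-attractor to $W_q$) is solved too, and $p$ wins exactly its winning region there. With memoization, results of already solved subgames are looked up instead of recomputed. Two recursive calls are distinct if they are on different subgames. **Theorem 2 (SCC-Decomposition Worst Case).** The number of distinct recursive calls executed by the Recursive algorithm with SCC decomposition, with or without memoization and for every order of processing the components, on a game with $n$ positions is $\Omega(2^{\sqrt{n/3}})$ in the worst case: there is $c>0$ such that for all sufficiently large $n$ some parity game with $n$ positions requires at least $c\,2^{\sqrt{n/3}}$ distinct recursive calls. The SCC family is a witness: for all $k\ge1$ the game $G^S_k$ has $n=3k^2+8k+3$ positions, is a core extension of $G^C_k$, and requires at least $c\,2^{\sqrt{n/3}}$ distinct recursive calls, with $c>0$ independent of $k$. Moreover, in the induced subgame tree of $G^S_k$, the subgames $G_\varepsilon$,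 $G_{wL}$ ($|w|<k$) and $\hat G_{w}$ ($1\le|w|\le k+1$, $w\ne R^{k+1}$) are single strongly connected components; $\hat G_{R^{k+1}}$ is empty; and $G_{wR}$ ($|w|<k$), with $z=2(k-|wR|)$, contains $T=\{\beta_{z+1}\}$ if $z>0$, respectively $T=\{\beta_1,\alpha_0\}$ if $z=0$, and $G_{wR}\setminus T$ is a terminal strongly connected component of $G_{wR}$. -/

import Mathlib

open Filter

/-- The two players `0` and `1`. The opponent of `p` is `p + 1`, and a natural number cast to
`Player` is its parity. -/
abbrev Player := ZMod 2

/-- A parity game whose set of positions is the type `V` (which is assumed finite where needed). -/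
structure ParityGame (V : Type*) where
  owner : V → Player
  move : V → V → Prop
  prio : V → ℕ
  total : ∀ v, ∃ w, move v w

namespace ParityGame

variable {V : Type*} (G : ParityGame V)

/-! Subgames of `G` are represented by their sets of positions; the moves of a subgame are all
moves of `G` between its positions. -/

/-- `U` is the set of positions of a subgame: each of its positions has a move inside `U`. -/
def IsSubgame (U : Set V) : Prop := ∀ v ∈ U, ∃ w ∈ U, G.move v w

/-- The maximal subgame of the subgame `U` whose positions lie in `U \ X`. -/
def minus (U X : Set V) : Set V := ⋃₀ {Y | Y ⊆ U \ X ∧ G.IsSubgame Y}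

/-- The `p`-predecessor of `X` in the subgame `U`. -/
def pre (U : Set V) (p : Player) (X : Set V) : Set V :=
  {v | v ∈ U ∧ G.owner v = p ∧ ∃ w ∈ U, G.move v w ∧ w ∈ X} ∪
  {v | v ∈ U ∧ G.owner v ≠ p ∧ ∀ w ∈ U, G.move v w → w ∈ X}

theorem pre_mono (U : Set V) (p : Player) : Monotone (G.pre U p) := by
  intro X Y h v hv
  rcases hv with ⟨hU, ho, w, hw, hm, hX⟩ | ⟨hU, ho, hall⟩
  · exact Or.inl ⟨hU, ho, w, hw, hm, h hX⟩
  · exact Or.inr ⟨hU, ho, fun w hw hm => h (hall w hw hm)⟩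

/-- The `p`-attractor of `X` in the subgame `U`: the least fixed point of
`Y ↦ (X ∩ U) ∪ pre Y`. -/
def attr (U : Set V) (p : Player) (X : Set V) : Set V :=
  OrderHom.lfp
    { toFun := fun Y => (X ∩ U) ∪ G.pre U p Y
      monotone' := fun _ _ h => Set.union_subset_union_right _ (G.pre_mono U p h) }

/-- `s` is a positional strategy for player `p` on `D`
(the values of `s` at other positions are irrelevant). -/
def IsStrategy (D : Set V) (p : Player) (s : V → V) : Prop :=
  ∀ v ∈ D, G.owner v = p → s v ∈ D ∧ G.move v (s v)

/-- The play from `v` in which player `p` follows the strategy `s` and the opponent follows `t`. -/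
def play (p : Player) (s t : V → V) (v : V) : ℕ → V
  | 0 => v
  | i + 1 => if G.owner (play p s t v i) = p then s (play p s t v i) else t (play p s t v i)

/-- The priority of an infinite path: the maximal priority that occurs infinitely often. -/
noncomputable def pathPrio (π : ℕ → V) : ℕ := limsup (fun i => G.prio (π i)) atTop

/-- `D` is a `p`-dominion of the subgame `U`: the opponent cannot leave `D`, and some strategy
of `p` on `D` wins all plays from positions of `D` against every opponent strategy on `D`. -/
def IsDominion (U : Set V) (p : Player) (D : Set V) : Prop :=
  D ⊆ U ∧
  (∀ v ∈ D, G.owner v ≠ p → ∀ w ∈ U, G.move v w → w ∈ D) ∧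
  ∃ s, G.IsStrategy D p s ∧
    ∀ t, G.IsStrategy D (p + 1) t → ∀ v ∈ D, (G.pathPrio (G.play p s t v) : Player) = p

/-- The winning region of player `p` in the subgame `U`: the largest `p`-dominion. -/
def win (U : Set V) (p : Player) : Set V := ⋃₀ {D | G.IsDominion U p D}

/-- The graph induced on `U` is (nonempty and) strongly connected. -/
def StronglyConnected (U : Set V) : Prop :=
  U.Nonempty ∧ ∀ v ∈ U, ∀ w ∈ U,
    Relation.ReflTransGen (fun a b => a ∈ U ∧ b ∈ U ∧ G.move a b) v w

/-- `C` is a terminal (bottom) strongly connected component of the subgame `U`. -/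
def IsTerminalSCC (U C : Set V) : Prop :=
  C ⊆ U ∧ G.StronglyConnected C ∧ ∀ v ∈ C, ∀ w ∈ U, G.move v w → w ∈ C

/-- A rule that fixes the order in which strongly connected components are processed: it selects
a terminal component of every nonempty set of positions. -/
structure SCCRule where
  pick : Set V → Set V
  spec : ∀ U : Set V, U.Nonempty → G.IsTerminalSCC U (pick U)

theorem nonempty_SCCRule [Finite V] : Nonempty G.SCCRule := by
  suffices h : ∀ U : Set V, ∃ C, U.Nonempty → G.IsTerminalSCC U C by
    choose f hf using h
    exact ⟨⟨f, hf⟩⟩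
  intro U
  by_cases hU : U.Nonempty
  swap
  · exact ⟨∅, fun h => absurd h hU⟩
  let r : V → V → Prop := fun a b => a ∈ U ∧ b ∈ U ∧ G.move a b
  let R : V → Set V := fun v => {w | Relation.ReflTransGen r v w}
  obtain ⟨v, hv, hmin⟩ := Set.exists_min_image U (fun v => (R v).ncard) (Set.toFinite U) hU
  have hRU : ∀ w ∈ R v, w ∈ U := by
    intro w hw
    induction hw with
    | refl => exact hv
    | tail _ h _ => exact h.2.1
  have hback : ∀ w ∈ R v, R w = R v := fun w hw =>
    Set.eq_of_subset_of_ncard_le (fun x hx => hw.trans hx) (hmin w (hRU w hw))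
  have hlift : ∀ a ∈ R v, ∀ b, Relation.ReflTransGen r a b →
      Relation.ReflTransGen (fun a b => a ∈ R v ∧ b ∈ R v ∧ G.move a b) a b := by
    intro a ha b hab
    induction hab with
    | refl => exact .refl
    | tail h1 h2 ih =>
      exact ih.tail ⟨ha.trans h1, (ha.trans h1).tail h2, h2.2.2⟩
  refine ⟨R v, fun _ => ⟨hRU, ⟨⟨v, .refl⟩, fun a ha b hb => hlift a ha b ?_⟩, ?_⟩⟩
  · have : b ∈ R a := by rw [hback a ha]; exact hb
    exact this
  · intro a ha b hb hm
    exact ha.tail ⟨hRU a ha, hb, hm⟩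

/-- The greatest priority in the subgame `U`. -/
noncomputable def maxPrio (U : Set V) : ℕ := sSup (G.prio '' U)

/-- The set of positions of maximal priority in the subgame `U`. -/
def topPos (U : Set V) : Set V := {v | v ∈ U ∧ G.prio v = G.maxPrio U}

/-- The state of a run: the table of the solved subgames with their computed winning regions, and
the list of calls executed so far. -/
structure RunState (V : Type*) where
  table : Set V → Option (Player → Set V)
  calls : List (Set V)

/-- The initial state: nothing solved, no call executed. -/
def RunState.init : RunState V := ⟨fun _ => none, []⟩

/-- Add a call on `U` to the list of executed calls. -/
def RunState.log (s : RunState V) (U : Set V) : RunState V := ⟨s.table, U :: s.calls⟩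

open Classical in
/-- Record the computed winning regions of `U` in the table. -/
noncomputable def RunState.record (s : RunState V) (U : Set V) (W : Player → Set V) :
    RunState V := ⟨Function.update s.table U (some W), s.calls⟩

theorem minus_subset (U X : Set V) : G.minus U X ⊆ U \ X :=
  Set.sUnion_subset fun _ h => h.1

theorem attr_unfold (U : Set V) (p : Player) (X : Set V) :
    (X ∩ U) ∪ G.pre U p (G.attr U p X) = G.attr U p X :=
  OrderHom.map_lfp
    { toFun := fun Y => (X ∩ U) ∪ G.pre U p Y
      monotone' := fun _ _ h => Set.union_subset_union_right _ (G.pre_mono U p h) }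

theorem pre_subset (U : Set V) (p : Player) (X : Set V) : G.pre U p X ⊆ U := by
  rintro v (h | h) <;> exact h.1

theorem minus_ncard_lt [Finite V] {U X : Set V} {v : V} (hU : v ∈ U) (hX : v ∈ X) :
    (G.minus U X).ncard < U.ncard :=
  Set.ncard_lt_ncard
    ⟨fun _ h => (G.minus_subset U X h).1, fun h => (G.minus_subset U X (h hU)).2 hX⟩
    (Set.toFinite U)

theorem left_ncard_lt [Finite V] {U : Set V} (h : U ≠ ∅) (p : Player) :
    (G.minus U (G.attr U p (G.topPos U))).ncard < U.ncard := by
  have hne : (G.prio '' U).Nonempty := (Set.nonempty_iff_ne_empty.2 h).image _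
  obtain ⟨v, hv, he⟩ := Nat.sSup_mem hne ((Set.toFinite U).image G.prio).bddAbove
  refine G.minus_ncard_lt hv ?_
  rw [← G.attr_unfold]
  exact Or.inl ⟨⟨hv, he⟩, hv⟩

theorem right_ncard_lt [Finite V] {U W : Set V} {q : Player} (h : G.pre U q W \ W ≠ ∅) :
    (G.minus U (G.attr U q W)).ncard < U.ncard := by
  obtain ⟨v, hv, -⟩ := Set.nonempty_iff_ne_empty.2 h
  refine G.minus_ncard_lt (G.pre_subset U q W hv) ?_
  rw [← G.attr_unfold]
  refine Or.inr ?_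
  have key : W ∩ U ⊆ G.attr U q W := by
    rw [← G.attr_unfold]; exact Set.subset_union_left
  rcases hv with ⟨hU, ho, w, hw, hm, hX⟩ | ⟨hU, ho, hall⟩
  · exact Or.inl ⟨hU, ho, w, hw, hm, key ⟨hX, hw⟩⟩
  · exact Or.inr ⟨hU, ho, fun w hw hm => key ⟨hall w hw hm, hw⟩⟩

theorem scc_ncard_lt [Finite V] (σ : G.SCCRule) {U : Set V} (h : U ≠ ∅)
    (hs : ¬ G.StronglyConnected U) : (σ.pick U).ncard < U.ncard := by
  obtain ⟨h1, h2, -⟩ := σ.spec U (Set.nonempty_iff_ne_empty.2 h)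
  refine Set.ncard_lt_ncard (h1.ssubset_of_ne ?_) (Set.toFinite U)
  intro he
  rw [he] at h2
  exact hs h2

theorem rest_ncard_lt [Finite V] (σ : G.SCCRule) {U : Set V} (h : U ≠ ∅) (A B : Set V) :
    (G.minus U (σ.pick U ∪ A ∪ B)).ncard < U.ncard := by
  obtain ⟨h1, h2, -⟩ := σ.spec U (Set.nonempty_iff_ne_empty.2 h)
  obtain ⟨v, hv⟩ := h2.1
  exact G.minus_ncard_lt (h1 hv) (Or.inl (Or.inl hv))

open Classical in
/-- The Recursive algorithm with SCC decomposition, on the subgame `U`. It returns the computed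
winning regions of the two players and the new state. With `memo = true` the result of a subgame
that was solved before is taken from the table; with `memo = false` the table is never read.

* A subgame that is not strongly connected is solved component-wise: a terminal component is
  solved, its winning regions are extended by attraction, all these positions are removed, and the
  residual subgame is decomposed and solved in turn.
* On a subgame `U` that is a single strongly connected component, a call of the recursive
  procedure is executed (and logged): the attractor, for the player `p` of the parity of the
  maximal priority, to the positions of maximal priority is removed, and the left subgame is
  solved. If the opponent `q` can force no further position into its winning region `W q` of the
  left subgame, then `U` is solved; otherwise the `q`-attractor to `W q` is removed, and the right
  subgame is solved.

Only the calls on single components are logged; the decomposition itself is not counted. -/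
noncomputable def solve [Finite V] (σ : G.SCCRule) (memo : Bool) (U : Set V) (s : RunState V) :
    (Player → Set V) × RunState V :=
  match (if memo then s.table U else none) with
  | some W => (W, s)
  | none =>
    if h0 : U = ∅ then (fun _ => ∅, s)
    else if hs : G.StronglyConnected U then
      let p : Player := (G.maxPrio U : Player)
      let q : Player := p + 1
      let left := solve σ memo (G.minus U (G.attr U p (G.topPos U))) (s.log U)
      if hp : G.pre U q (left.1 q) \ left.1 q = ∅ then
        let W : Player → Set V := fun r => if r = q then left.1 q else U \ left.1 q
        (W, left.2.record U W)
      else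
        let right := solve σ memo (G.minus U (G.attr U q (left.1 q))) left.2
        let W : Player → Set V := fun r => if r = p then right.1 p else U \ right.1 p
        (W, right.2.record U W)
    else
      let comp := solve σ memo (σ.pick U) s
      let rest := solve σ memo
        (G.minus U (σ.pick U ∪ G.attr U 0 (comp.1 0) ∪ G.attr U 1 (comp.1 1))) comp.2
      let W : Player → Set V := fun r => G.attr U r (comp.1 r) ∪ rest.1 r
      (W, rest.2.record U W)
termination_by U.ncard
decreasing_by
  · exact G.left_ncard_lt h0 _
  · exact G.right_ncard_lt hp
  · exact G.scc_ncard_lt σ h0 hs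
  · exact G.rest_ncard_lt σ h0 _ _

/-- The number of distinct recursive calls (that is, calls on pairwise different subgames) that
the Recursive algorithm with SCC decomposition executes on the game `G`. -/
noncomputable def distinctCalls [Finite V] (σ : G.SCCRule) (memo : Bool) : ℕ :=
  {U | U ∈ (G.solve σ memo Set.univ RunState.init).2.calls}.ncard

end ParityGame

/-- The positions of the `k`-th core game. -/
inductive CorePos (k : ℕ)
  | alpha (i : Fin (2 * k + 1))
  | beta (i : Fin (2 * k + 1))
  | gamma (i : Fin (2 * k + 1))
  deriving DecidableEq, Fintype

namespace CorePos

variable {k : ℕ}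

def owner : CorePos k → Player
  | alpha i => (i.val : Player)
  | beta i => (i.val : Player)
  | gamma i => (i.val : Player) + 1

def prio : CorePos k → ℕ
  | alpha i => 2 * k + i.val + 1
  | beta i => i.val
  | gamma i => i.val

def move : CorePos k → CorePos k → Prop
  | alpha i, beta j => j = i
  | beta i, gamma j => j = i
  | beta i, alpha j => j.val + 1 = i.val
  | gamma i, beta j => j = i
  | gamma i, gamma j => j = i
  | gamma i, alpha j => j.val = i.val + 1
  | _, _ => False

end CorePos

/-- The `k`-th game of the core family. -/
def coreGame (k : ℕ) : ParityGame (CorePos k) where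
  owner := CorePos.owner
  move := CorePos.move
  prio := CorePos.prio
  total v := by
    cases v with
    | alpha i => exact ⟨.beta i, rfl⟩
    | beta i => exact ⟨.gamma i, rfl⟩
    | gamma i => exact ⟨.beta i, rfl⟩

/-- `G` is a core extension of the `k`-th core game, whose positions are identified with positions
of `G` by the injection `e`. -/
def IsCoreExtension (k : ℕ) {V : Type*} (G : ParityGame V) (e : CorePos k → V) : Prop :=
  Function.Injective e ∧
  (G.minus Set.univ (Set.range e)ᶜ = Set.range e ∧
    ∀ c, G.owner (e c) = (coreGame k).owner c ∧ G.prio (e c) = (coreGame k).prio c ∧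
      ∀ d, G.move (e c) (e d) ↔ (coreGame k).move c d) ∧
  (∀ v ∉ Set.range e, G.prio v < G.prio (e (.alpha 0))) ∧
  (∀ v ∉ Set.range e, ∀ i,
    ¬ G.move v (e (.alpha i)) ∧ ¬ G.move (e (.alpha i)) v ∧
    ¬ G.move v (e (.beta i)) ∧ ¬ G.move (e (.beta i)) v) ∧
  (∀ v ∉ Set.range e, ∀ i, G.move (e (.gamma i)) v →
    G.owner v = (i.val : Player) ∧ G.move v (e (.gamma i)) ∧ G.prio v ≤ i.val)

/-- The index `(i, j, p)` stands for the additional position `δ` with doubleton `{i, j}` and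
superscript `p`; the doubleton is written with `i < j`. -/
abbrev DeltaPos (k : ℕ) : Type :=
  {x : Fin (2 * k + 1) × Fin (2 * k + 1) × Player //
    x.1 < x.2.1 ∧ ((x.1.val : Player) = (x.2.1.val : Player) → x.2.2 = (x.1.val : Player))}

/-- The positions of the `k`-th game of the SCC family. -/
abbrev SCCPos (k : ℕ) : Type := CorePos k ⊕ DeltaPos k

/-- There are moves in both directions between `γ i` and the additional position `δ`. -/
def gammaDelta {k : ℕ} (i : Fin (2 * k + 1)) (δ : DeltaPos k) : Prop :=
  (i = δ.1.1 ∨ i = δ.1.2.1) ∧ (i.val : Player) = δ.1.2.2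

/-- The moves of the `k`-th game of the SCC family. -/
def sccMove {k : ℕ} : SCCPos k → SCCPos k → Prop
  | .inl c, .inl d => CorePos.move c d
  | .inl (.gamma i), .inr δ => gammaDelta i δ
  | .inr δ, .inl (.gamma i) => gammaDelta i δ
  | .inr δ, .inr δ' =>
      δ'.1.1 = δ.1.1 ∧ δ'.1.2.1 = δ.1.2.1 ∧ δ'.1.2.2 = δ.1.2.2 + 1 ∧
        (δ.1.1.val : Player) ≠ (δ.1.2.1.val : Player)
  | _, _ => False

theorem sccMove_total {k : ℕ} (v : SCCPos k) : ∃ w, sccMove v w := by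
  rcases v with c | ⟨⟨i, j, p⟩, h1, h2⟩
  · obtain ⟨d, hd⟩ := (coreGame k).total c
    exact ⟨.inl d, by cases c <;> exact hd⟩
  · by_cases hp : (i.val : Player) = p
    · exact ⟨.inl (.gamma i), Or.inl rfl, hp⟩
    · refine ⟨.inl (.gamma j), Or.inr rfl, ?_⟩
      change (j.val : Player) = p
      have key : ∀ a b p : Player, ¬ a = p → (a = b → p = a) → b = p := by decide
      exact key _ _ _ hp h2

/-- The `k`-th game of the SCC family. -/
def sccGame (k : ℕ) : ParityGame (SCCPos k) where
  owner := Sum.elim CorePos.owner fun δ => δ.1.2.2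
  move := sccMove
  prio := Sum.elim CorePos.prio fun _ => 0
  total := sccMove_total

/-- The letters of the sequences that index the induced subgame tree: left and right. -/
inductive Dir
  | L
  | R

section Tree

variable {k : ℕ} {V : Type*} (G : ParityGame V) (e : CorePos k → V)

/-- The set `{α_i}`. -/
def alphaSet (i : ℕ) : Set V := {v | ∃ j : Fin (2 * k + 1), j.val = i ∧ v = e (.alpha j)}

/-- The set `{β_i}`. -/
def betaSet (i : ℕ) : Set V := {v | ∃ j : Fin (2 * k + 1), j.val = i ∧ v = e (.beta j)}

/-- The child `Ĝ_{wx}`, in direction `x`, of the node `U = G_w` of depth `l = |w|`. -/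
def hatChild (l : ℕ) (U : Set V) : Dir → Set V
  | .L => G.minus U (G.attr U 1 (alphaSet e (2 * (k - l))))
  | .R => G.minus U (G.attr U 0
      (G.win (G.minus U (G.attr U 1 (alphaSet e (2 * (k - l))))) 0))

/-- The game `G_w` of the induced subgame tree, for a sequence `w` of length at most `k`.
Sequences are lists written backwards: `x :: w` is the sequence `w` followed by the letter `x`. -/
def treeGame : List Dir → Set V
  | [] => Set.univ
  | x :: w =>
      G.minus (hatChild G e w.length (treeGame w) x)
        (G.attr (hatChild G e w.length (treeGame w) x) 0
          (alphaSet e (2 * (k - (w.length + 1)) + 1)))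

/-- The game `Ĝ_{wx}` of the induced subgame tree, for a sequence `w` of length at most `k`. -/
def hatGame (w : List Dir) (x : Dir) : Set V := hatChild G e w.length (treeGame G e w) x

/-- The positions of `G_{wR}` outside its terminal strongly connected component, where
`z = 2(k - |wR|)`: these are `β_{z+1}` and, if `z = 0`, also `α_0`. -/
def transientPos (z : ℕ) : Set V := betaSet e (z + 1) ∪ {v | z = 0 ∧ v ∈ alphaSet e 0}

end Tree

/-! The bound comes from a binary tree of subgames of `sccGame k` that every run has to solve. A
node `G_w` remembers the word `w`: with `z = 2 (k - |w|)`, passing to `G_{wR}` deletes `γ_{z-1}`,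
passing to `G_{wL}` keeps it, and later levels can delete only smaller odd `γ`. Hence the odd `γ` in
a node determine its word among words of that length (`treeGame_gamma_injective`), and the level
`|w| = k` supplies `2 ^ k` different subgames.

The shape of a node is described by `TreeInv`. In its left subgame, where `α_z` and `β_{z+1}` are
gone, player `0` wins `β_z`, the even `γ` from `γ_z` on and some `δ`, a trap in which all priorities
are even. Player `1` wins the rest by moving from even `γ_i` to `α_{i+1}`, from odd `β_i` to `γ_i`,
and from `δ` to its largest remaining `γ` (`TreeInv.dominion_zero`, `TreeInv.dominion_one`). The
region of player `0` attracts `α_z` and through it `γ_{z-1}` (`TreeInv.attr_win`); this deletion is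
the letter `R`. In both children the maximal position is then `α_{z-1}`, and removing its attractor
restores the invariant with `z - 2` (`TreeInv.left`, `TreeInv.right`).

Decomposition into components does not help, because the `δ` link all remaining `γ` to each other
(`mutual_gamma`). A node falls apart only when `γ_{z+1}` was deleted: `β_{z+1}`, and `α_0` if `z =
0`, then become transient, and what is left is the only terminal component, so the order of
processing is irrelevant (`TreeInv.exists_mainComponent`). For `z > 0` the lost position lies in
both attractors that are removed next, so the component has the same children as the whole node
(`MainComponent.leftGame_eq`, `MainComponent.rightGame_eq`).

The algorithm enters through `goodRun_solve`: from a table of correct entries it computes correct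
winning regions, and afterwards the table contains every nonempty subgame on which a tabulated one
depends. Winning regions are unique, so this holds with and without memoization. The final table is
an `ExploredFamily`, and the lower bound is a statement about such families (`two_pow_le_ncard`).
Arbitrary `n` is reached by padding with isolated loops, which no order of processing can exploit
(`range_inl_mem_of_pad`). -/

namespace ParityGame

variable {V : Type*} (G : ParityGame V)

theorem player_eq_of_ne {a p : Player} (h : a ≠ p) : a = p + 1 := by
  revert a p; decide

theorem player_succ_ne (p : Player) : p + 1 ≠ p := by
  revert p; decide

theorem player_add_two (p : Player) : p + 1 + 1 = p := by
  revert p; decide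

variable {G}

/-! ### Attractors and subgames -/

theorem subset_attr (U : Set V) (p : Player) (X : Set V) : X ∩ U ⊆ G.attr U p X := by
  rw [← G.attr_unfold]; exact Set.subset_union_left

theorem pre_attr_subset (U : Set V) (p : Player) (X : Set V) :
    G.pre U p (G.attr U p X) ⊆ G.attr U p X := by
  conv_rhs => rw [← G.attr_unfold]
  exact Set.subset_union_right

theorem attr_subset_of_closed {U X A : Set V} {p : Player} (hX : X ∩ U ⊆ A)
    (hpre : G.pre U p A ⊆ A) : G.attr U p X ⊆ A :=
  OrderHom.lfp_le
    { toFun := fun Y => (X ∩ U) ∪ G.pre U p Y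
      monotone' := fun _ _ h => Set.union_subset_union_right _ (G.pre_mono U p h) }
    (Set.union_subset hX hpre)

theorem attr_subset (U : Set V) (p : Player) (X : Set V) : G.attr U p X ⊆ U :=
  attr_subset_of_closed Set.inter_subset_right (G.pre_subset U p U)

theorem mem_attr_own {U X : Set V} {p : Player} {v w : V} (hv : v ∈ U) (ho : G.owner v = p)
    (hm : G.move v w) (hw : w ∈ G.attr U p X) : v ∈ G.attr U p X :=
  pre_attr_subset U p X (Or.inl ⟨hv, ho, w, attr_subset U p X hw, hm, hw⟩)

theorem mem_attr_opp {U X : Set V} {p : Player} {v : V} (hv : v ∈ U) (ho : G.owner v ≠ p)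
    (h : ∀ w ∈ U, G.move v w → w ∈ G.attr U p X) : v ∈ G.attr U p X :=
  pre_attr_subset U p X (Or.inr ⟨hv, ho, h⟩)

theorem isSubgame_minus (U X : Set V) : G.IsSubgame (G.minus U X) := by
  rintro v ⟨Y, hY, hv⟩
  obtain ⟨w, hw, hm⟩ := hY.2 v hv
  exact ⟨w, ⟨Y, hY, hw⟩, hm⟩

theorem subset_minus {U X Y : Set V} (h : Y ⊆ U \ X) (hY : G.IsSubgame Y) : Y ⊆ G.minus U X :=
  fun _ hv => ⟨Y, ⟨h, hY⟩, hv⟩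

theorem minus_eq_diff {U X : Set V} (h : G.IsSubgame (U \ X)) : G.minus U X = U \ X :=
  (G.minus_subset U X).antisymm (subset_minus subset_rfl h)

theorem own_move_notMem_attr {U X : Set V} {p : Player} {v w : V} (hv : v ∈ U)
    (hA : v ∉ G.attr U p X) (ho : G.owner v = p) (hm : G.move v w) : w ∉ G.attr U p X :=
  fun hw => hA (mem_attr_own hv ho hm hw)

theorem exists_opp_move_notMem_attr {U X : Set V} {p : Player} {v : V} (hv : v ∈ U)
    (hA : v ∉ G.attr U p X) (ho : G.owner v ≠ p) :
    ∃ w ∈ U, G.move v w ∧ w ∉ G.attr U p X := by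
  by_contra h
  push Not at h
  exact hA (mem_attr_opp hv ho h)

theorem isSubgame_diff_attr {U : Set V} (hU : G.IsSubgame U) (p : Player) (X : Set V) :
    G.IsSubgame (U \ G.attr U p X) := by
  rintro v ⟨hv, hA⟩
  by_cases ho : G.owner v = p
  · obtain ⟨w, hw, hm⟩ := hU v hv
    exact ⟨w, ⟨hw, own_move_notMem_attr hv hA ho hm⟩, hm⟩
  · obtain ⟨w, hw, hm, h⟩ := exists_opp_move_notMem_attr hv hA ho
    exact ⟨w, ⟨hw, h⟩, hm⟩

theorem minus_attr {U : Set V} (hU : G.IsSubgame U) (p : Player) (X : Set V) :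
    G.minus U (G.attr U p X) = U \ G.attr U p X :=
  minus_eq_diff (isSubgame_diff_attr hU p X)

/-- The positions from which `p` forces a visit to `X` in at most `n` moves. -/
def attrStage (G : ParityGame V) (U : Set V) (p : Player) (X : Set V) : ℕ → Set V
  | 0 => X ∩ U
  | n + 1 => (X ∩ U) ∪ G.pre U p (attrStage G U p X n)

theorem attrStage_mono (U : Set V) (p : Player) (X : Set V) :
    Monotone (G.attrStage U p X) := by
  refine monotone_nat_of_le_succ fun n => ?_
  induction n with
  | zero => exact Set.subset_union_left
  | succ n ih => exact Set.union_subset_union_right _ (G.pre_mono U p ih)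

theorem attrStage_subset_attr (U : Set V) (p : Player) (X : Set V) (n : ℕ) :
    G.attrStage U p X n ⊆ G.attr U p X := by
  induction n with
  | zero => exact subset_attr U p X
  | succ n ih =>
    exact Set.union_subset (subset_attr U p X)
      ((G.pre_mono U p ih).trans (pre_attr_subset U p X))

/-- Finiteness bounds the stages of all successors of a position simultaneously, so the union of the
stages is already closed under `pre` and contains the least fixed point. -/
theorem exists_mem_attrStage [Finite V] {U : Set V} {p : Player} {X : Set V} {v : V}
    (hv : v ∈ G.attr U p X) : ∃ n, v ∈ G.attrStage U p X n := by
  have h : G.attr U p X ⊆ ⋃ n, G.attrStage U p X n := by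
    refine attr_subset_of_closed (fun x hx => Set.mem_iUnion.2 ⟨0, hx⟩) ?_
    rintro v (⟨hU, ho, w, hw, hm, hX⟩ | ⟨hU, ho, hall⟩)
    · obtain ⟨n, hn⟩ := Set.mem_iUnion.1 hX
      exact Set.mem_iUnion.2 ⟨n + 1, Or.inr (Or.inl ⟨hU, ho, w, hw, hm, hn⟩)⟩
    · have : ∀ w, ∃ n, w ∈ U → G.move v w → w ∈ G.attrStage U p X n := by
        intro w
        by_cases hw : w ∈ U ∧ G.move v w
        · obtain ⟨n, hn⟩ := Set.mem_iUnion.1 (hall w hw.1 hw.2)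
          exact ⟨n, fun _ _ => hn⟩
        · exact ⟨0, fun a b => absurd ⟨a, b⟩ hw⟩
      choose f hf using this
      obtain ⟨N, hN⟩ := (Set.finite_range f).bddAbove
      refine Set.mem_iUnion.2 ⟨N + 1, Or.inr (Or.inr ⟨hU, ho, fun w hw hm => ?_⟩)⟩
      exact attrStage_mono U p X (hN ⟨w, rfl⟩) (hf w hw hm)
  exact Set.mem_iUnion.1 (h hv)

/-- The attractor has a positional strategy along which a rank decreases until `X` is reached. -/
theorem exists_attr_strategy [Finite V] (G : ParityGame V) (U : Set V) (p : Player) (X : Set V) :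
    ∃ (s : V → V) (rank : V → ℕ), ∀ v ∈ G.attr U p X, v ∉ X →
      (G.owner v = p → s v ∈ G.attr U p X ∧ G.move v (s v) ∧ rank (s v) < rank v) ∧
      (G.owner v ≠ p → ∀ w ∈ U, G.move v w → w ∈ G.attr U p X ∧ rank w < rank v) := by
  classical
  let rank : V → ℕ := fun v => sInf {n | v ∈ G.attrStage U p X n}
  have hrank : ∀ v ∈ G.attr U p X, v ∈ G.attrStage U p X (rank v) := fun v hv =>
    Nat.sInf_mem (exists_mem_attrStage hv)
  have hle : ∀ v n, v ∈ G.attrStage U p X n → rank v ≤ n := fun v n h => Nat.sInf_le h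
  have key : ∀ v, ∃ w, v ∈ G.attr U p X → v ∉ X → G.owner v = p →
      w ∈ G.attr U p X ∧ G.move v w ∧ rank w < rank v := by
    intro v
    by_cases h : v ∈ G.attr U p X ∧ v ∉ X ∧ G.owner v = p
    swap
    · exact ⟨v, fun a b c => absurd ⟨a, b, c⟩ h⟩
    have := hrank v h.1
    rcases hr : rank v with _ | n
    · rw [hr] at this
      exact absurd this.1 h.2.1
    · rw [hr] at this
      rcases this with h1 | ⟨hU, ho, w, hw, hm, hX⟩ | ⟨hU, ho, hall⟩
      · exact absurd h1.1 h.2.1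
      · exact ⟨w, fun _ _ _ => ⟨attrStage_subset_attr U p X n hX, hm,
          Nat.lt_succ_of_le (hle w n hX)⟩⟩
      · exact absurd h.2.2 ho
  choose s hs using key
  refine ⟨s, rank, fun v hv hX => ⟨fun ho => hs v hv hX ho, fun ho w hw hm => ?_⟩⟩
  have := hrank v hv
  rcases hr : rank v with _ | n
  · rw [hr] at this
    exact absurd this.1 hX
  · rw [hr] at this
    rcases this with h1 | ⟨hU, ho', -⟩ | ⟨hU, -, hall⟩
    · exact absurd h1.1 hX
    · exact absurd ho' ho
    · have h2 := hall w hw hm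
      exact ⟨attrStage_subset_attr U p X n h2, Nat.lt_succ_of_le (hle w n h2)⟩

/-! ### The priority of a path -/

theorem pathPrio_eq {π : ℕ → V} {m : ℕ} (h1 : ∀ᶠ n in atTop, G.prio (π n) ≤ m)
    (h2 : ∃ᶠ n in atTop, G.prio (π n) = m) : G.pathPrio π = m := by
  refine le_antisymm ?_ ?_
  · exact limsup_le_of_le (by isBoundedDefault) h1
  · exact le_limsup_of_frequently_le (h2.mono fun n h => h.ge) ⟨m, by simpa using h1⟩

/-- With finitely many priorities the limit superior is attained infinitely often and eventually
bounds the path; later arguments use only these two facts. -/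
theorem pathPrio_spec [Finite V] (G : ParityGame V) (π : ℕ → V) :
    (∀ᶠ n in atTop, G.prio (π n) ≤ G.pathPrio π) ∧
      ∃ᶠ n in atTop, G.prio (π n) = G.pathPrio π := by
  classical
  obtain ⟨B, hB⟩ := (Set.finite_range G.prio).bddAbove
  have hB' : ∀ v, G.prio v ≤ B := fun v => hB ⟨v, rfl⟩
  let P : ℕ → Prop := fun m => ∃ᶠ n in atTop, m ≤ G.prio (π n)
  have h0 : P 0 := Frequently.of_forall fun n => Nat.zero_le _
  have hm : P (Nat.findGreatest P B) := Nat.findGreatest_spec (Nat.zero_le B) h0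
  set m := Nat.findGreatest P B with hmdef
  have hup : ∀ᶠ n in atTop, G.prio (π n) ≤ m := by
    by_contra hcon
    have hP : P (m + 1) := by
      refine (not_eventually.1 hcon).mono fun n hn => ?_
      exact Nat.lt_of_not_le hn
    have hle : m + 1 ≤ B := by
      obtain ⟨n, hn⟩ := hP.exists
      exact hn.trans (hB' _)
    have := Nat.le_findGreatest hle hP
    omega
  have hfr : ∃ᶠ n in atTop, G.prio (π n) = m :=
    (hm.and_eventually hup).mono fun n h => le_antisymm h.2 h.1
  rw [pathPrio_eq hup hfr]
  exact ⟨hup, hfr⟩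

theorem pathPrio_tail (π : ℕ → V) (N : ℕ) : G.pathPrio (fun n => π (n + N)) = G.pathPrio π :=
  limsup_nat_add (fun i => G.prio (π i)) N

/-! ### Dominions against arbitrary opponents -/

/-- `π` is an infinite path in `D` on which player `p` follows the strategy `s`. -/
structure ConsistentPath (G : ParityGame V) (D : Set V) (p : Player) (s : V → V) (π : ℕ → V) :
    Prop where
  mem : ∀ n, π n ∈ D
  move : ∀ n, G.move (π n) (π (n + 1))
  own : ∀ n, G.owner (π n) = p → π (n + 1) = s (π n)

theorem ConsistentPath.tail {D : Set V} {p : Player} {s : V → V} {π : ℕ → V}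
    (h : G.ConsistentPath D p s π) (N : ℕ) : G.ConsistentPath D p s (fun n => π (n + N)) where
  mem n := h.mem _
  move n := by have := h.move (n + N); rwa [add_right_comm] at this
  own n ho := by have := h.own (n + N) ho; rwa [add_right_comm] at this

/-- `D` is closed under the moves of the opponent in `U`, and player `p` has a positional strategy
on `D` that wins every path, whatever the opponent does. -/
def StrongDominion (G : ParityGame V) (U : Set V) (p : Player) (D : Set V) : Prop :=
  D ⊆ U ∧
  (∀ v ∈ D, G.owner v ≠ p → ∀ w ∈ U, G.move v w → w ∈ D) ∧
  ∃ s, G.IsStrategy D p s ∧ ∀ π, G.ConsistentPath D p s π → (G.pathPrio π : Player) = p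

theorem StrongDominion.isDominion {U D : Set V} {p : Player} (h : G.StrongDominion U p D) :
    G.IsDominion U p D := by
  obtain ⟨h1, h2, s, hs, hw⟩ := h
  refine ⟨h1, h2, s, hs, fun t ht v hv => hw _ ?_⟩
  have hmem : ∀ n, G.play p s t v n ∈ D := by
    intro n
    induction n with
    | zero => exact hv
    | succ n ih =>
      rw [play]
      split_ifs with ho
      · exact (hs _ ih ho).1
      · exact (ht _ ih (player_eq_of_ne ho)).1
  refine ⟨hmem, fun n => ?_, fun n ho => ?_⟩
  · rw [play]
    split_ifs with ho
    · exact (hs _ (hmem n) ho).2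
    · exact (ht _ (hmem n) (player_eq_of_ne ho)).2
  · rw [play, if_pos ho]

theorem strongDominion_empty (U : Set V) (p : Player) : G.StrongDominion U p ∅ :=
  ⟨Set.empty_subset _, fun _ h => h.elim, id, fun _ h => h.elim, fun _ h => (h.mem 0).elim⟩

/-- From a common position both winning strategies can be followed at once. The play stays in `D ∩
E` and would be won by both players. -/
theorem disjoint_dominion {U D E : Set V} {p : Player} (hU : G.IsSubgame U)
    (hD : G.IsDominion U p D) (hE : G.StrongDominion U (p + 1) E) : Disjoint D E := by
  classical
  rw [Set.disjoint_left]
  intro v hvD hvE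
  obtain ⟨hDU, hDc, s, hs, hsw⟩ := hD
  obtain ⟨hEU, hEc, r, hr, hrw⟩ := hE
  have hmv : ∀ u, ∃ w, u ∈ U → w ∈ U ∧ G.move u w := by
    intro u
    by_cases hu : u ∈ U
    · obtain ⟨w, hw⟩ := hU u hu
      exact ⟨w, fun _ => hw⟩
    · exact ⟨u, fun h => absurd h hu⟩
  choose f hf using hmv
  -- A dominion is tested only against strategies defined on all of `D`, so `r` is extended by
  -- arbitrary moves outside `E`.
  let t : V → V := fun u => if u ∈ E then r u else f u
  have htm : ∀ u ∈ D, G.owner u = p + 1 → t u ∈ U ∧ G.move u (t u) := by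
    intro u hu ho
    by_cases hE : u ∈ E
    · simp only [t, if_pos hE]
      exact ⟨hEU (hr u hE ho).1, (hr u hE ho).2⟩
    · simp only [t, if_neg hE]
      exact hf u (hDU hu)
  have ht : G.IsStrategy D (p + 1) t := by
    intro u hu ho
    obtain ⟨h1, h2⟩ := htm u hu ho
    exact ⟨hDc u hu (by rw [ho]; exact player_succ_ne p) _ h1 h2, h2⟩
  have hmem : ∀ n, G.play p s t v n ∈ D ∧ G.play p s t v n ∈ E := by
    intro n
    induction n with
    | zero => exact ⟨hvD, hvE⟩
    | succ n ih =>
      rw [play]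
      split_ifs with ho
      · obtain ⟨h1, h2⟩ := hs _ ih.1 ho
        exact ⟨h1, hEc _ ih.2 (by rw [ho]; exact (player_succ_ne p).symm) _ (hDU h1) h2⟩
      · have ho' := player_eq_of_ne ho
        refine ⟨(ht _ ih.1 ho').1, ?_⟩
        simp only [t, if_pos ih.2]
        exact (hr _ ih.2 ho').1
  have hpath : G.ConsistentPath E (p + 1) r (G.play p s t v) := by
    refine ⟨fun n => (hmem n).2, fun n => ?_, fun n ho => ?_⟩
    · rw [play]
      split_ifs with ho
      · exact (hs _ (hmem n).1 ho).2
      · exact (ht _ (hmem n).1 (player_eq_of_ne ho)).2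
    · rw [play, if_neg (by rw [ho]; exact player_succ_ne p)]
      simp only [t, if_pos (hmem n).2]
  have h1 := hsw t ht v hvD
  have h2 := hrw _ hpath
  exact player_succ_ne p (h2.symm.trans h1)

/-- `W` consists of complementary winning regions of the subgame `U`. -/
def IsSolution (G : ParityGame V) (U : Set V) (W : Player → Set V) : Prop :=
  (∀ p, G.StrongDominion U p (W p)) ∧ ∀ p, U ⊆ W p ∪ W (p + 1)

/-- Every `p`-dominion avoids `W (p + 1)` and therefore lies in `W p`. This reconciles `win`,
defined with positional opponents, with strategies that beat arbitrary paths, and makes solutions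
unique. -/
theorem IsSolution.win_eq {U : Set V} {W : Player → Set V} (hU : G.IsSubgame U)
    (h : G.IsSolution U W) (p : Player) : G.win U p = W p := by
  refine Set.Subset.antisymm ?_ (Set.subset_sUnion_of_mem (h.1 p).isDominion)
  rintro v ⟨D, hD, hv⟩
  have hdis := Set.disjoint_left.1 (disjoint_dominion hU hD (h.1 (p + 1))) hv
  exact (h.2 p (hD.1 hv)).resolve_right hdis

theorem IsSolution.unique {U : Set V} {W W' : Player → Set V} (hU : G.IsSubgame U)
    (h : G.IsSolution U W) (h' : G.IsSolution U W') : W = W' := by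
  funext p
  rw [← h.win_eq hU, ← h'.win_eq hU]

theorem IsSolution.subset {U : Set V} {W : Player → Set V}
    (h : G.IsSolution U W) (p : Player) : W p ⊆ U := (h.1 p).1

theorem IsSolution.notMem {U : Set V} {W : Player → Set V} (hU : G.IsSubgame U)
    (h : G.IsSolution U W) {p : Player} {v : V} (hv : v ∈ W p) : v ∉ W (p + 1) :=
  Set.disjoint_left.1 (disjoint_dominion hU (h.1 p).isDominion (h.1 (p + 1))) hv

theorem IsSolution.mem_of_notMem {U : Set V} {W : Player → Set V}
    (h : G.IsSolution U W) {p : Player} {v : V} (hU : v ∈ U) (hv : v ∉ W p) : v ∈ W (p + 1) :=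
  (h.2 p hU).resolve_left hv

theorem isSolution_of {U : Set V} {W : Player → Set V} (p : Player)
    (h1 : G.StrongDominion U p (W p)) (h2 : G.StrongDominion U (p + 1) (W (p + 1)))
    (h : U ⊆ W p ∪ W (p + 1)) : G.IsSolution U W := by
  have key : ∀ q : Player, q = p ∨ q = p + 1 := fun q =>
    (eq_or_ne q p).imp_right player_eq_of_ne
  refine ⟨fun q => ?_, fun q => ?_⟩
  · rcases key q with rfl | rfl <;> assumption
  · rcases key q with rfl | rfl
    · assumption
    · rw [player_add_two, Set.union_comm]; exact h

theorem isSolution_empty : G.IsSolution ∅ (fun _ => ∅) :=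
  ⟨fun p => strongDominion_empty _ p, fun _ => Set.empty_subset _⟩

/-! ### Composing dominions -/

/-- A path that follows attractor moves reaches the target. -/
theorem exists_mem_of_rank {X A : Set V} {π : ℕ → V} {rank : V → ℕ}
    (h : ∀ n, π n ∈ A → π n ∉ X → π (n + 1) ∈ A ∧ rank (π (n + 1)) < rank (π n)) {N : ℕ}
    (hN : π N ∈ A) : ∃ n, N ≤ n ∧ π n ∈ X := by
  by_contra hcon
  push Not at hcon
  have key : ∀ i, π (N + i) ∈ A ∧ rank (π (N + i)) + i ≤ rank (π N) := by
    intro i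
    induction i with
    | zero => exact ⟨hN, le_rfl⟩
    | succ i ih =>
      obtain ⟨h1, h2⟩ := h (N + i) ih.1 (hcon _ (by omega))
      refine ⟨h1, ?_⟩
      have := ih.2
      rw [show N + (i + 1) = N + i + 1 from rfl]
      omega
  have := (key (rank (π N) + 1)).2
  omega

theorem ConsistentPath.stays {U D : Set V} {p : Player} {s : V → V}
    (hDc : ∀ v ∈ D, G.owner v ≠ p → ∀ w ∈ U, G.move v w → w ∈ D)
    (hs : G.IsStrategy D p s) {r : V → V} (hr : ∀ v ∈ D, r v = s v) {π : ℕ → V}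
    (hπ : G.ConsistentPath U p r π) {N : ℕ} (hN : π N ∈ D) :
    G.ConsistentPath D p s (fun n => π (n + N)) := by
  have hmem : ∀ n, π (n + N) ∈ D := by
    intro n
    induction n with
    | zero => simpa using hN
    | succ n ih =>
      rw [add_right_comm]
      by_cases ho : G.owner (π (n + N)) = p
      · rw [hπ.own _ ho, hr _ ih]
        exact (hs _ ih ho).1
      · exact hDc _ ih ho _ (hπ.mem _) (hπ.move _)
  have := hπ.tail N
  exact ⟨hmem, this.move, fun n ho => (this.own n ho).trans (hr _ (hmem n))⟩

theorem ConsistentPath.mono {U D : Set V} {p : Player} {s : V → V} {π : ℕ → V}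
    (h : G.ConsistentPath D p s π) (hD : D ⊆ U) : G.ConsistentPath U p s π :=
  ⟨fun n => hD (h.mem n), h.move, h.own⟩

theorem StrongDominion.attr [Finite V] {U D : Set V} {p : Player} (h : G.StrongDominion U p D) :
    G.StrongDominion U p (G.attr U p D) := by
  classical
  obtain ⟨hDU, hDc, s, hs, hw⟩ := h
  obtain ⟨a, rank, ha⟩ := G.exists_attr_strategy U p D
  have hsub : D ⊆ G.attr U p D := fun v hv => subset_attr U p D ⟨hv, hDU hv⟩
  refine ⟨attr_subset U p D, ?_, fun v => if v ∈ D then s v else a v, ?_, ?_⟩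
  · intro v hv ho w hw hm
    by_cases hD : v ∈ D
    · exact hsub (hDc v hD ho w hw hm)
    · exact ((ha v hv hD).2 ho w hw hm).1
  · intro v hv ho
    by_cases hD : v ∈ D
    · simp only [if_pos hD]
      exact ⟨hsub (hs v hD ho).1, (hs v hD ho).2⟩
    · simp only [if_neg hD]
      exact ⟨((ha v hv hD).1 ho).1, ((ha v hv hD).1 ho).2.1⟩
  · intro π hπ
    obtain ⟨n, -, hn⟩ := exists_mem_of_rank (X := D) (A := G.attr U p D) (rank := rank) (π := π)
      (N := 0) (by
        intro n hn hD
        by_cases ho : G.owner (π n) = p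
        · rw [hπ.own n ho, if_neg hD]
          exact ⟨((ha _ hn hD).1 ho).1, ((ha _ hn hD).1 ho).2.2⟩
        · exact (ha _ hn hD).2 ho _ (attr_subset U p D (hπ.mem _)) (hπ.move n)) (hπ.mem 0)
    rw [← pathPrio_tail π n]
    exact hw _ (ConsistentPath.stays hDc hs (fun v hv => if_pos hv) (hπ.mono (attr_subset U p D)) hn)

/-- The union of a dominion `D` of `U` and a dominion `R` of a subgame `U'` that the opponent can
leave only towards `D`. -/
theorem StrongDominion.union {U U' D R : Set V} {p : Player} (hU : U' ⊆ U)
    (hD : G.StrongDominion U p D) (hR : G.StrongDominion U' p R)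
    (hesc : ∀ v ∈ R, G.owner v ≠ p → ∀ w ∈ U, G.move v w → w ∈ U' ∪ D) :
    G.StrongDominion U p (D ∪ R) := by
  classical
  obtain ⟨hDU, hDc, s, hs, hw⟩ := hD
  obtain ⟨hRU, hRc, r, hr, hrw⟩ := hR
  have hsub : D ∪ R ⊆ U := Set.union_subset hDU (hRU.trans hU)
  refine ⟨hsub, ?_, fun v => if v ∈ D then s v else r v, ?_, ?_⟩
  · intro v hv ho w hw hm
    by_cases hvD : v ∈ D
    · exact Or.inl (hDc v hvD ho w hw hm)
    · have hvR := hv.resolve_left hvD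
      rcases hesc v hvR ho w hw hm with h | h
      · exact Or.inr (hRc v hvR ho w h hm)
      · exact Or.inl h
  · intro v hv ho
    by_cases hvD : v ∈ D
    · simp only [if_pos hvD]
      exact ⟨Or.inl (hs v hvD ho).1, (hs v hvD ho).2⟩
    · simp only [if_neg hvD]
      have hvR := hv.resolve_left hvD
      exact ⟨Or.inr (hr v hvR ho).1, (hr v hvR ho).2⟩
  · intro π hπ
    by_cases hex : ∃ N, π N ∈ D
    · obtain ⟨N, hN⟩ := hex
      rw [← pathPrio_tail π N]
      exact hw _ (ConsistentPath.stays hDc hs (fun v hv => if_pos hv) (hπ.mono hsub) hN)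
    · push Not at hex
      refine hrw π ⟨fun n => (hπ.mem n).resolve_left (hex n), hπ.move, fun n ho => ?_⟩
      rw [hπ.own n ho, if_neg (hex n)]

theorem StrongDominion.of_trap {U U' R : Set V} {p : Player} (hU : U' ⊆ U)
    (hR : G.StrongDominion U' p R)
    (hesc : ∀ v ∈ R, G.owner v ≠ p → ∀ w ∈ U, G.move v w → w ∈ U') :
    G.StrongDominion U p R := by
  have := (strongDominion_empty U p).union hU hR
    (fun v hv ho w hw hm => Or.inl (hesc v hv ho w hw hm))
  rwa [Set.empty_union] at this

theorem prio_le_maxPrio [Finite V] {U : Set V} {v : V} (hv : v ∈ U) : G.prio v ≤ G.maxPrio U :=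
  le_csSup ((Set.toFinite U).image G.prio).bddAbove ⟨v, hv, rfl⟩

/-- If the opponent `q` of the player `p` of the maximal priority cannot extend its winning region
of the left subgame, then `p` wins everywhere else. -/
theorem strongDominion_of_left [Finite V] {U : Set V} {p : Player} (hU : G.IsSubgame U)
    (hp : (G.maxPrio U : Player) = p) {W : Player → Set V}
    (hW : G.IsSolution (U \ G.attr U p (G.topPos U)) W)
    (hpre : G.pre U (p + 1) (W (p + 1)) ⊆ W (p + 1)) :
    G.StrongDominion U p (U \ W (p + 1)) := by
  classical
  have hL := isSubgame_diff_attr hU p (G.topPos U)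
  obtain ⟨hDU, hDc, s, hs, hw⟩ := hW.1 p
  obtain ⟨a, rank, ha⟩ := G.exists_attr_strategy U p (G.topPos U)
  have hAq : ∀ v ∈ G.attr U p (G.topPos U), v ∉ W (p + 1) := fun v hv h =>
    (hW.subset _ h).2 hv
  have hAU := attr_subset (G := G) U p (G.topPos U)
  have hc : ∀ v ∈ U \ W (p + 1), G.owner v ≠ p → ∀ w ∈ U, G.move v w → w ∈ U \ W (p + 1) :=
    fun v hv ho w hw hm => ⟨hw, fun h =>
      hv.2 (hpre (Or.inl ⟨hv.1, player_eq_of_ne ho, w, hw, hm, h⟩))⟩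
  have hex : ∀ v, ∃ w, v ∈ U \ W (p + 1) → G.owner v = p → w ∈ U \ W (p + 1) ∧ G.move v w := by
    intro v
    by_cases h : v ∈ U \ W (p + 1) ∧ G.owner v = p
    · by_contra hcon
      push Not at hcon
      refine h.1.2 (hpre (Or.inr ⟨h.1.1, ?_, fun w hw hm => ?_⟩))
      · rw [h.2]; exact (player_succ_ne p).symm
      · by_contra hwW
        exact (hcon w).2.2 ⟨hw, hwW⟩ hm
    · exact ⟨v, fun a b => absurd ⟨a, b⟩ h⟩
  choose f hf using hex
  -- Three regimes: win inside `W p`, approach the maximal priority inside the attractor, and at a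
  -- maximal position make any move that avoids `W (p + 1)`.
  let r : V → V := fun v => if v ∈ W p then s v else if v ∈ G.topPos U then f v else a v
  have hWpA : ∀ v ∈ W p, v ∉ G.attr U p (G.topPos U) := fun v hv => (hDU hv).2
  have hcase : ∀ v ∈ U \ W (p + 1), v ∉ W p → v ∈ G.attr U p (G.topPos U) := by
    intro v hv hn
    by_contra hA
    exact hv.2 (hW.mem_of_notMem ⟨hv.1, hA⟩ hn)
  refine ⟨Set.sdiff_subset, hc, r, ?_, ?_⟩
  · intro v hv ho
    by_cases h1 : v ∈ W p
    · simp only [r, if_pos h1]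
      obtain ⟨h2, h3⟩ := hs v h1 ho
      exact ⟨⟨(hDU h2).1, hW.notMem hL h2⟩, h3⟩
    by_cases h2 : v ∈ G.topPos U
    · simp only [r, if_neg h1, if_pos h2]
      exact hf v hv ho
    · simp only [r, if_neg h1, if_neg h2]
      obtain ⟨h3, h4, -⟩ := (ha v (hcase v hv h1) h2).1 ho
      exact ⟨⟨hAU h3, hAq _ h3⟩, h4⟩
  · intro π hπ
    by_cases hfr : ∃ᶠ n in atTop, π n ∈ G.topPos U
    · rw [pathPrio_eq (m := G.maxPrio U) (Eventually.of_forall fun n => prio_le_maxPrio (hπ.mem n).1)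
        (hfr.mono fun n h => h.2)]
      exact hp
    · rw [not_frequently, eventually_atTop] at hfr
      obtain ⟨N, hN⟩ := hfr
      have hstep : ∀ n, π n ∈ G.attr U p (G.topPos U) → π n ∉ G.topPos U →
          π (n + 1) ∈ G.attr U p (G.topPos U) ∧ rank (π (n + 1)) < rank (π n) := by
        intro n hn hX
        have hnW : π n ∉ W p := fun h => hWpA _ h hn
        by_cases ho : G.owner (π n) = p
        · rw [hπ.own n ho]
          simp only [r, if_neg hnW, if_neg hX]
          exact ⟨((ha _ hn hX).1 ho).1, ((ha _ hn hX).1 ho).2.2⟩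
        · exact (ha _ hn hX).2 ho _ (hπ.mem _).1 (hπ.move n)
      have hWp : ∀ n, π (n + N) ∈ W p := by
        intro n
        by_contra hn
        obtain ⟨m, hm, hX⟩ := exists_mem_of_rank hstep (hcase _ (hπ.mem _) hn)
        exact hN m (by omega) hX
      rw [← pathPrio_tail π N]
      have ht := hπ.tail N
      refine hw _ ⟨hWp, ht.move, fun n ho => ?_⟩
      rw [ht.own n ho]
      exact if_pos (hWp n)

theorem isSubgame_of_terminal {U C : Set V} (hU : G.IsSubgame U) (hC : G.IsTerminalSCC U C) :
    G.IsSubgame C := by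
  intro v hv
  obtain ⟨w, hw, hm⟩ := hU v (hC.1 hv)
  exact ⟨w, hC.2.2 v hv w hw hm, hm⟩

/-- The left subgame of `U`. -/
def leftGame (G : ParityGame V) (U : Set V) : Set V :=
  G.minus U (G.attr U (G.maxPrio U : Player) (G.topPos U))

/-- The right subgame of `U`, if the opponent wins `W` in the left subgame. -/
def rightGame (G : ParityGame V) (U W : Set V) : Set V :=
  G.minus U (G.attr U ((G.maxPrio U : Player) + 1) W)

/-- The residual subgame of `U` after its component `C` was solved with winning regions `W`. -/
def restGame (G : ParityGame V) (U C : Set V) (W : Player → Set V) : Set V :=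
  G.minus U (C ∪ G.attr U 0 (W 0) ∪ G.attr U 1 (W 1))

section Correctness

variable {U : Set V} {W : Player → Set V}

/-- Player `p` cannot move from outside its own attractor into it, so what `p + 1` wins in the left
subgame it also wins in `U`. -/
theorem left_attr_dominion {p : Player}
    (hW : G.IsSolution (U \ G.attr U p (G.topPos U)) W) :
    G.StrongDominion U (p + 1) (W (p + 1)) := by
  refine (hW.1 (p + 1)).of_trap Set.sdiff_subset fun v hv ho w hw hm => ⟨hw, ?_⟩
  have hv' := hW.subset _ hv
  exact own_move_notMem_attr hv'.1 hv'.2 ((player_eq_of_ne ho).trans (player_add_two p)) hm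

variable [Finite V]

open Classical in
theorem isSolution_left (hU : G.IsSubgame U)
    (hW : G.IsSolution (G.leftGame U) W)
    (hpre : G.pre U ((G.maxPrio U : Player) + 1) (W ((G.maxPrio U : Player) + 1)) \
      W ((G.maxPrio U : Player) + 1) = ∅) :
    G.IsSolution U (fun r => if r = (G.maxPrio U : Player) + 1
      then W ((G.maxPrio U : Player) + 1) else U \ W ((G.maxPrio U : Player) + 1)) := by
  rw [leftGame, minus_attr hU] at hW
  generalize hp : (G.maxPrio U : Player) = p at *
  refine isSolution_of p ?_ ?_ ?_
  · simp only [(player_succ_ne p).symm, if_false]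
    exact strongDominion_of_left hU hp hW (Set.sdiff_eq_empty.1 hpre)
  · simp only [if_true]
    exact left_attr_dominion hW
  · intro v hv
    simp only [(player_succ_ne p).symm, if_false, if_true]
    by_cases h : v ∈ W (p + 1)
    · exact Or.inr h
    · exact Or.inl ⟨hv, h⟩

open Classical in
-- The opponent wins the removed attractor together with its part of the right subgame. The region
-- of `p` there is safe, since the opponent cannot step back into its own attractor.
theorem isSolution_right (hU : G.IsSubgame U) {W' : Player → Set V}
    (hW : G.IsSolution (G.leftGame U) W)
    (hW' : G.IsSolution (G.rightGame U (W ((G.maxPrio U : Player) + 1))) W') :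
    G.IsSolution U (fun r => if r = (G.maxPrio U : Player)
      then W' (G.maxPrio U : Player) else U \ W' (G.maxPrio U : Player)) := by
  rw [leftGame, minus_attr hU] at hW
  rw [rightGame, minus_attr hU] at hW'
  generalize hp : (G.maxPrio U : Player) = p at *
  have hdom := (left_attr_dominion hW).attr
  set A := G.attr U (p + 1) (W (p + 1)) with hA
  have hsub := isSubgame_diff_attr (G := G) hU (p + 1) (W (p + 1))
  have hD : G.StrongDominion U (p + 1) (A ∪ W' (p + 1)) := by
    refine hdom.union Set.sdiff_subset (hW'.1 (p + 1)) fun v _ _ w hw _ => ?_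
    by_cases h : w ∈ A
    · exact Or.inr h
    · exact Or.inl ⟨hw, h⟩
  have he : U \ W' p = A ∪ W' (p + 1) := by
    ext v
    constructor
    · rintro ⟨hv, hn⟩
      by_cases h : v ∈ A
      · exact Or.inl h
      · exact Or.inr (hW'.mem_of_notMem ⟨hv, h⟩ hn)
    · intro hv
      refine ⟨hD.1 hv, fun h => ?_⟩
      rcases hv with hv | hv
      · exact (hW'.subset _ h).2 hv
      · exact hW'.notMem hsub h hv
  refine isSolution_of p ?_ ?_ ?_
  · simp only [if_true]
    refine (hW'.1 p).of_trap Set.sdiff_subset fun v hv ho w hw hm => ⟨hw, ?_⟩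
    have hv' := hW'.subset _ hv
    exact own_move_notMem_attr hv'.1 hv'.2 (player_eq_of_ne ho) hm
  · simp only [player_succ_ne p, if_false]
    rw [he]
    exact hD
  · intro v hv
    simp only [player_succ_ne p, if_false, if_true]
    by_cases h : v ∈ W' p
    · exact Or.inl h
    · exact Or.inr ⟨hv, h⟩

/-- No move leaves a terminal component, so dominions of `C` are dominions of `U`, and so are their
attractors. In the rest the opponent of `p` can escape only into the attractor of `p`, where `p`
wins anyway. -/
theorem isSolution_rest (hU : G.IsSubgame U) {C : Set V} {W' : Player → Set V}
    (hC : G.IsTerminalSCC U C) (hW : G.IsSolution C W)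
    (hW' : G.IsSolution (G.restGame U C W) W') :
    G.IsSolution U (fun r => G.attr U r (W r) ∪ W' r) := by
  have hdom : ∀ p, G.StrongDominion U p (G.attr U p (W p)) := fun p =>
    ((hW.1 p).of_trap hC.1 fun v hv _ w hw hm =>
      hC.2.2 v (hW.subset p hv) w hw hm).attr
  have hdisj : ∀ p v, v ∈ G.attr U p (W p) → v ∉ G.attr U (p + 1) (W (p + 1)) := fun p v hv =>
    Set.disjoint_left.1 (disjoint_dominion hU (hdom p).isDominion (hdom (p + 1))) hv
  have hcover : ∀ p v, v ∈ U \ (C ∪ G.attr U 0 (W 0) ∪ G.attr U 1 (W 1)) ↔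
      v ∈ U ∧ v ∉ G.attr U p (W p) ∧ v ∉ G.attr U (p + 1) (W (p + 1)) := by
    intro p v
    have h01 : (v ∉ G.attr U 0 (W 0) ∧ v ∉ G.attr U 1 (W 1)) ↔
        (v ∉ G.attr U p (W p) ∧ v ∉ G.attr U (p + 1) (W (p + 1))) := by
      have hp : p = 0 ∨ p = 1 := by revert p; decide
      rcases hp with rfl | rfl
      · rfl
      · rw [show (1 : Player) + 1 = 0 from rfl]; exact and_comm
    rw [← h01]
    constructor
    · rintro ⟨h, hn⟩
      exact ⟨h, fun h0 => hn (Or.inl (Or.inr h0)), fun h1 => hn (Or.inr h1)⟩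
    · rintro ⟨h, h0, h1⟩
      refine ⟨h, ?_⟩
      rintro ((hvC | hv) | hv)
      · rcases hW.2 0 hvC with h2 | h2
        · exact h0 (subset_attr U 0 _ ⟨h2, h⟩)
        · exact h1 (subset_attr U 1 _ ⟨h2, h⟩)
      · exact h0 hv
      · exact h1 hv
  -- An owner outside both attractors has no move into its own attractor and some move that avoids
  -- the other one; `C` is covered by the two attractors.
  have hsub : G.IsSubgame (U \ (C ∪ G.attr U 0 (W 0) ∪ G.attr U 1 (W 1))) := by
    intro v hv
    obtain ⟨hvU, h0, h1⟩ := (hcover (G.owner v) v).1 hv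
    obtain ⟨w, hw, hm, hn⟩ := exists_opp_move_notMem_attr hvU h1
      (player_succ_ne (G.owner v)).symm
    exact ⟨w, (hcover (G.owner v) w).2 ⟨hw, own_move_notMem_attr hvU h0 rfl hm, hn⟩, hm⟩
  rw [restGame, minus_eq_diff hsub] at hW'
  refine ⟨fun p => ?_, fun p v hv => ?_⟩
  · refine (hdom p).union Set.sdiff_subset (hW'.1 p) fun v hv ho w hw hm => ?_
    by_cases h : w ∈ G.attr U p (W p)
    · exact Or.inr h
    · obtain ⟨hvU, -, h1⟩ := (hcover p v).1 (hW'.subset _ hv)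
      exact Or.inl ((hcover p w).2
        ⟨hw, h, own_move_notMem_attr hvU h1 (player_eq_of_ne ho) hm⟩)
  · by_cases h0 : v ∈ G.attr U p (W p)
    · exact Or.inl (Or.inl h0)
    by_cases h1 : v ∈ G.attr U (p + 1) (W (p + 1))
    · exact Or.inr (Or.inl h1)
    exact (hW'.2 p ((hcover p v).2 ⟨hv, h0, h1⟩)).imp Or.inr Or.inr

end Correctness

/-! ### Runs of the algorithm -/

namespace RunState

/-- `U` is solved in the state `s`. -/
def Done (s : RunState V) (U : Set V) : Prop := U = ∅ ∨ ∃ W, s.table U = some W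

/-- `s'` extends `s`. -/
structure Extends (s s' : RunState V) : Prop where
  done : ∀ U W, s.table U = some W → ∃ W', s'.table U = some W'
  calls : ∀ U ∈ s.calls, U ∈ s'.calls

theorem Extends.refl (s : RunState V) : s.Extends s := ⟨fun _ W h => ⟨W, h⟩, fun _ h => h⟩

theorem Extends.trans {s t u : RunState V} (h : s.Extends t) (h' : t.Extends u) : s.Extends u :=
  ⟨fun U W hW => by obtain ⟨W', h1⟩ := h.done U W hW; exact h'.done U W' h1,
    fun U hU => h'.calls U (h.calls U hU)⟩

theorem Extends.mono_done {s t : RunState V} (h : s.Extends t) {U : Set V} (hU : s.Done U) :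
    t.Done U :=
  hU.imp_right fun ⟨W, hW⟩ => h.done U W hW

theorem extends_log (s : RunState V) (U : Set V) : s.Extends (s.log U) :=
  ⟨fun _ W h => ⟨W, h⟩, fun _ h => List.mem_cons_of_mem _ h⟩

theorem extends_record (s : RunState V) (U : Set V) (W : Player → Set V) :
    s.Extends (s.record U W) := by
  classical
  refine ⟨fun U' W' h => ?_, fun _ h => h⟩
  by_cases he : U' = U
  · subst he
    exact ⟨W, by simp [record]⟩
  · exact ⟨W', by simp [record, he, h]⟩

theorem done_record (s : RunState V) (U : Set V) (W : Player → Set V) :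
    (s.record U W).Done U := by
  exact Or.inr ⟨W, by simp [record]⟩

end RunState

/-- The subgames on which the solution of `U` depends are solved in the state `s`, and the
call on `U` is executed if `U` is a single component. -/
structure Explored (G : ParityGame V) (s : RunState V) (U : Set V) : Prop where
  call : G.StronglyConnected U → U ∈ s.calls
  left : G.StronglyConnected U → s.Done (G.leftGame U)
  right : G.StronglyConnected U → ∀ W, G.IsSolution (G.leftGame U) W →
    (G.pre U ((G.maxPrio U : Player) + 1) (W ((G.maxPrio U : Player) + 1)) \
      W ((G.maxPrio U : Player) + 1)).Nonempty →
    s.Done (G.rightGame U (W ((G.maxPrio U : Player) + 1)))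
  comp : U ≠ ∅ → ¬ G.StronglyConnected U → ∃ C W, G.IsTerminalSCC U C ∧ s.Done C ∧
    G.IsSolution C W ∧ s.Done (G.restGame U C W)

theorem Explored.mono {s t : RunState V} (h : s.Extends t) {U : Set V} (hU : G.Explored s U) :
    G.Explored t U where
  call hs := h.calls U (hU.call hs)
  left hs := h.mono_done (hU.left hs)
  right hs W hW hne := h.mono_done (hU.right hs W hW hne)
  comp h0 hs := by
    obtain ⟨C, W, h1, h2, h3, h4⟩ := hU.comp h0 hs
    exact ⟨C, W, h1, h.mono_done h2, h3, h.mono_done h4⟩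

/-- All entries of the table are correct and explored. -/
def ValidState (G : ParityGame V) (s : RunState V) : Prop :=
  ∀ U W, s.table U = some W → G.IsSolution U W ∧ G.Explored s U

theorem validState_init : G.ValidState RunState.init := fun _ _ h => by
  simp [RunState.init] at h

theorem ValidState.log {s : RunState V} (h : G.ValidState s) (U : Set V) :
    G.ValidState (s.log U) := fun U' W hW =>
  ⟨(h U' W hW).1, (h U' W hW).2.mono (s.extends_log U)⟩

theorem ValidState.record {s : RunState V} (h : G.ValidState s) {U : Set V} {W : Player → Set V}
    (hW : G.IsSolution U W) (hU : G.Explored s U) : G.ValidState (s.record U W) := by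
  classical
  intro U' W' hW'
  by_cases he : U' = U
  · subst he
    have : W' = W := by simpa [RunState.record, eq_comm] using hW'
    subst this
    exact ⟨hW, hU.mono (s.extends_record _ _)⟩
  · have : s.table U' = some W' := by simpa [RunState.record, he] using hW'
    exact ⟨(h U' W' this).1, (h U' W' this).2.mono (s.extends_record _ _)⟩

/-- The outcome of a run on `U` from the state `s`. -/
structure GoodRun (G : ParityGame V) (U : Set V) (s : RunState V)
    (r : (Player → Set V) × RunState V) : Prop where
  sol : G.IsSolution U r.1
  ext : s.Extends r.2
  valid : G.ValidState r.2
  done : r.2.Done U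

/-- Starting from an arbitrary valid state is what makes the induction on the size of `U` go
through: the second recursive call begins with the table left by the first, and a looked-up entry is
correct and explored by validity. -/
theorem goodRun_solve [Finite V] (σ : G.SCCRule) (memo : Bool) (U : Set V) (s : RunState V)
    (hU : G.IsSubgame U) (hs : G.ValidState s) : G.GoodRun U s (G.solve σ memo U s) := by
  classical
  induction hn : U.ncard using Nat.strong_induction_on generalizing U s with
  | _ n ih =>
  subst hn
  rw [solve]
  split
  · rename_i W hW
    have hW' : s.table U = some W := by
      cases memo <;> simp_all
    exact ⟨(hs U W hW').1, RunState.Extends.refl s, hs, Or.inr ⟨W, hW'⟩⟩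
  · split_ifs with h0 hsc
    · subst h0
      exact ⟨isSolution_empty, RunState.Extends.refl s, hs, Or.inl rfl⟩
    · dsimp only
      split_ifs with hp
      · have hl := ih _ (G.left_ncard_lt h0 _) (G.leftGame U) (s.log U) (isSubgame_minus _ _)
          (hs.log U) rfl
        have hsol := isSolution_left hU hl.sol hp
        have hexp : G.Explored (G.solve σ memo (G.leftGame U) (s.log U)).2 U := by
          refine ⟨fun _ => hl.ext.calls U (List.mem_cons_self ..), fun _ => hl.done,
            fun _ W hW hne => ?_, fun _ h => absurd hsc h⟩
          -- Uniqueness of the solution turns the test on the computed regions into a test on any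
          -- solution `W`.
          rw [hW.unique (isSubgame_minus _ _) hl.sol] at hne
          exact absurd hp hne.ne_empty
        exact ⟨hsol, ((s.extends_log U).trans hl.ext).trans (RunState.extends_record _ _ _),
          hl.valid.record hsol hexp, RunState.done_record _ _ _⟩
      · have hl := ih _ (G.left_ncard_lt h0 _) (G.leftGame U) (s.log U) (isSubgame_minus _ _)
          (hs.log U) rfl
        have hr := ih _ (G.right_ncard_lt hp)
          (G.rightGame U ((G.solve σ memo (G.leftGame U) (s.log U)).1 ((G.maxPrio U : Player) + 1)))
          _ (isSubgame_minus _ _) hl.valid rfl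
        have hsol := isSolution_right hU hl.sol hr.sol
        refine ⟨hsol, (((s.extends_log U).trans hl.ext).trans hr.ext).trans
          (RunState.extends_record _ _ _), hr.valid.record hsol ?_, RunState.done_record _ _ _⟩
        refine ⟨fun _ => hr.ext.calls U (hl.ext.calls U (List.mem_cons_self ..)),
          fun _ => hr.ext.mono_done hl.done, fun _ W hW hne => ?_, fun _ h => absurd hsc h⟩
        rw [hW.unique (isSubgame_minus _ _) hl.sol]
        exact hr.done
    · have hC := σ.spec U (Set.nonempty_iff_ne_empty.2 h0)
      have hc := ih _ (G.scc_ncard_lt σ h0 hsc) (σ.pick U) s (isSubgame_of_terminal hU hC) hs rfl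
      have hr := ih _ (G.rest_ncard_lt σ h0 _ _)
        (G.restGame U (σ.pick U) (G.solve σ memo (σ.pick U) s).1)
        _ (isSubgame_minus _ _) hc.valid rfl
      have hsol := isSolution_rest hU hC hc.sol hr.sol
      refine ⟨hsol, (hc.ext.trans hr.ext).trans
        (RunState.extends_record _ _ _), hr.valid.record hsol ?_, RunState.done_record _ _ _⟩
      exact ⟨fun h => absurd h hsc, fun h => absurd h hsc, fun h => absurd h hsc,
        fun _ _ => ⟨σ.pick U, _, hC, hr.ext.mono_done hc.done, hc.sol, hr.done⟩⟩

/-- A family of subgames that contains the subgames on which its members depend. -/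
structure ExploredFamily (G : ParityGame V) (T : Set (Set V)) : Prop where
  left : ∀ U ∈ T, G.StronglyConnected U → (G.leftGame U).Nonempty → G.leftGame U ∈ T
  right : ∀ U ∈ T, G.StronglyConnected U → ∀ W, G.IsSolution (G.leftGame U) W →
    (G.pre U ((G.maxPrio U : Player) + 1) (W ((G.maxPrio U : Player) + 1)) \
      W ((G.maxPrio U : Player) + 1)).Nonempty →
    (G.rightGame U (W ((G.maxPrio U : Player) + 1))).Nonempty →
    G.rightGame U (W ((G.maxPrio U : Player) + 1)) ∈ T
  comp : ∀ U ∈ T, U.Nonempty → ¬ G.StronglyConnected U → ∃ C, G.IsTerminalSCC U C ∧ C ∈ T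

/-- The family `T` contains the residual subgames of its members. -/
def RestClosed (G : ParityGame V) (T : Set (Set V)) : Prop :=
  ∀ U ∈ T, U.Nonempty → ¬ G.StronglyConnected U → ∃ C W, G.IsTerminalSCC U C ∧
    G.IsSolution C W ∧ C ∈ T ∧ ((G.restGame U C W).Nonempty → G.restGame U C W ∈ T)

/-- The solved subgames of a run form an explored family whose single components are called. -/
theorem exists_exploredFamily [Finite V] (σ : G.SCCRule) (memo : Bool) [Nonempty V] :
    ∃ T, G.ExploredFamily T ∧ G.RestClosed T ∧ Set.univ ∈ T ∧
      {U | U ∈ T ∧ G.StronglyConnected U}.ncard ≤ G.distinctCalls σ memo := by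
  have h := goodRun_solve σ memo Set.univ RunState.init
    (fun v _ => by obtain ⟨w, hw⟩ := G.total v; exact ⟨w, trivial, hw⟩) validState_init
  set s := (G.solve σ memo Set.univ RunState.init).2 with hs
  have hd : ∀ {U : Set V}, U.Nonempty → s.Done U → ∃ W, s.table U = some W :=
    fun hne h => h.resolve_left hne.ne_empty
  have hrest : G.RestClosed {U | ∃ W, s.table U = some W} := by
    rintro U ⟨W', hW'⟩ hU hsc
    obtain ⟨C, W, h1, h2, h3, h4⟩ := (h.valid U W' hW').2.comp hU.ne_empty hsc
    exact ⟨C, W, h1, h3, hd h1.2.1.1 h2, fun hne => hd hne h4⟩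
  refine ⟨{U | ∃ W, s.table U = some W}, ⟨?_, ?_, ?_⟩, hrest, hd Set.univ_nonempty h.done, ?_⟩
  · rintro U ⟨W, hW⟩ hsc hne
    exact hd hne ((h.valid U W hW).2.left hsc)
  · rintro U ⟨W', hW'⟩ hsc W hW hp hne
    exact hd hne ((h.valid U W' hW').2.right hsc W hW hp)
  · intro U hUT hU hsc
    obtain ⟨C, W, h1, -, h3, -⟩ := hrest U hUT hU hsc
    exact ⟨C, h1, h3⟩
  · refine Set.ncard_le_ncard ?_ (List.finite_toSet _)
    rintro U ⟨⟨W, hW⟩, hsc⟩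
    exact (h.valid U W hW).2.call hsc

end ParityGame

/-! ### Positions, parities and moves of the SCC family -/

theorem player_zero_or_one (p : Player) : p = 0 ∨ p = 1 := by
  revert p; decide

theorem natCast_player_eq_iff (a b : ℕ) : (a : Player) = b ↔ a % 2 = b % 2 :=
  ZMod.natCast_eq_natCast_iff' a b 2

theorem natCast_player_eq_zero (a : ℕ) : (a : Player) = 0 ↔ a % 2 = 0 := by
  simpa using natCast_player_eq_iff a 0

theorem natCast_player_eq_one (a : ℕ) : (a : Player) = 1 ↔ a % 2 = 1 := by
  simpa using natCast_player_eq_iff a 1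

theorem natCast_player_succ_eq_zero (a : ℕ) : (a : Player) + 1 = 0 ↔ a % 2 = 1 := by
  have := natCast_player_eq_zero (a + 1)
  push_cast at this
  rw [this]; omega

theorem natCast_player_succ_eq_one (a : ℕ) : (a : Player) + 1 = 1 ↔ a % 2 = 0 := by
  have := natCast_player_eq_one (a + 1)
  push_cast at this
  rw [this]; omega

namespace SCCFamily

open Sum CorePos ParityGame

variable {k : ℕ}

/-- The additional positions `δ` and `δ'` have the same doubleton, of mixed parity, and different
owners. -/
def Partner (δ δ' : DeltaPos k) : Prop :=
  δ'.1.1 = δ.1.1 ∧ δ'.1.2.1 = δ.1.2.1 ∧ δ'.1.2.2 = δ.1.2.2 + 1 ∧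
    (δ.1.1.val : Player) ≠ (δ.1.2.1.val : Player)

theorem Partner.symm {δ δ' : DeltaPos k} (h : Partner δ δ') : Partner δ' δ := by
  obtain ⟨h1, h2, h3, h4⟩ := h
  refine ⟨h1.symm, h2.symm, ?_, ?_⟩
  · rw [h3, player_add_two]
  · rw [h1, h2]; exact h4

theorem Partner.owner {δ δ' : DeltaPos k} (h : Partner δ δ') : δ'.1.2.2 = δ.1.2.2 + 1 := h.2.2.1

theorem Partner.owner_one {δ δ' : DeltaPos k} (h : Partner δ δ') (h0 : δ.1.2.2 = 0) :
    δ'.1.2.2 = 1 := by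
  rw [h.owner, h0]; rfl

theorem Partner.owner_zero {δ δ' : DeltaPos k} (h : Partner δ δ') (h0 : δ.1.2.2 = 1) :
    δ'.1.2.2 = 0 := by
  rw [h.owner, h0]; rfl

theorem Partner.unique {δ δ' δ'' : DeltaPos k} (h : Partner δ δ') (h' : Partner δ δ'') :
    δ' = δ'' :=
  Subtype.ext (Prod.ext (h.1.trans h'.1.symm)
    (Prod.ext (h.2.1.trans h'.2.1.symm) (h.2.2.1.trans h'.2.2.1.symm)))

theorem Partner.gammaDelta_unique {δ δ' : DeltaPos k} (h : Partner δ δ') {i j : Fin (2 * k + 1)}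
    (hi : gammaDelta i δ) (hj : gammaDelta j δ) : i = j := by
  obtain ⟨hi, hi'⟩ := hi
  obtain ⟨hj, hj'⟩ := hj
  have h4 := h.2.2.2
  rcases hi with rfl | rfl <;> rcases hj with rfl | rfl
  · rfl
  · exact absurd (hi'.trans hj'.symm) h4
  · exact absurd (hj'.trans hi'.symm) h4
  · rfl

theorem exists_gammaDelta (δ : DeltaPos k) : ∃ i, gammaDelta i δ := by
  obtain ⟨⟨i, j, p⟩, h1, h2⟩ := δ
  by_cases hp : (i.val : Player) = p
  · exact ⟨i, Or.inl rfl, hp⟩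
  · refine ⟨j, Or.inr rfl, ?_⟩
    have key : ∀ a b p : Player, ¬ a = p → (a = b → p = a) → b = p := by decide
    exact key _ _ _ hp h2

theorem exists_delta_same {a b : Fin (2 * k + 1)} (hab : a ≠ b) (hp : a.val % 2 = b.val % 2) :
    ∃ δ : DeltaPos k, gammaDelta a δ ∧ gammaDelta b δ ∧ (∀ i, gammaDelta i δ → i = a ∨ i = b) ∧
      ∀ δ', ¬ Partner δ δ' := by
  have hp' := (natCast_player_eq_iff _ _).2 hp
  rcases lt_or_gt_of_ne hab with h | h
  · exact ⟨⟨(a, b, (a.val : Player)), h, fun _ => rfl⟩, ⟨Or.inl rfl, rfl⟩, ⟨Or.inr rfl, hp'.symm⟩,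
      fun i hi => hi.1, fun δ' h' => h'.2.2.2 hp'⟩
  · exact ⟨⟨(b, a, (a.val : Player)), h, fun _ => hp'⟩, ⟨Or.inr rfl, rfl⟩, ⟨Or.inl rfl, hp'.symm⟩,
      fun i hi => hi.1.symm, fun δ' h' => h'.2.2.2 hp'.symm⟩

theorem exists_delta_mixed {a b : Fin (2 * k + 1)} (hp : a.val % 2 ≠ b.val % 2) :
    ∃ δ δ' : DeltaPos k, gammaDelta a δ ∧ gammaDelta b δ' ∧ Partner δ δ' := by
  have hp' : (a.val : Player) ≠ (b.val : Player) := fun h => hp ((natCast_player_eq_iff _ _).1 h)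
  have hb : (b.val : Player) = (a.val : Player) + 1 := player_eq_of_ne hp'.symm
  have hab : a ≠ b := by rintro rfl; exact hp rfl
  rcases lt_or_gt_of_ne hab with h | h
  · exact ⟨⟨(a, b, (a.val : Player)), h, fun h => absurd h hp'⟩,
      ⟨(a, b, (b.val : Player)), h, fun h => absurd h hp'⟩, ⟨Or.inl rfl, rfl⟩, ⟨Or.inr rfl, rfl⟩,
      rfl, rfl, hb, hp'⟩
  · exact ⟨⟨(b, a, (a.val : Player)), h, fun h => absurd h.symm hp'⟩,
      ⟨(b, a, (b.val : Player)), h, fun h => absurd h.symm hp'⟩, ⟨Or.inr rfl, rfl⟩,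
      ⟨Or.inl rfl, rfl⟩, rfl, rfl, hb, hp'.symm⟩

theorem gammaDelta_even {i : Fin (2 * k + 1)} {δ : DeltaPos k} (h : gammaDelta i δ)
    (h0 : δ.1.2.2 = 0) : i.val % 2 = 0 :=
  (natCast_player_eq_zero _).1 (h.2.trans h0)

theorem gammaDelta_odd {i : Fin (2 * k + 1)} {δ : DeltaPos k} (h : gammaDelta i δ)
    (h0 : δ.1.2.2 = 1) : i.val % 2 = 1 :=
  (natCast_player_eq_one _).1 (h.2.trans h0)

theorem owner_of_even {i : Fin (2 * k + 1)} {δ : DeltaPos k} (h : gammaDelta i δ)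
    (h0 : i.val % 2 = 0) : δ.1.2.2 = 0 :=
  h.2.symm.trans ((natCast_player_eq_zero _).2 h0)

theorem owner_of_odd {i : Fin (2 * k + 1)} {δ : DeltaPos k} (h : gammaDelta i δ)
    (h0 : i.val % 2 = 1) : δ.1.2.2 = 1 :=
  h.2.symm.trans ((natCast_player_eq_one _).2 h0)

theorem move_alpha {i : Fin (2 * k + 1)} {w : SCCPos k} :
    (sccGame k).move (inl (alpha i)) w ↔ w = inl (beta i) := by
  rcases w with (j | j | j) | δ <;> simp [sccGame, sccMove, CorePos.move]

theorem move_beta {i : Fin (2 * k + 1)} {w : SCCPos k} :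
    (sccGame k).move (inl (beta i)) w ↔
      w = inl (gamma i) ∨ ∃ j : Fin (2 * k + 1), j.val + 1 = i.val ∧ w = inl (alpha j) := by
  rcases w with (j | j | j) | δ <;> simp [sccGame, sccMove, CorePos.move]

theorem move_gamma {i : Fin (2 * k + 1)} {w : SCCPos k} :
    (sccGame k).move (inl (gamma i)) w ↔
      w = inl (beta i) ∨ w = inl (gamma i) ∨
      (∃ j : Fin (2 * k + 1), j.val = i.val + 1 ∧ w = inl (alpha j)) ∨
      ∃ δ, gammaDelta i δ ∧ w = inr δ := by
  rcases w with (j | j | j) | δ <;> simp [sccGame, sccMove, CorePos.move]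

theorem move_delta {δ : DeltaPos k} {w : SCCPos k} :
    (sccGame k).move (inr δ) w ↔
      (∃ i, gammaDelta i δ ∧ w = inl (gamma i)) ∨ ∃ δ', Partner δ δ' ∧ w = inr δ' := by
  rcases w with (j | j | j) | δ <;> simp [sccGame, sccMove, Partner]

theorem owner_alpha_zero {i : Fin (2 * k + 1)} :
    (sccGame k).owner (inl (alpha i)) = 0 ↔ i.val % 2 = 0 := natCast_player_eq_zero _

theorem owner_alpha_one {i : Fin (2 * k + 1)} :
    (sccGame k).owner (inl (alpha i)) = 1 ↔ i.val % 2 = 1 := natCast_player_eq_one _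

theorem owner_beta_zero {i : Fin (2 * k + 1)} :
    (sccGame k).owner (inl (beta i)) = 0 ↔ i.val % 2 = 0 := natCast_player_eq_zero _

theorem owner_beta_one {i : Fin (2 * k + 1)} :
    (sccGame k).owner (inl (beta i)) = 1 ↔ i.val % 2 = 1 := natCast_player_eq_one _

theorem owner_gamma_zero {i : Fin (2 * k + 1)} :
    (sccGame k).owner (inl (gamma i)) = 0 ↔ i.val % 2 = 1 := natCast_player_succ_eq_zero _

theorem owner_gamma_one {i : Fin (2 * k + 1)} :
    (sccGame k).owner (inl (gamma i)) = 1 ↔ i.val % 2 = 0 := natCast_player_succ_eq_one _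

theorem prio_alpha {i : Fin (2 * k + 1)} :
    (sccGame k).prio (inl (alpha i)) = 2 * k + i.val + 1 := rfl

theorem prio_beta {i : Fin (2 * k + 1)} : (sccGame k).prio (inl (beta i)) = i.val := rfl

theorem prio_gamma {i : Fin (2 * k + 1)} : (sccGame k).prio (inl (gamma i)) = i.val := rfl

theorem prio_delta {δ : DeltaPos k} : (sccGame k).prio (inr δ) = 0 := rfl

theorem player_ne_zero {p : Player} : p ≠ 0 ↔ p = 1 := by revert p; decide

theorem player_ne_one {p : Player} : p ≠ 1 ↔ p = 0 := by revert p; decide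

section SetMembership

variable {n : ℕ} {i : Fin (2 * k + 1)} {δ : DeltaPos k}

@[simp] theorem alpha_mem_alphaSet :
    (inl (alpha i) : SCCPos k) ∈ alphaSet (k := k) inl n ↔ i.val = n :=
  ⟨fun ⟨_, h, h'⟩ => by cases h'; exact h, fun h => ⟨i, h, rfl⟩⟩

@[simp] theorem beta_notMem_alphaSet :
    (inl (beta i) : SCCPos k) ∉ alphaSet (k := k) inl n := fun ⟨_, _, h'⟩ => by cases h'

@[simp] theorem gamma_notMem_alphaSet :
    (inl (gamma i) : SCCPos k) ∉ alphaSet (k := k) inl n := fun ⟨_, _, h'⟩ => by cases h'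

@[simp] theorem delta_notMem_alphaSet :
    (inr δ : SCCPos k) ∉ alphaSet (k := k) inl n := fun ⟨_, _, h'⟩ => by cases h'

@[simp] theorem beta_mem_betaSet :
    (inl (beta i) : SCCPos k) ∈ betaSet (k := k) inl n ↔ i.val = n :=
  ⟨fun ⟨_, h, h'⟩ => by cases h'; exact h, fun h => ⟨i, h, rfl⟩⟩

@[simp] theorem alpha_notMem_betaSet :
    (inl (alpha i) : SCCPos k) ∉ betaSet (k := k) inl n := fun ⟨_, _, h'⟩ => by cases h'

@[simp] theorem gamma_notMem_betaSet :
    (inl (gamma i) : SCCPos k) ∉ betaSet (k := k) inl n := fun ⟨_, _, h'⟩ => by cases h'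

@[simp] theorem delta_notMem_betaSet :
    (inr δ : SCCPos k) ∉ betaSet (k := k) inl n := fun ⟨_, _, h'⟩ => by cases h'

end SetMembership

/-! ### The invariant of the subgame tree -/

/-- The relation between the positions `γ` and the additional positions in the subgames of the
subgame tree. -/
structure DeltaInv (U : Set (SCCPos k)) : Prop where
  zero_gamma : ∀ δ : DeltaPos k, δ.1.2.2 = 0 → inr δ ∈ U → ∀ i, gammaDelta i δ →
    inl (gamma i) ∈ U
  one_gamma : ∀ δ : DeltaPos k, δ.1.2.2 = 1 → ∀ i, gammaDelta i δ → inl (gamma i) ∈ U → inr δ ∈ U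
  zero_of : ∀ δ : DeltaPos k, δ.1.2.2 = 0 → (∀ i, gammaDelta i δ → inl (gamma i) ∈ U) →
    (∀ δ', Partner δ δ' → ∀ i, gammaDelta i δ' → inl (gamma i) ∈ U) → inr δ ∈ U
  one_of : ∀ δ : DeltaPos k, δ.1.2.2 = 1 → inr δ ∈ U →
    (∃ i, gammaDelta i δ ∧ inl (gamma i) ∈ U) ∨ ∃ δ', Partner δ δ' ∧ inr δ' ∈ U
  partner : ∀ δ δ' : DeltaPos k, δ.1.2.2 = 0 → Partner δ δ' → inr δ ∈ U → inr δ' ∈ U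

theorem DeltaInv.congr {U U' : Set (SCCPos k)} (h : DeltaInv U)
    (hg : ∀ i, inl (gamma i) ∈ U' ↔ inl (gamma i) ∈ U) (hd : ∀ δ, inr δ ∈ U' ↔ inr δ ∈ U) :
    DeltaInv U' := by
  constructor <;> simp only [hg, hd]
  · exact h.zero_gamma
  · exact h.one_gamma
  · exact h.zero_of
  · exact h.one_of
  · exact h.partner

/-- The invariant of the subgame `G_w` of the subgame tree, with `z = 2 (k - |w|)`. -/
structure TreeInv (z : ℕ) (U : Set (SCCPos k)) : Prop where
  even : z % 2 = 0
  le : z ≤ 2 * k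
  alpha_mem : ∀ i, inl (alpha i) ∈ U ↔ i.val ≤ z
  beta_low : ∀ i : Fin (2 * k + 1), i.val ≤ z + 1 → inl (beta i) ∈ U
  beta_high : ∀ i : Fin (2 * k + 1), z < i.val → inl (beta i) ∈ U →
    i.val % 2 = 1 ∧ (i.val = z + 1 ∨ inl (gamma i) ∈ U)
  gamma_low : ∀ i : Fin (2 * k + 1), i.val ≤ z → inl (gamma i) ∈ U
  delta : DeltaInv U

theorem treeInv_univ : TreeInv (2 * k) (Set.univ : Set (SCCPos k)) where
  even := by omega
  le := le_rfl
  alpha_mem i := ⟨fun _ => by omega, fun _ => trivial⟩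
  beta_low _ _ := trivial
  beta_high i h := by omega
  gamma_low _ _ := trivial
  delta := ⟨fun _ _ _ _ _ => trivial, fun _ _ _ _ _ => trivial, fun _ _ _ _ => trivial,
    fun δ _ _ => Or.inl ((exists_gammaDelta δ).imp fun _ h => ⟨h, trivial⟩),
    fun _ _ _ _ _ => trivial⟩

/-! ### Strong connectivity -/

/-- Mutual reachability in `S`. -/
def Mutual (S : Set (SCCPos k)) (v w : SCCPos k) : Prop :=
  Relation.ReflTransGen (fun a b => a ∈ S ∧ b ∈ S ∧ (sccGame k).move a b) v w ∧
  Relation.ReflTransGen (fun a b => a ∈ S ∧ b ∈ S ∧ (sccGame k).move a b) w v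

theorem Mutual.symm {S : Set (SCCPos k)} {v w : SCCPos k} (h : Mutual S v w) : Mutual S w v :=
  ⟨h.2, h.1⟩

theorem Mutual.trans {S : Set (SCCPos k)} {u v w : SCCPos k} (h : Mutual S u v)
    (h' : Mutual S v w) : Mutual S u w :=
  ⟨h.1.trans h'.1, h'.2.trans h.2⟩

theorem mutual_gamma_delta {S : Set (SCCPos k)} {i : Fin (2 * k + 1)} {δ : DeltaPos k}
    (h : gammaDelta i δ) (hi : inl (gamma i) ∈ S) (hδ : inr δ ∈ S) :
    Mutual S (inl (gamma i)) (inr δ) :=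
  ⟨.single ⟨hi, hδ, move_gamma.2 (Or.inr (Or.inr (Or.inr ⟨δ, h, rfl⟩)))⟩,
    .single ⟨hδ, hi, move_delta.2 (Or.inl ⟨i, h, rfl⟩)⟩⟩

theorem mutual_partner {S : Set (SCCPos k)} {δ δ' : DeltaPos k}
    (h : Partner δ δ') (hδ : inr δ ∈ S) (hδ' : inr δ' ∈ S) : Mutual S (inr δ) (inr δ') :=
  ⟨.single ⟨hδ, hδ', move_delta.2 (Or.inr ⟨δ', h, rfl⟩)⟩,
    .single ⟨hδ', hδ, move_delta.2 (Or.inr ⟨δ, h.symm, rfl⟩)⟩⟩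

/-- This is the purpose of the `δ`. Indices of equal parity share one `δ`; indices of different
parity are joined by a pair of partners, one adjacent to each `γ`. `DeltaInv` ensures that these `δ`
survive as long as both `γ` do. -/
theorem mutual_gamma {S : Set (SCCPos k)} (hS : DeltaInv S) {a b : Fin (2 * k + 1)}
    (ha : inl (gamma a) ∈ S) (hb : inl (gamma b) ∈ S) :
    Mutual S (inl (gamma a)) (inl (gamma b)) := by
  have mixed : ∀ {a b : Fin (2 * k + 1)}, inl (gamma a) ∈ S → inl (gamma b) ∈ S →
      a.val % 2 = 0 → b.val % 2 = 1 → Mutual S (inl (gamma a)) (inl (gamma b)) := by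
    intro a b ha hb hpa hpb
    obtain ⟨δ, δ', h1, h2, h3⟩ := exists_delta_mixed (a := a) (b := b) (by omega)
    have hδ' := hS.one_gamma δ' (owner_of_odd h2 hpb) b h2 hb
    have hδ := hS.zero_of δ (owner_of_even h1 hpa)
      (fun i hi => by rw [h3.gammaDelta_unique hi h1]; exact ha)
      (fun δ'' h'' i hi => by
        obtain rfl := h3.unique h''
        rw [h3.symm.gammaDelta_unique hi h2]; exact hb)
    exact ((mutual_gamma_delta h1 ha hδ).trans (mutual_partner h3 hδ hδ')).trans
      (mutual_gamma_delta h2 hb hδ').symm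
  by_cases hab : a = b
  · subst hab; exact ⟨.refl, .refl⟩
  by_cases hp : a.val % 2 = b.val % 2
  · obtain ⟨δ, h1, h2, h3, h4⟩ := exists_delta_same hab hp
    have hδ : inr δ ∈ S := by
      rcases player_zero_or_one δ.1.2.2 with h0 | h0
      · refine hS.zero_of δ h0 (fun i hi => ?_) (fun δ' h' => absurd h' (h4 δ'))
        rcases h3 i hi with rfl | rfl <;> assumption
      · exact hS.one_gamma δ h0 a h1 ha
    exact (mutual_gamma_delta h1 ha hδ).trans (mutual_gamma_delta h2 hb hδ).symm
  · rcases Nat.mod_two_eq_zero_or_one a.val with h0 | h0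
    · exact mixed ha hb h0 (by omega)
    · exact (mixed hb ha (by omega) h0).symm

/-- A criterion for strong connectivity. -/
theorem stronglyConnected_of {S : Set (SCCPos k)} (hS : DeltaInv S)
    (hgam : ∃ i, inl (gamma i) ∈ S)
    (halpha : ∀ i : Fin (2 * k + 1), inl (alpha i) ∈ S → inl (beta i) ∈ S ∧
      ((∃ j : Fin (2 * k + 1), j.val + 1 = i.val ∧ inl (gamma j) ∈ S) ∨
        ∃ j : Fin (2 * k + 1), i.val + 1 = j.val ∧ inl (beta j) ∈ S))
    (hbeta : ∀ i : Fin (2 * k + 1), inl (beta i) ∈ S → inl (gamma i) ∈ S ∨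
      (inl (alpha i) ∈ S ∧ ∃ j : Fin (2 * k + 1), j.val + 1 = i.val ∧
        inl (alpha j) ∈ S ∧ inl (beta j) ∈ S ∧ inl (gamma j) ∈ S)) :
    (sccGame k).StronglyConnected S := by
  obtain ⟨c, hc⟩ := hgam
  have hedge : ∀ {v w : SCCPos k}, v ∈ S → w ∈ S → (sccGame k).move v w →
      Relation.ReflTransGen (fun a b => a ∈ S ∧ b ∈ S ∧ (sccGame k).move a b) v w :=
    fun hv hw hm => .single ⟨hv, hw, hm⟩
  have hbg : ∀ j : Fin (2 * k + 1), inl (beta j) ∈ S → inl (gamma j) ∈ S →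
      Mutual S (inl (beta j)) (inl (gamma c)) := fun j h1 h2 =>
    Mutual.trans ⟨hedge h1 h2 (move_beta.2 (Or.inl rfl)), hedge h2 h1 (move_gamma.2 (Or.inl rfl))⟩
      (mutual_gamma hS h2 hc)
  have hB : ∀ i, inl (beta i) ∈ S → Mutual S (inl (beta i)) (inl (gamma c)) := by
    intro i hi
    rcases hbeta i hi with h | ⟨hai, j, hj, ha, hb, hg⟩
    · exact hbg i hi h
    · refine ⟨((hedge hi ha (move_beta.2 (Or.inr ⟨j, hj, rfl⟩))).trans
        (hedge ha hb (move_alpha.2 rfl))).trans (hbg j hb hg).1, ?_⟩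
      exact ((mutual_gamma hS hc hg).1.trans
        (hedge hg hai (move_gamma.2 (Or.inr (Or.inr (Or.inl ⟨i, hj.symm, rfl⟩)))))).trans
        (hedge hai hi (move_alpha.2 rfl))
  have hA : ∀ i, inl (alpha i) ∈ S → Mutual S (inl (alpha i)) (inl (gamma c)) := by
    intro i hi
    obtain ⟨hb, h⟩ := halpha i hi
    refine ⟨(hedge hi hb (move_alpha.2 rfl)).trans (hB i hb).1, ?_⟩
    rcases h with ⟨j, hj, hg⟩ | ⟨j, hj, hb'⟩
    · exact (mutual_gamma hS hc hg).1.trans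
        (hedge hg hi (move_gamma.2 (Or.inr (Or.inr (Or.inl ⟨i, hj.symm, rfl⟩)))))
    · exact (hB j hb').2.trans (hedge hb' hi (move_beta.2 (Or.inr ⟨i, hj, rfl⟩)))
  have hD0 : ∀ δ : DeltaPos k, δ.1.2.2 = 0 → inr δ ∈ S →
      Mutual S (inr δ) (inl (gamma c)) := by
    intro δ h0 hδ
    obtain ⟨i, hi⟩ := exists_gammaDelta δ
    have hg := hS.zero_gamma δ h0 hδ i hi
    exact (mutual_gamma_delta hi hg hδ).symm.trans (mutual_gamma hS hg hc)
  have hD : ∀ δ : DeltaPos k, inr δ ∈ S → Mutual S (inr δ) (inl (gamma c)) := by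
    intro δ hδ
    rcases player_zero_or_one δ.1.2.2 with h0 | h0
    · exact hD0 δ h0 hδ
    · rcases hS.one_of δ h0 hδ with ⟨i, hi, hg⟩ | ⟨δ', h, hδ'⟩
      · exact (mutual_gamma_delta hi hg hδ).symm.trans (mutual_gamma hS hg hc)
      · exact (mutual_partner h hδ hδ').trans (hD0 δ' (h.owner_zero h0) hδ')
  have hall : ∀ v ∈ S, Mutual S v (inl (gamma c)) := by
    rintro ((i | i | i) | δ) hv
    · exact hA i hv
    · exact hB i hv
    · exact mutual_gamma hS hv hc
    · exact hD δ hv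
  exact ⟨⟨_, hc⟩, fun v hv w hw => ((hall v hv).trans (hall w hw).symm).1⟩

/-! ### The left children -/

/-- Every position of a subgame satisfying the invariant has a move in it. -/
theorem TreeInv.isSubgame {z : ℕ} {U : Set (SCCPos k)} (h : TreeInv z U) :
    (sccGame k).IsSubgame U := by
  rintro ((i | i | i) | δ) hv
  · have := (h.alpha_mem i).1 hv
    exact ⟨_, h.beta_low i (by omega), move_alpha.2 rfl⟩
  · by_cases hg : inl (gamma i) ∈ U
    · exact ⟨_, hg, move_beta.2 (Or.inl rfl)⟩
    · have hz : z < i.val := by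
        by_contra hcon
        exact hg (h.gamma_low i (by omega))
      have := ((h.beta_high i hz hv).2.resolve_right hg)
      exact ⟨_, (h.alpha_mem ⟨z, by omega⟩).2 le_rfl, move_beta.2 (Or.inr ⟨_, this.symm, rfl⟩)⟩
  · exact ⟨_, hv, move_gamma.2 (Or.inr (Or.inl rfl))⟩
  · rcases player_zero_or_one δ.1.2.2 with h0 | h0
    · obtain ⟨i, hi⟩ := exists_gammaDelta δ
      exact ⟨_, h.delta.zero_gamma δ h0 hv i hi, move_delta.2 (Or.inl ⟨i, hi, rfl⟩)⟩
    · rcases h.delta.one_of δ h0 hv with ⟨i, hi, hg⟩ | ⟨δ', hδ, hm⟩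
      · exact ⟨_, hg, move_delta.2 (Or.inl ⟨i, hi, rfl⟩)⟩
      · exact ⟨_, hm, move_delta.2 (Or.inr ⟨δ', hδ, rfl⟩)⟩

/-- The subgame of `U` on the left, before the attractor of the second priority is removed. -/
def hatLeft (z : ℕ) (U : Set (SCCPos k)) : Set (SCCPos k) :=
  U \ (alphaSet (k := k) inl z ∪ betaSet (k := k) inl (z + 1))

theorem exists_move_of_mem_pre {V : Type*} {G : ParityGame V} {U S : Set V} {p : Player} {v : V}
    (hU : G.IsSubgame U) (h : v ∈ G.pre U p S) : ∃ w ∈ U, G.move v w ∧ w ∈ S := by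
  rcases h with ⟨-, -, h⟩ | ⟨hv, -, hall⟩
  · exact h
  · obtain ⟨w, hw, hm⟩ := hU v hv
    exact ⟨w, hw, hm, hall w hw hm⟩

/-- Besides `α_m` only `β_{m+1}`, owned by `p`, is attracted. The attraction stops there: `α_{m+1}`
is absent, and the `γ` next to these positions belong to the opponent, who can loop. -/
theorem attr_alphaSet {m : ℕ} {p : Player} {U : Set (SCCPos k)} (hm : (m : Player) = p + 1)
    (hU : (sccGame k).IsSubgame U) (h1 : ∀ i : Fin (2 * k + 1), i.val = m → inl (alpha i) ∈ U)
    (h2 : ∀ i : Fin (2 * k + 1), i.val = m + 1 → inl (alpha i) ∉ U) :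
    (sccGame k).attr U p (alphaSet (k := k) inl m) =
      U ∩ (alphaSet (k := k) inl m ∪ betaSet (k := k) inl (m + 1)) := by
  -- Both alternatives say that the owner `i + 1` of `γ_i` is not `p`; by the loop at `γ_i` it is in
  -- `pre S` only if it is in `S` already.
  have hself : ∀ {i : Fin (2 * k + 1)} {S : Set (SCCPos k)}, (i.val : Player) = p ∨
      (i.val : Player) + 1 = m → inl (gamma i) ∈ (sccGame k).pre U p S → inl (gamma i) ∈ S := by
    rintro i S hi (⟨-, ho, -⟩ | ⟨hv, -, hall⟩)
    · have ho : (i.val : Player) + 1 = p := ho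
      rcases hi with hi | hi
      · rw [hi] at ho; exact absurd ho (player_succ_ne p)
      · rw [ho, hm] at hi; exact absurd hi.symm (player_succ_ne p)
    · exact hall _ hv (move_gamma.2 (Or.inr (Or.inl rfl)))
  refine Set.Subset.antisymm (attr_subset_of_closed (fun v hv => ⟨hv.2, Or.inl hv.1⟩) ?_) ?_
  · intro v hv
    have hvU := (sccGame k).pre_subset U p _ hv
    obtain ⟨w, hw, hmv, -, hS⟩ := exists_move_of_mem_pre hU hv
    refine ⟨hvU, ?_⟩
    rcases v with (i | i | i) | δ
    · rw [move_alpha] at hmv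
      subst hmv
      simp only [Set.mem_union, beta_notMem_alphaSet, beta_mem_betaSet, false_or] at hS
      exact absurd hvU (h2 i hS)
    · rw [move_beta] at hmv
      rcases hmv with rfl | ⟨j, hj, rfl⟩
      · simp at hS
      · simp only [Set.mem_union, alpha_mem_alphaSet, alpha_notMem_betaSet, or_false] at hS
        right
        simp only [beta_mem_betaSet]
        omega
    · refine absurd (hself ?_ hv) (by simp)
      rw [move_gamma] at hmv
      rcases hmv with rfl | rfl | ⟨j, hj, rfl⟩ | ⟨δ, hδ, rfl⟩
      · simp only [Set.mem_union, beta_notMem_alphaSet, beta_mem_betaSet, false_or] at hS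
        left
        rw [hS]; push_cast
        rw [hm, player_add_two]
      · simp at hS
      · simp only [Set.mem_union, alpha_mem_alphaSet, alpha_notMem_betaSet, or_false] at hS
        right
        rw [← hS, hj]; push_cast; rfl
      · simp at hS
    · rw [move_delta] at hmv
      rcases hmv with ⟨i, hi, rfl⟩ | ⟨δ', h', rfl⟩ <;> simp at hS
  · rintro v ⟨hvU, hv | hv⟩
    · exact subset_attr U p _ ⟨hv, hvU⟩
    · obtain ⟨i, hi, rfl⟩ := hv
      have hlt : m < 2 * k + 1 := by omega
      refine mem_attr_own hvU ?_ (move_beta.2 (Or.inr ⟨⟨m, hlt⟩, hi.symm, rfl⟩))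
        (subset_attr U p _ ⟨⟨_, rfl, rfl⟩, h1 ⟨m, hlt⟩ rfl⟩)
      change (i.val : Player) = p
      rw [hi]; push_cast
      rw [hm, player_add_two]

end SCCFamily

namespace ParityGame

/-- A dominion from a relation that describes the admissible moves of the player. -/
theorem strongDominion_of_rel {V : Type*} {G : ParityGame V} {U D : Set V} {p : Player}
    (P : V → V → Prop) (hDU : D ⊆ U)
    (hc : ∀ v ∈ D, G.owner v ≠ p → ∀ w ∈ U, G.move v w → w ∈ D)
    (hex : ∀ v ∈ D, G.owner v = p → ∃ w ∈ D, G.move v w ∧ P v w)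
    (hw : ∀ π : ℕ → V, (∀ n, π n ∈ D) → (∀ n, G.move (π n) (π (n + 1))) →
      (∀ n, G.owner (π n) = p → P (π n) (π (n + 1))) → (G.pathPrio π : Player) = p) :
    G.StrongDominion U p D := by
  have : ∀ v, ∃ w, v ∈ D → G.owner v = p → w ∈ D ∧ G.move v w ∧ P v w := by
    intro v
    by_cases h : v ∈ D ∧ G.owner v = p
    · obtain ⟨w, hw⟩ := hex v h.1 h.2
      exact ⟨w, fun _ _ => hw⟩
    · exact ⟨v, fun a b => absurd ⟨a, b⟩ h⟩
  choose s hs using this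
  refine ⟨hDU, hc, s, fun v hv ho => ⟨(hs v hv ho).1, (hs v hv ho).2.1⟩, fun π hπ => ?_⟩
  refine hw π hπ.mem hπ.move fun n ho => ?_
  rw [hπ.own n ho]
  exact (hs _ (hπ.mem n) ho).2.2

end ParityGame

/-! ### Winning regions in the left child. -/

namespace SCCFamily

open Sum CorePos ParityGame

variable {k : ℕ}

/-- The winning region of player `0` in the left child of `U`. -/
def WinPred (z : ℕ) (U : Set (SCCPos k)) : SCCPos k → Prop
  | inl (alpha _) => False
  | inl (beta i) => i.val = z
  | inl (gamma i) => i.val % 2 = 0 ∧ z ≤ i.val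
  | inr δ => (δ.1.2.2 = 0 ∧ ((∃ i, gammaDelta i δ ∧ z ≤ i.val) ∨
      ∃ δ', Partner δ δ' ∧ ∀ i, gammaDelta i δ' → inl (gamma i) ∉ U)) ∨
      (δ.1.2.2 = 1 ∧ ∀ i, gammaDelta i δ → inl (gamma i) ∉ U)

/-- The positions from which player `0` can force a visit to its winning region in the left child
of `U`. -/
def AttrPred (z : ℕ) (U : Set (SCCPos k)) : SCCPos k → Prop
  | inl (alpha i) => i.val = z
  | inl (beta i) => i.val = z ∨ (i.val = z + 1 ∧ inl (gamma i) ∉ U)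
  | inl (gamma i) => (i.val % 2 = 0 ∧ z ≤ i.val) ∨ i.val + 1 = z
  | inr δ => WinPred z U (inr δ) ∨ (δ.1.2.2 = 1 ∧
      (∀ i, gammaDelta i δ → inl (gamma i) ∈ U → i.val + 1 = z) ∧
      ∀ δ', Partner δ δ' → inr δ' ∈ U → WinPred z U (inr δ'))

theorem winPred_delta_zero {z : ℕ} {U : Set (SCCPos k)} {δ : DeltaPos k} (h0 : δ.1.2.2 = 0) :
    WinPred z U (inr δ) ↔ ((∃ i, gammaDelta i δ ∧ z ≤ i.val) ∨
      ∃ δ', Partner δ δ' ∧ ∀ i, gammaDelta i δ' → inl (gamma i) ∉ U) := by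
  simp [WinPred, h0]

theorem winPred_delta_one {z : ℕ} {U : Set (SCCPos k)} {δ : DeltaPos k} (h0 : δ.1.2.2 = 1) :
    WinPred z U (inr δ) ↔ ∀ i, gammaDelta i δ → inl (gamma i) ∉ U := by
  simp [WinPred, h0]

theorem attrPred_delta_zero {z : ℕ} {U : Set (SCCPos k)} {δ : DeltaPos k} (h0 : δ.1.2.2 = 0) :
    AttrPred z U (inr δ) ↔ WinPred z U (inr δ) := by
  simp [AttrPred, h0]

theorem attrPred_of_winPred {z : ℕ} {U : Set (SCCPos k)} {v : SCCPos k} (h : WinPred z U v) :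
    AttrPred z U v := by
  rcases v with (i | i | i) | δ
  · exact h.elim
  · exact Or.inl h
  · exact Or.inl h
  · exact Or.inl h

section Step

variable {z : ℕ} {U : Set (SCCPos k)} (h : TreeInv z U)
include h

theorem TreeInv.attr_alphaSet :
    (sccGame k).attr U 1 (alphaSet (k := k) inl z) =
      U ∩ (alphaSet (k := k) inl z ∪ betaSet (k := k) inl (z + 1)) := by
  refine SCCFamily.attr_alphaSet ?_ h.isSubgame (fun i hi => (h.alpha_mem i).2 hi.le)
    fun i hi hm => ?_
  · exact (natCast_player_eq_zero z).2 h.even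
  · have := (h.alpha_mem i).1 hm
    omega

theorem TreeInv.minus_left :
    (sccGame k).minus U ((sccGame k).attr U 1 (alphaSet (k := k) inl z)) = hatLeft z U := by
  rw [minus_attr h.isSubgame, h.attr_alphaSet, Set.sdiff_self_inter]; rfl

theorem TreeInv.isSubgame_hatLeft : (sccGame k).IsSubgame (hatLeft z U) := by
  rw [← h.minus_left]; exact isSubgame_minus _ _

theorem TreeInv.mem_hatLeft_alpha (i : Fin (2 * k + 1)) :
    inl (alpha i) ∈ hatLeft z U ↔ i.val < z := by
  have := h.alpha_mem i
  simp only [hatLeft, Set.mem_sdiff, Set.mem_union, alpha_mem_alphaSet, alpha_notMem_betaSet,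
    or_false, this]
  omega

omit h in
theorem mem_hatLeft_beta (i : Fin (2 * k + 1)) :
    inl (beta i) ∈ hatLeft z U ↔ inl (beta i) ∈ U ∧ i.val ≠ z + 1 := by
  simp [hatLeft]

omit h in
theorem mem_hatLeft_gamma (i : Fin (2 * k + 1)) :
    inl (gamma i) ∈ hatLeft z U ↔ inl (gamma i) ∈ U := by
  simp [hatLeft]

omit h in
theorem mem_hatLeft_delta (δ : DeltaPos k) :
    inr δ ∈ hatLeft z U ↔ inr δ ∈ U := by
  simp [hatLeft]

omit h in
theorem winPred_mem_hatLeft {v : SCCPos k} (hv : v ∈ U) (hw : WinPred z U v) :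
    v ∈ hatLeft z U := by
  rcases v with (i | i | i) | δ
  · exact hw.elim
  · have hw : i.val = z := hw
    rw [mem_hatLeft_beta]; exact ⟨hv, by omega⟩
  · rwa [mem_hatLeft_gamma]
  · rwa [mem_hatLeft_delta]

/-- Player `1` owns the even `γ` and cannot leave from them: `α_{i+1}` is gone, and the only even
`β` left from `z` on is `β_z`. Every priority in the region is even, so player `0` only has to stay
inside. -/
theorem TreeInv.dominion_zero :
    (sccGame k).StrongDominion (hatLeft z U) 0 {v | v ∈ U ∧ WinPred z U v} := by
  have hz := h.even
  refine strongDominion_of_rel (fun _ _ => True)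
    (fun v hv => winPred_mem_hatLeft hv.1 hv.2) ?_ ?_ ?_
  · rintro v ⟨hv, hW⟩ ho w hw hm
    refine ⟨hw.1, ?_⟩
    rw [player_ne_zero] at ho
    rcases v with (i | i | i) | δ
    · exact hW.elim
    · have hW : i.val = z := hW
      rw [owner_beta_one] at ho
      omega
    · obtain ⟨h1, h2⟩ : i.val % 2 = 0 ∧ z ≤ i.val := hW
      rw [move_gamma] at hm
      rcases hm with rfl | rfl | ⟨j, hj, rfl⟩ | ⟨δ, hδ, rfl⟩
      · change i.val = z
        by_contra hne
        have := h.beta_high i (by omega) hw.1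
        omega
      · exact ⟨h1, h2⟩
      · rw [h.mem_hatLeft_alpha] at hw
        omega
      · rw [winPred_delta_zero (owner_of_even hδ h1)]
        exact Or.inl ⟨i, hδ, h2⟩
    · have ho : δ.1.2.2 = 1 := ho
      rw [winPred_delta_one ho] at hW
      rw [move_delta] at hm
      rcases hm with ⟨i, hi, rfl⟩ | ⟨δ', h', rfl⟩
      · exact absurd hw.1 (hW i hi)
      · rw [winPred_delta_zero (h'.owner_zero ho)]
        exact Or.inr ⟨δ, h'.symm, hW⟩
  · rintro v ⟨hv, hW⟩ ho
    rcases v with (i | i | i) | δ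
    · exact hW.elim
    · have hW : i.val = z := hW
      exact ⟨inl (gamma i), ⟨h.gamma_low i hW.le, by omega, hW.ge⟩, move_beta.2 (Or.inl rfl),
        trivial⟩
    · exact ⟨inl (gamma i), ⟨hv, hW⟩, move_gamma.2 (Or.inr (Or.inl rfl)), trivial⟩
    · have ho : δ.1.2.2 = 0 := ho
      rw [winPred_delta_zero ho] at hW
      rcases hW with ⟨i, hi, hzi⟩ | ⟨δ', h', hall⟩
      · exact ⟨inl (gamma i), ⟨h.delta.zero_gamma δ ho hv i hi, gammaDelta_even hi ho, hzi⟩,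
          move_delta.2 (Or.inl ⟨i, hi, rfl⟩), trivial⟩
      · exact ⟨inr δ', ⟨h.delta.partner δ δ' ho h' hv,
          (winPred_delta_one (h'.owner_one ho)).2 hall⟩, move_delta.2 (Or.inr ⟨δ', h', rfl⟩),
          trivial⟩
  · intro π hπ _ _
    rw [natCast_player_eq_zero]
    obtain ⟨n, hn⟩ := ((sccGame k).pathPrio_spec π).2.exists
    rw [← hn]
    have hW := (hπ n).2
    generalize π n = v at hW
    rcases v with (i | i | i) | δ
    · exact hW.elim
    · have hW : i.val = z := hW
      rw [prio_beta]; omega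
    · exact hW.1
    · rfl

/-- The moves of the winning strategy of player `1` in the left child. -/
def OneMove (U : Set (SCCPos k)) (v w : SCCPos k) : Prop :=
  (∀ i, v = inl (beta i) → w = inl (gamma i)) ∧
  (∀ i : Fin (2 * k + 1), v = inl (gamma i) → ∃ j : Fin (2 * k + 1), j.val = i.val + 1 ∧
    w = inl (alpha j)) ∧
  ∀ δ, v = inr δ → ∃ i, gammaDelta i δ ∧ w = inl (gamma i) ∧
    ∀ j, gammaDelta j δ → inl (gamma j) ∈ U → j ≤ i

/-- Suppose the play has even priority `m`. If `m > 2k`, it belongs to an odd `α_i`, to which the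
play cannot return without meeting a larger `α`. If `m ≤ 2k`, eventually no `α` and hence no even
`γ` occurs, which excludes even `β` and leaves no way to have priority `0` either. -/
theorem TreeInv.dominion_one :
    (sccGame k).StrongDominion (hatLeft z U) 1 {v | v ∈ hatLeft z U ∧ ¬ WinPred z U v} := by
  have hz := h.even
  have hzk := h.le
  refine strongDominion_of_rel (OneMove U) (fun v hv => hv.1) ?_ ?_ ?_
  · rintro v ⟨hv, hW⟩ ho w hw hm
    refine ⟨hw, ?_⟩
    rw [player_ne_one] at ho
    rcases v with (i | i | i) | δ
    · rw [h.mem_hatLeft_alpha] at hv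
      rw [move_alpha] at hm
      subst hm
      exact hv.ne
    · rw [owner_beta_zero] at ho
      rw [mem_hatLeft_beta] at hv
      have hiz : i.val < z := by
        by_contra hcon
        have h1 : i.val ≠ z := hW
        have := h.beta_high i (by omega) hv.1
        omega
      rw [move_beta] at hm
      rcases hm with rfl | ⟨j, hj, rfl⟩
      · intro hW'
        have := hW'.2
        omega
      · exact id
    · rw [owner_gamma_zero] at ho
      rw [move_gamma] at hm
      rcases hm with rfl | rfl | ⟨j, hj, rfl⟩ | ⟨δ, hδ, rfl⟩
      · intro hW'
        have hW' : i.val = z := hW'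
        omega
      · exact hW
      · exact id
      · rw [winPred_delta_one (owner_of_odd hδ ho)]
        intro hall
        rw [mem_hatLeft_gamma] at hv
        exact hall i hδ hv
    · have ho : δ.1.2.2 = 0 := ho
      rw [winPred_delta_zero ho] at hW
      push Not at hW
      rw [move_delta] at hm
      rcases hm with ⟨i, hi, rfl⟩ | ⟨δ', h', rfl⟩
      · intro hW'
        exact absurd hW'.2 (not_le.2 (hW.1 i hi))
      · rw [winPred_delta_one (h'.owner_one ho)]
        push Not
        exact hW.2 δ' h'
  · rintro v ⟨hv, hW⟩ ho
    rcases v with (i | i | i) | δ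
    · rw [h.mem_hatLeft_alpha] at hv
      refine ⟨inl (beta i), ⟨?_, hv.ne⟩, move_alpha.2 rfl, ?_, ?_, ?_⟩
      · rw [mem_hatLeft_beta]
        exact ⟨h.beta_low i (by omega), by omega⟩
      all_goals intro _ h'; simp at h'
    · rw [owner_beta_one] at ho
      rw [mem_hatLeft_beta] at hv
      refine ⟨inl (gamma i), ⟨?_, ?_⟩, move_beta.2 (Or.inl rfl), ?_, ?_, ?_⟩
      · rw [mem_hatLeft_gamma]
        rcases le_or_gt i.val z with h1 | h1
        · exact h.gamma_low i h1
        · exact (h.beta_high i h1 hv.1).2.resolve_left hv.2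
      · intro hW'
        have := hW'.1
        omega
      · intro j hj; cases hj; rfl
      all_goals intro _ h'; simp at h'
    · rw [owner_gamma_one] at ho
      have hiz : i.val < z := by
        by_contra hcon
        exact hW ⟨ho, by omega⟩
      refine ⟨inl (alpha ⟨i.val + 1, by omega⟩), ⟨?_, id⟩,
        move_gamma.2 (Or.inr (Or.inr (Or.inl ⟨_, rfl, rfl⟩))), ?_, ?_, ?_⟩
      · rw [h.mem_hatLeft_alpha]
        change i.val + 1 < z
        omega
      · intro _ h'; simp at h'
      · intro j hj; cases hj; exact ⟨_, rfl, rfl⟩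
      · intro _ h'; simp at h'
    · have ho : δ.1.2.2 = 1 := ho
      rw [winPred_delta_one ho] at hW
      push Not at hW
      obtain ⟨i, ⟨hi, hiU⟩, hmax⟩ := Set.exists_max_image
        {i : Fin (2 * k + 1) | gammaDelta i δ ∧ inl (gamma i) ∈ U} id (Set.toFinite _) hW
      refine ⟨inl (gamma i), ⟨?_, ?_⟩, move_delta.2 (Or.inl ⟨i, hi, rfl⟩), ?_, ?_, ?_⟩
      · rwa [mem_hatLeft_gamma]
      · intro hW'
        have := gammaDelta_odd hi ho
        have := hW'.1
        omega
      · intro _ h'; simp at h'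
      · intro _ h'; simp at h'
      · intro δ' h'; cases h'
        exact ⟨i, hi, rfl, fun j hj hjU => hmax j ⟨hj, hjU⟩⟩
  · intro π hπ hm hP
    by_contra hcon
    rw [← ne_eq, player_ne_one, natCast_player_eq_zero] at hcon
    obtain ⟨hle, hfr⟩ := (sccGame k).pathPrio_spec π
    generalize (sccGame k).pathPrio π = m at hcon hle hfr
    obtain ⟨N, hN⟩ := eventually_atTop.1 hle
    obtain ⟨n, hn, hpn⟩ := frequently_atTop.1 hfr N
    have hodd_gamma : ∀ t (i : Fin (2 * k + 1)), i.val % 2 = 0 → π t = inl (gamma i) →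
        ∃ j : Fin (2 * k + 1), j.val = i.val + 1 ∧ π (t + 1) = inl (alpha j) := by
      intro t i hi ht
      exact (hP t (by rw [ht, owner_gamma_one]; exact hi)).2.1 i ht
    have hdelta : ∀ t (δ : DeltaPos k), δ.1.2.2 = 1 → π t = inr δ → ∃ i, gammaDelta i δ ∧
        π (t + 1) = inl (gamma i) ∧ ∀ j, gammaDelta j δ → inl (gamma j) ∈ U → j ≤ i := by
      intro t δ hδ ht
      exact (hP t (by rw [ht]; exact hδ)).2.2 δ ht
    by_cases hbig : 2 * k < m
    · -- a position `α i` with odd `i` is visited infinitely often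
      have hα : ∃ i : Fin (2 * k + 1), π n = inl (alpha i) ∧ m = 2 * k + i.val + 1 := by
        generalize π n = v at hpn
        rcases v with (i | i | i) | δ
        · exact ⟨i, rfl, hpn.symm⟩
        · rw [prio_beta] at hpn; omega
        · rw [prio_gamma] at hpn; omega
        · rw [prio_delta] at hpn; omega
      obtain ⟨i, hi, hmi⟩ := hα
      -- After `α_i` the play is confined to odd `β_j`, `γ_j` with `j ≥ i` and to `δ` of player `1`
      -- having such a `γ_j`: the exit `α_{j+1}` would exceed `m`, and choosing the largest `γ`
      -- never lowers the index below `i`.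
      have key : ∀ t, (∃ j : Fin (2 * k + 1), i.val ≤ j.val ∧ j.val % 2 = 1 ∧
          (π (n + 1 + t) = inl (beta j) ∨ π (n + 1 + t) = inl (gamma j))) ∨
          ∃ δ : DeltaPos k, δ.1.2.2 = 1 ∧ π (n + 1 + t) = inr δ ∧
            ∃ j : Fin (2 * k + 1), i.val ≤ j.val ∧ gammaDelta j δ ∧ inl (gamma j) ∈ U := by
        intro t
        induction t with
        | zero =>
          have := hm n
          rw [hi, move_alpha] at this
          exact Or.inl ⟨i, le_rfl, by omega, Or.inl this⟩
        | succ t ih =>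
          have hmv := hm (n + 1 + t)
          rw [show n + 1 + (t + 1) = n + 1 + t + 1 from rfl]
          rcases ih with ⟨j, hij, hj, hb | hg⟩ | ⟨δ, hδ, hd, j, hij, hjδ, hjU⟩
          · exact Or.inl ⟨j, hij, hj, Or.inr
              ((hP _ (by rw [hb, owner_beta_one]; exact hj)).1 j hb)⟩
          · rw [hg, move_gamma] at hmv
            rcases hmv with h1 | h1 | ⟨j', hj', h1⟩ | ⟨δ, hδ, h1⟩
            · exact Or.inl ⟨j, hij, hj, Or.inl h1⟩
            · exact Or.inl ⟨j, hij, hj, Or.inr h1⟩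
            · have := hN (n + 1 + t + 1) (by omega)
              rw [h1, prio_alpha] at this
              omega
            · refine Or.inr ⟨δ, owner_of_odd hδ hj, h1, j, hij, hδ, ?_⟩
              have := (hπ (n + 1 + t)).1.1
              rwa [hg] at this
          · obtain ⟨i', hi', h1, hmax⟩ := hdelta _ δ hδ hd
            have : j.val ≤ i'.val := hmax j hjδ hjU
            exact Or.inl ⟨i', by omega, gammaDelta_odd hi' hδ, Or.inr h1⟩
      obtain ⟨t, ht, hpt⟩ := frequently_atTop.1 hfr (n + 1)
      obtain ⟨t, rfl⟩ := Nat.exists_eq_add_of_le ht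
      rcases key t with ⟨j, -, -, hb | hg⟩ | ⟨δ, -, hd, -⟩
      · rw [hb, prio_beta] at hpt; omega
      · rw [hg, prio_gamma] at hpt; omega
      · rw [hd, prio_delta] at hpt; omega
    -- An even `γ` would move to an `α`. A `δ` of player `0` leads to an even `γ` or to its partner,
    -- and a `δ` of player `1` to an odd `γ`, whose positive priority contradicts `m = 0`.
    · have hnα : ∀ t, N ≤ t → ∀ i, π t ≠ inl (alpha i) := by
        intro t ht i hi
        have := hN t ht
        rw [hi, prio_alpha] at this
        omega
      have hne : ∀ t, N ≤ t → ∀ i : Fin (2 * k + 1), i.val % 2 = 0 → π t ≠ inl (gamma i) := by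
        intro t ht i hi hg
        obtain ⟨j, -, hj⟩ := hodd_gamma t i hi hg
        exact hnα (t + 1) (by omega) j hj
      have hone : ∀ t, N ≤ t → ∀ δ : DeltaPos k, δ.1.2.2 = 1 → π t = inr δ → 0 < m := by
        intro t ht δ hδ hd
        obtain ⟨i, hi, h1, -⟩ := hdelta t δ hδ hd
        have h2 := hN (t + 1) (by omega)
        rw [h1, prio_gamma] at h2
        have := gammaDelta_odd hi hδ
        omega
      rcases hv : π n with (i | i | i) | δ
      · exact hnα n hn i hv
      · rw [hv, prio_beta] at hpn
        have hmv := hm n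
        rw [hv, move_beta] at hmv
        rcases hmv with h1 | ⟨j, -, h1⟩
        · exact hne (n + 1) (by omega) i (by omega) h1
        · exact hnα (n + 1) (by omega) j h1
      · rw [hv, prio_gamma] at hpn
        exact hne n hn i (by omega) hv
      · rw [hv, prio_delta] at hpn
        rcases player_zero_or_one δ.1.2.2 with h0 | h0
        · have hmv := hm n
          rw [hv, move_delta] at hmv
          rcases hmv with ⟨i, hi, h1⟩ | ⟨δ', h', h1⟩
          · exact hne (n + 1) (by omega) i (gammaDelta_even hi h0) h1
          · have := hone (n + 1) (by omega) δ' (h'.owner_one h0) h1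
            omega
        · have := hone n hn δ h0 hv
          omega

/-- The winning regions in the left child. -/
theorem TreeInv.isSolution_hatLeft {W : Player → Set (SCCPos k)}
    (h0 : W 0 = {v | v ∈ U ∧ WinPred z U v})
    (h1 : W 1 = {v | v ∈ hatLeft z U ∧ ¬ WinPred z U v}) :
    (sccGame k).IsSolution (hatLeft z U) W := by
  refine isSolution_of 0 ?_ ?_ ?_
  · rw [h0]; exact h.dominion_zero
  · rw [show (0 : Player) + 1 = 1 from rfl, h1]; exact h.dominion_one
  · rw [show (0 : Player) + 1 = 1 from rfl, h0, h1]
    intro v hv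
    by_cases hW : WinPred z U v
    · exact Or.inl ⟨hv.1, hW⟩
    · exact Or.inr ⟨hv, hW⟩

/-- The winning regions in the left child, as a function of the player. -/
def hatLeftWin (z : ℕ) (U : Set (SCCPos k)) (p : Player) : Set (SCCPos k) :=
  {v | v ∈ hatLeft z U ∧ (p = 0 ↔ WinPred z U v)}

theorem TreeInv.isSolution_hatLeftWin :
    (sccGame k).IsSolution (hatLeft z U) (hatLeftWin z U) := by
  refine h.isSolution_hatLeft ?_ ?_
  · ext v
    simp only [hatLeftWin, true_iff, Set.mem_ofPred_eq]
    exact ⟨fun hv => ⟨hv.1.1, hv.2⟩, fun hv => ⟨winPred_mem_hatLeft hv.1 hv.2, hv.2⟩⟩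
  · ext v
    simp [hatLeftWin]

theorem TreeInv.win_hatLeft :
    (sccGame k).win (hatLeft z U) 0 = {v | v ∈ U ∧ WinPred z U v} := by
  rw [h.isSolution_hatLeftWin.win_eq h.isSubgame_hatLeft]
  ext v
  simp only [hatLeftWin, true_iff, Set.mem_ofPred_eq]
  exact ⟨fun hv => ⟨hv.1.1, hv.2⟩, fun hv => ⟨winPred_mem_hatLeft hv.1 hv.2, hv.2⟩⟩

end Step

/-- The subgame of `U` on the right, before the attractor of the second priority is removed. -/
def hatRight (z : ℕ) (U : Set (SCCPos k)) : Set (SCCPos k) :=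
  {v | v ∈ U ∧ ¬ AttrPred z U v}

/-- The subgame of `S` without the attractor of the position `α (z + 1)` of maximal priority. -/
def dropAlpha (z : ℕ) (S : Set (SCCPos k)) : Set (SCCPos k) :=
  S \ (alphaSet (k := k) inl (z + 1) ∪ betaSet (k := k) inl (z + 2))

theorem minus_dropAlpha {z : ℕ} {S : Set (SCCPos k)} (hz : z % 2 = 0)
    (hS : (sccGame k).IsSubgame S)
    (ha : ∀ i : Fin (2 * k + 1), inl (alpha i) ∈ S ↔ i.val < z + 2) :
    (sccGame k).minus S ((sccGame k).attr S 0 (alphaSet (k := k) inl (z + 1))) =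
      dropAlpha z S := by
  rw [minus_attr hS, SCCFamily.attr_alphaSet ((natCast_player_eq_one _).2 (by omega)) hS
    (fun i hi => (ha i).2 (by omega)) (fun i hi => by rw [ha]; omega), Set.sdiff_self_inter]
  rfl

section Membership

variable {z : ℕ} {S : Set (SCCPos k)}

theorem mem_dropAlpha_alpha (i : Fin (2 * k + 1)) :
    inl (alpha i) ∈ dropAlpha z S ↔ inl (alpha i) ∈ S ∧ i.val ≠ z + 1 := by
  simp [dropAlpha]

theorem mem_dropAlpha_beta (i : Fin (2 * k + 1)) :
    inl (beta i) ∈ dropAlpha z S ↔ inl (beta i) ∈ S ∧ i.val ≠ z + 2 := by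
  simp [dropAlpha]

theorem mem_dropAlpha_gamma (i : Fin (2 * k + 1)) :
    inl (gamma i) ∈ dropAlpha z S ↔ inl (gamma i) ∈ S := by
  simp [dropAlpha]

theorem mem_dropAlpha_delta (δ : DeltaPos k) : inr δ ∈ dropAlpha z S ↔ inr δ ∈ S := by
  simp [dropAlpha]

end Membership

/-! ### The attractor to the region of player `0` and the right child. -/

section Step

variable {z : ℕ} {U : Set (SCCPos k)} (h : TreeInv z U)
include h

/-- New positions arise along `γ_{z-1} → α_z → β_z`, all three owned by player `0`. Also `β_{z+1}`
is attracted if without `γ_{z+1}` it can only move to `α_z`, and so are the `δ` of player `1` left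
with no move elsewhere. -/
theorem TreeInv.attr_win :
    (sccGame k).attr U 0 {v | v ∈ U ∧ WinPred z U v} = {v | v ∈ U ∧ AttrPred z U v} := by
  have hz := h.even
  have hzk := h.le
  refine Set.Subset.antisymm (attr_subset_of_closed
    (fun v hv => ⟨hv.2, attrPred_of_winPred hv.1.2⟩) ?_) ?_
  · rintro v (⟨hv, ho, w, hw, hm, -, hA⟩ | ⟨hv, ho, hall⟩)
    · refine ⟨hv, ?_⟩
      rcases v with (i | i | i) | δ
      · have hiz := (h.alpha_mem i).1 hv
        rw [owner_alpha_zero] at ho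
        rw [move_alpha] at hm
        subst hm
        rcases hA with hA | ⟨hA, -⟩
        · exact hA
        · omega
      · rw [owner_beta_zero] at ho
        have hiz : i.val ≤ z := by
          by_contra hcon
          have := h.beta_high i (by omega) hv
          omega
        rw [move_beta] at hm
        rcases hm with rfl | ⟨j, hj, rfl⟩
        · rcases hA with ⟨-, hA⟩ | hA
          · exact Or.inl (le_antisymm hiz hA)
          · omega
        · have hA : j.val = z := hA
          omega
      · rw [owner_gamma_zero] at ho
        rw [move_gamma] at hm
        rcases hm with rfl | rfl | ⟨j, hj, rfl⟩ | ⟨δ, hδ, rfl⟩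
        · rcases hA with hA | ⟨hA, hn⟩
          · omega
          · exact absurd hv hn
        · exact hA
        · have hA : j.val = z := hA
          exact Or.inr (by omega)
        · rcases hA with hA | ⟨-, hA, -⟩
          · rw [winPred_delta_one (owner_of_odd hδ ho)] at hA
            exact absurd hv (hA i hδ)
          · exact Or.inr (hA i hδ hv)
      · have ho : δ.1.2.2 = 0 := ho
        rw [attrPred_delta_zero ho]
        rw [move_delta] at hm
        rcases hm with ⟨i, hi, rfl⟩ | ⟨δ', h', rfl⟩
        · have := gammaDelta_even hi ho
          rcases hA with hA | hA
          · exact (winPred_delta_zero ho).2 (Or.inl ⟨i, hi, hA.2⟩)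
          · omega
        · rcases hA with hA | ⟨-, -, hA⟩
          · rw [winPred_delta_one (h'.owner_one ho)] at hA
            exact (winPred_delta_zero ho).2 (Or.inr ⟨δ', h', hA⟩)
          · exact hA δ h'.symm hv
    · rw [player_ne_zero] at ho
      refine ⟨hv, ?_⟩
      rcases v with (i | i | i) | δ
      · have hiz := (h.alpha_mem i).1 hv
        rw [owner_alpha_one] at ho
        obtain ⟨-, hA⟩ := hall _ (h.beta_low i (by omega)) (move_alpha.2 rfl)
        rcases hA with hA | ⟨hA, -⟩
        · exact hA
        · omega
      · rw [owner_beta_one] at ho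
        rcases lt_or_ge i.val z with hiz | hiz
        · obtain ⟨-, hA⟩ := hall _ ((h.alpha_mem ⟨i.val - 1, by omega⟩).2
            (show i.val - 1 ≤ z by omega))
            (move_beta.2 (Or.inr ⟨_, show i.val - 1 + 1 = i.val by omega, rfl⟩))
          have hA : i.val - 1 = z := hA
          omega
        · by_cases hg : inl (gamma i) ∈ U
          · obtain ⟨-, hA⟩ := hall _ hg (move_beta.2 (Or.inl rfl))
            rcases hA with hA | hA <;> omega
          · exact Or.inr ⟨(h.beta_high i (by omega) hv).2.resolve_right hg, hg⟩
      · exact (hall _ hv (move_gamma.2 (Or.inr (Or.inl rfl)))).2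
      · have ho : δ.1.2.2 = 1 := ho
        refine Or.inr ⟨ho, fun i hi hg => ?_, fun δ' h' hδ' => ?_⟩
        · obtain ⟨-, hA⟩ := hall _ hg (move_delta.2 (Or.inl ⟨i, hi, rfl⟩))
          have := gammaDelta_odd hi ho
          rcases hA with hA | hA <;> omega
        · obtain ⟨-, hA⟩ := hall _ hδ' (move_delta.2 (Or.inr ⟨δ', h', rfl⟩))
          exact (attrPred_delta_zero (h'.owner_zero ho)).1 hA
  · have hbz : ∀ i : Fin (2 * k + 1), i.val = z → (inl (beta i) : SCCPos k) ∈
        (sccGame k).attr U 0 {v | v ∈ U ∧ WinPred z U v} :=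
      fun i hi =>
      subset_attr U 0 _ ⟨⟨h.beta_low i (by omega), hi⟩, h.beta_low i (by omega)⟩
    have haz : ∀ i : Fin (2 * k + 1), i.val = z → (inl (alpha i) : SCCPos k) ∈
        (sccGame k).attr U 0 {v | v ∈ U ∧ WinPred z U v} := by
      rintro i hi
      exact mem_attr_own ((h.alpha_mem i).2 hi.le) (owner_alpha_zero.2 (by omega))
        (move_alpha.2 rfl) (hbz i hi)
    have hgz : ∀ i : Fin (2 * k + 1), i.val + 1 = z → (inl (gamma i) : SCCPos k) ∈
        (sccGame k).attr U 0 {v | v ∈ U ∧ WinPred z U v} := by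
      rintro i hi
      exact mem_attr_own (h.gamma_low i (by omega)) (owner_gamma_zero.2 (by omega))
        (move_gamma.2 (Or.inr (Or.inr (Or.inl ⟨⟨z, by omega⟩, hi.symm, rfl⟩)))) (haz _ rfl)
    have hW : ∀ v ∈ U, WinPred z U v →
        v ∈ (sccGame k).attr U 0 {v | v ∈ U ∧ WinPred z U v} :=
      fun v hv hW => subset_attr U 0 _ ⟨⟨hv, hW⟩, hv⟩
    rintro ((i | i | i) | δ) ⟨hv, hA⟩
    · exact haz i hA
    · rcases hA with hA | ⟨hA, hn⟩
      · exact hW _ hv hA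
      · refine mem_attr_opp hv (player_ne_zero.2 (owner_beta_one.2 (by omega)))
          fun w hw hm => ?_
        rw [move_beta] at hm
        rcases hm with rfl | ⟨j, hj, rfl⟩
        · exact absurd hw hn
        · exact haz j (by omega)
    · rcases hA with hA | hA
      · exact hW _ hv hA
      · exact hgz i hA
    · rcases hA with hA | ⟨ho, h1, h2⟩
      · exact hW _ hv hA
      · refine mem_attr_opp hv (player_ne_zero.2 ho) fun w hw hm => ?_
        rw [move_delta] at hm
        rcases hm with ⟨i, hi, rfl⟩ | ⟨δ', h', rfl⟩
        · exact hgz i (h1 i hi hw)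
        · exact hW _ hw (h2 δ' h' hw)

theorem TreeInv.diff_attr_win :
    U \ (sccGame k).attr U 0 {v | v ∈ U ∧ WinPred z U v} = hatRight z U := by
  rw [h.attr_win]
  ext v
  simp only [hatRight, Set.mem_sdiff, Set.mem_ofPred_eq, not_and]
  exact ⟨fun hv => ⟨hv.1, hv.2 hv.1⟩, fun hv => ⟨hv.1, fun _ => hv.2⟩⟩

theorem TreeInv.isSubgame_hatRight : (sccGame k).IsSubgame (hatRight z U) := by
  rw [← h.diff_attr_win]; exact isSubgame_diff_attr h.isSubgame _ _

theorem TreeInv.mem_hatRight_alpha (i : Fin (2 * k + 1)) :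
    inl (alpha i) ∈ hatRight z U ↔ i.val < z := by
  change inl (alpha i) ∈ U ∧ ¬ i.val = z ↔ _
  rw [h.alpha_mem]; omega

theorem TreeInv.mem_hatRight_beta (i : Fin (2 * k + 1)) :
    inl (beta i) ∈ hatRight z U ↔
      i.val < z ∨ (z < i.val ∧ inl (beta i) ∈ U ∧ inl (gamma i) ∈ U) := by
  change inl (beta i) ∈ U ∧ ¬ (i.val = z ∨ (i.val = z + 1 ∧ inl (gamma i) ∉ U)) ↔ _
  constructor
  · rintro ⟨hb, hA⟩
    push Not at hA
    rcases lt_or_gt_of_ne hA.1 with hlt | hlt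
    · exact Or.inl hlt
    · rcases (h.beta_high i hlt hb).2 with h1 | h1
      · exact Or.inr ⟨hlt, hb, hA.2 h1⟩
      · exact Or.inr ⟨hlt, hb, h1⟩
  · rintro (hlt | ⟨hlt, hb, hg⟩)
    · exact ⟨h.beta_low i (by omega), by omega⟩
    · refine ⟨hb, ?_⟩
      rintro (h1 | h1)
      · omega
      · exact h1.2 hg

omit h in
theorem mem_hatRight_gamma (i : Fin (2 * k + 1)) :
    inl (gamma i) ∈ hatRight z U ↔
      inl (gamma i) ∈ U ∧ (i.val % 2 = 0 → i.val < z) ∧ i.val + 1 ≠ z := by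
  change inl (gamma i) ∈ U ∧ ¬ ((i.val % 2 = 0 ∧ z ≤ i.val) ∨ i.val + 1 = z) ↔ _
  refine and_congr_right fun _ => ?_
  push Not
  rfl

omit h in
theorem mem_hatRight_delta (δ : DeltaPos k) :
    inr δ ∈ hatRight z U ↔ inr δ ∈ U ∧ ¬ AttrPred z U (inr δ) := Iff.rfl

theorem TreeInv.deltaInv_hatRight : DeltaInv (hatRight z U) := by
  have hz := h.even
  constructor
  · intro δ h0 hδ i hi
    rw [mem_hatRight_delta, attrPred_delta_zero h0, winPred_delta_zero h0] at hδ
    push Not at hδ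
    have := gammaDelta_even hi h0
    rw [mem_hatRight_gamma]
    exact ⟨h.delta.zero_gamma δ h0 hδ.1 i hi, fun _ => hδ.2.1 i hi, by omega⟩
  · intro δ h0 i hi hg
    rw [mem_hatRight_gamma] at hg
    refine ⟨h.delta.one_gamma δ h0 i hi hg.1, ?_⟩
    rintro (hA | ⟨-, hA, -⟩)
    · exact (winPred_delta_one h0).1 hA i hi hg.1
    · exact hg.2.2 (hA i hi hg.1)
  · intro δ h0 h1 h2
    rw [mem_hatRight_delta, attrPred_delta_zero h0, winPred_delta_zero h0]
    refine ⟨h.delta.zero_of δ h0 (fun i hi => (h1 i hi).1) (fun δ' h' i hi => (h2 δ' h' i hi).1),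
      ?_⟩
    rintro (⟨i, hi, hzi⟩ | ⟨δ', h', hall⟩)
    · have := (mem_hatRight_gamma i).1 (h1 i hi)
      have := this.2.1 (gammaDelta_even hi h0)
      omega
    · obtain ⟨i, hi⟩ := exists_gammaDelta δ'
      exact hall i hi (h2 δ' h' i hi).1
  · rintro δ h0 ⟨-, hA⟩
    simp only [AttrPred, not_or, not_and, h0, true_implies] at hA
    -- A `δ` of player `1` escapes the attractor through a `γ` other than `γ_{z-1}`, or else through
    -- a partner that player `0` does not win.
    by_cases hcon : ∀ i, gammaDelta i δ → inl (gamma i) ∈ U → i.val + 1 = z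
    · have h2 := hA.2 hcon
      push Not at h2
      obtain ⟨δ', h', hδ', hW⟩ := h2
      exact Or.inr ⟨δ', h', hδ', by rwa [attrPred_delta_zero (h'.owner_zero h0)]⟩
    · push Not at hcon
      obtain ⟨i, hi, hg, hne⟩ := hcon
      have := gammaDelta_odd hi h0
      exact Or.inl ⟨i, hi, (mem_hatRight_gamma i).2 ⟨hg, by omega, hne⟩⟩
  · rintro δ δ' h0 h' ⟨hδ, hA⟩
    rw [attrPred_delta_zero h0] at hA
    refine ⟨h.delta.partner δ δ' h0 h' hδ, ?_⟩
    rintro (hA' | ⟨-, -, hA'⟩)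
    · exact hA ((winPred_delta_zero h0).2
        (Or.inr ⟨δ', h', (winPred_delta_one (h'.owner_one h0)).1 hA'⟩))
    · exact hA (hA' δ h'.symm hδ)

theorem TreeInv.deltaInv_hatLeft : DeltaInv (hatLeft z U) :=
  h.delta.congr mem_hatLeft_gamma mem_hatLeft_delta

end Step

/-- `β_{z+3}` goes with `α_{z+2}`, and `β_{z+2}` with `α_{z+1}`. The remaining `β` above `z` are
`β_{z+1}` and older odd ones that still have their `γ`. -/
theorem TreeInv.left {z : ℕ} {U : Set (SCCPos k)} (h : TreeInv (z + 2) U) :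
    TreeInv z (dropAlpha z (hatLeft (z + 2) U)) where
  even := by have := h.even; omega
  le := by have := h.le; omega
  alpha_mem i := by rw [mem_dropAlpha_alpha, h.mem_hatLeft_alpha]; omega
  beta_low i hi := by
    rw [mem_dropAlpha_beta, mem_hatLeft_beta]
    exact ⟨⟨h.beta_low i (by omega), by omega⟩, by omega⟩
  beta_high i hi hb := by
    have := h.even
    rw [mem_dropAlpha_beta, mem_hatLeft_beta] at hb
    rw [mem_dropAlpha_gamma, mem_hatLeft_gamma]
    rcases (show i.val = z + 1 ∨ z + 2 < i.val by omega) with h1 | h1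
    · exact ⟨by omega, Or.inl h1⟩
    · obtain ⟨h2, h3⟩ := h.beta_high i h1 hb.1.1
      exact ⟨h2, Or.inr (h3.resolve_left hb.1.2)⟩
  gamma_low i hi := by
    rw [mem_dropAlpha_gamma, mem_hatLeft_gamma]
    exact h.gamma_low i (by omega)
  delta := h.deltaInv_hatLeft.congr mem_dropAlpha_gamma mem_dropAlpha_delta

/-- Here `γ_{z+1}` is lost, which the invariant permits for `β_{z+1}` alone; a higher `β` survives
only together with its `γ`. -/
theorem TreeInv.right {z : ℕ} {U : Set (SCCPos k)} (h : TreeInv (z + 2) U) :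
    TreeInv z (dropAlpha z (hatRight (z + 2) U)) where
  even := by have := h.even; omega
  le := by have := h.le; omega
  alpha_mem i := by rw [mem_dropAlpha_alpha, h.mem_hatRight_alpha]; omega
  beta_low i hi := by
    rw [mem_dropAlpha_beta, h.mem_hatRight_beta]
    exact ⟨Or.inl (by omega), by omega⟩
  beta_high i hi hb := by
    have := h.even
    rw [mem_dropAlpha_beta, h.mem_hatRight_beta] at hb
    rw [mem_dropAlpha_gamma, mem_hatRight_gamma]
    rcases hb.1 with h1 | ⟨h1, hb, hg⟩
    · exact ⟨by omega, Or.inl (by omega)⟩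
    · have := (h.beta_high i h1 hb).1
      exact ⟨this, Or.inr ⟨hg, by omega, by omega⟩⟩
  gamma_low i hi := by
    have := h.even
    rw [mem_dropAlpha_gamma, mem_hatRight_gamma]
    exact ⟨h.gamma_low i (by omega), by omega, by omega⟩
  delta := h.deltaInv_hatRight.congr mem_dropAlpha_gamma mem_dropAlpha_delta

/-! ### Strong connectivity in the subgame tree -/

theorem TreeInv.stronglyConnected_hatLeft {z : ℕ} {U : Set (SCCPos k)} (h : TreeInv z U) :
    (sccGame k).StronglyConnected (hatLeft z U) := by
  have hz := h.even
  have hzk := h.le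
  refine stronglyConnected_of h.deltaInv_hatLeft
    ⟨0, (mem_hatLeft_gamma 0).2 (h.gamma_low 0 (by simp))⟩ (fun i hi => ?_) fun i hi => Or.inl ?_
  · rw [h.mem_hatLeft_alpha] at hi
    refine ⟨(mem_hatLeft_beta i).2 ⟨h.beta_low i (by omega), by omega⟩, ?_⟩
    by_cases h0 : i.val = 0
    · refine Or.inr ⟨⟨1, by omega⟩, by simp [h0], (mem_hatLeft_beta _).2 ⟨h.beta_low _ ?_, ?_⟩⟩
      · change 1 ≤ z + 1
        omega
      · change 1 ≠ z + 1
        omega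
    · refine Or.inl ⟨⟨i.val - 1, by omega⟩, Nat.succ_pred h0,
        (mem_hatLeft_gamma _).2 (h.gamma_low _ ?_)⟩
      change i.val - 1 ≤ z
      omega
  · rw [mem_hatLeft_beta] at hi
    rw [mem_hatLeft_gamma]
    rcases le_or_gt i.val z with h1 | h1
    · exact h.gamma_low i h1
    · exact (h.beta_high i h1 hi.1).2.resolve_left hi.2

/-- For `z = 0` all even `γ` are attracted, so some odd `γ` must serve as the hub; this fails
exactly along the all-`R` branch. -/
theorem TreeInv.stronglyConnected_hatRight {z : ℕ} {U : Set (SCCPos k)} (h : TreeInv z U)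
    (hne : z ≠ 0 ∨ ∃ i : Fin (2 * k + 1), i.val % 2 = 1 ∧ inl (gamma i) ∈ U) :
    (sccGame k).StronglyConnected (hatRight z U) := by
  have hz := h.even
  have hzk := h.le
  refine stronglyConnected_of h.deltaInv_hatRight ?_ (fun i hi => ?_) fun i hi => ?_
  · by_cases h0 : z = 0
    · obtain ⟨i, hi, hg⟩ := hne.resolve_left (not_not.2 h0)
      exact ⟨i, (mem_hatRight_gamma i).2 ⟨hg, by omega, by omega⟩⟩
    · refine ⟨0, (mem_hatRight_gamma 0).2 ⟨h.gamma_low 0 (by simp), fun _ => ?_, ?_⟩⟩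
      · change 0 < z
        omega
      · change 0 + 1 ≠ z
        omega
  · rw [h.mem_hatRight_alpha] at hi
    refine ⟨(h.mem_hatRight_beta i).2 (Or.inl hi), ?_⟩
    by_cases h0 : i.val = 0
    · refine Or.inr ⟨⟨1, by omega⟩, by simp [h0], (h.mem_hatRight_beta _).2 (Or.inl ?_)⟩
      change 1 < z
      omega
    · refine Or.inl ⟨⟨i.val - 1, by omega⟩, Nat.succ_pred h0,
        (mem_hatRight_gamma _).2 ⟨h.gamma_low _ ?_, fun _ => ?_, ?_⟩⟩
      · change i.val - 1 ≤ z
        omega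
      · change i.val - 1 < z
        omega
      · change i.val - 1 + 1 ≠ z
        omega
  · rw [h.mem_hatRight_beta] at hi
    by_cases hg : inl (gamma i) ∈ hatRight z U
    · exact Or.inl hg
    rcases hi with hi | ⟨hi, hb, hg'⟩
    · have hi1 : i.val + 1 = z := by
        by_contra hcon
        exact hg ((mem_hatRight_gamma i).2 ⟨h.gamma_low i (by omega), fun _ => hi, hcon⟩)
      refine Or.inr ⟨(h.mem_hatRight_alpha i).2 hi, ⟨i.val - 1, by omega⟩, ?_, ?_, ?_, ?_⟩
      · change i.val - 1 + 1 = i.val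
        omega
      · rw [h.mem_hatRight_alpha]
        change i.val - 1 < z
        omega
      · rw [h.mem_hatRight_beta]
        left
        change i.val - 1 < z
        omega
      · rw [mem_hatRight_gamma]
        refine ⟨h.gamma_low _ ?_, fun _ => ?_, ?_⟩
        · change i.val - 1 ≤ z
          omega
        · change i.val - 1 < z
          omega
        · change i.val - 1 + 1 ≠ z
          omega
    · have := (h.beta_high i hi hb).1
      exact absurd ((mem_hatRight_gamma i).2 ⟨hg', by omega, by omega⟩) hg

theorem TreeInv.hatRight_eq_empty {U : Set (SCCPos k)} (h : TreeInv 0 U)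
    (hne : ∀ i : Fin (2 * k + 1), i.val % 2 = 1 → inl (gamma i) ∉ U) : hatRight 0 U = ∅ := by
  have hg : ∀ i, inl (gamma i) ∉ hatRight 0 U := by
    intro i hi
    rw [mem_hatRight_gamma] at hi
    rcases Nat.mod_two_eq_zero_or_one i.val with h0 | h0
    · exact absurd (hi.2.1 h0) (by omega)
    · exact hne i h0 hi.1
  have hd0 : ∀ δ : DeltaPos k, δ.1.2.2 = 0 → inr δ ∉ hatRight 0 U := by
    intro δ h0 hδ
    obtain ⟨i, hi⟩ := exists_gammaDelta δ
    exact hg i (h.deltaInv_hatRight.zero_gamma δ h0 hδ i hi)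
  rw [Set.eq_empty_iff_forall_notMem]
  rintro ((i | i | i) | δ) hv
  · rw [h.mem_hatRight_alpha] at hv
    omega
  · rw [h.mem_hatRight_beta] at hv
    rcases hv with hv | ⟨hi, hb, hg⟩
    · omega
    · exact hne i (h.beta_high i hi hb).1 hg
  · exact hg i hv
  · rcases player_zero_or_one δ.1.2.2 with h0 | h0
    · exact hd0 δ h0 hv
    · rcases h.deltaInv_hatRight.one_of δ h0 hv with ⟨i, -, hi⟩ | ⟨δ', h', hδ'⟩
      · exact hg i hi
      · exact hd0 δ' (h'.owner_zero h0) hδ'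

theorem TreeInv.stronglyConnected {z : ℕ} {U : Set (SCCPos k)} (h : TreeInv z U) (hk : 1 ≤ k)
    (hg : ∀ i : Fin (2 * k + 1), i.val = z + 1 → inl (gamma i) ∈ U) :
    (sccGame k).StronglyConnected U := by
  refine stronglyConnected_of h.delta ⟨0, h.gamma_low 0 (by simp)⟩ (fun i hi => ?_)
    fun i hi => Or.inl ?_
  · rw [h.alpha_mem] at hi
    refine ⟨h.beta_low i (by omega), ?_⟩
    by_cases h0 : i.val = 0
    · refine Or.inr ⟨⟨1, by omega⟩, by simp [h0], h.beta_low _ ?_⟩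
      change 1 ≤ z + 1
      omega
    · refine Or.inl ⟨⟨i.val - 1, by omega⟩, Nat.succ_pred h0, h.gamma_low _ ?_⟩
      change i.val - 1 ≤ z
      omega
  · rcases le_or_gt i.val z with h1 | h1
    · exact h.gamma_low i h1
    · exact (h.beta_high i h1 hi).2.elim (hg i) id

/-! ### The terminal component of a node without `γ_{z+1}`. -/

section Transient

variable {z : ℕ} {U : Set (SCCPos k)}

theorem mem_diff_transient_alpha (i : Fin (2 * k + 1)) :
    inl (alpha i) ∈ U \ transientPos (k := k) inl z ↔
      inl (alpha i) ∈ U ∧ ¬ (z = 0 ∧ i.val = 0) := by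
  simp [transientPos]

theorem mem_diff_transient_beta (i : Fin (2 * k + 1)) :
    inl (beta i) ∈ U \ transientPos (k := k) inl z ↔ inl (beta i) ∈ U ∧ i.val ≠ z + 1 := by
  simp [transientPos]

theorem mem_diff_transient_gamma (i : Fin (2 * k + 1)) :
    inl (gamma i) ∈ U \ transientPos (k := k) inl z ↔ inl (gamma i) ∈ U := by
  simp [transientPos]

theorem mem_diff_transient_delta (δ : DeltaPos k) :
    inr δ ∈ U \ transientPos (k := k) inl z ↔ inr δ ∈ U := by
  simp [transientPos]

theorem TreeInv.transientPos_subset (h : TreeInv z U) :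
    transientPos (k := k) inl z ⊆ U := by
  rintro v (⟨i, hi, rfl⟩ | ⟨h0, i, hi, rfl⟩)
  · exact h.beta_low i hi.le
  · exact (h.alpha_mem i).2 (by omega)

/-- The possible predecessors of `β_{z+1}` are `α_{z+1}` and `γ_{z+1}`, both absent. For `z = 0` the
only predecessor of `α_0` is `β_1`; for `z > 0`, `α_z` is still entered from `γ_{z-1}`. -/
theorem TreeInv.isTerminalSCC (h : TreeInv z U) (hz : z < 2 * k)
    (hg : ∀ i : Fin (2 * k + 1), i.val = z + 1 → inl (gamma i) ∉ U) :
    (sccGame k).IsTerminalSCC U (U \ transientPos (k := k) inl z) := by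
  have hze := h.even
  refine ⟨Set.sdiff_subset, stronglyConnected_of
    (h.delta.congr mem_diff_transient_gamma mem_diff_transient_delta)
    ⟨0, (mem_diff_transient_gamma 0).2 (h.gamma_low 0 (by simp))⟩ (fun i hi => ?_)
    fun i hi => Or.inl ?_, fun v hv w hw hm => ⟨hw, ?_⟩⟩
  · rw [mem_diff_transient_alpha, h.alpha_mem] at hi
    refine ⟨(mem_diff_transient_beta i).2 ⟨h.beta_low i (by omega), by omega⟩, ?_⟩
    by_cases h0 : i.val = 0
    · refine Or.inr ⟨⟨1, by omega⟩, by simp [h0],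
        (mem_diff_transient_beta _).2 ⟨h.beta_low _ ?_, ?_⟩⟩
      · change 1 ≤ z + 1
        omega
      · change 1 ≠ z + 1
        omega
    · refine Or.inl ⟨⟨i.val - 1, by omega⟩, Nat.succ_pred h0,
        (mem_diff_transient_gamma _).2 (h.gamma_low _ ?_)⟩
      change i.val - 1 ≤ z
      omega
  · rw [mem_diff_transient_beta] at hi
    rw [mem_diff_transient_gamma]
    rcases le_or_gt i.val z with h1 | h1
    · exact h.gamma_low i h1
    · exact (h.beta_high i h1 hi.1).2.resolve_left hi.2
  · rintro (⟨j, hj, rfl⟩ | ⟨h0, j, hj, rfl⟩)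
    · rcases v with (i | i | i) | δ
      · rw [move_alpha] at hm
        cases hm
        have := (h.alpha_mem _).1 hv.1
        omega
      · rw [move_beta] at hm
        rcases hm with hm | ⟨_, -, hm⟩ <;> cases hm
      · rw [move_gamma] at hm
        rcases hm with hm | hm | ⟨_, -, hm⟩ | ⟨_, -, hm⟩ <;> cases hm
        exact hg _ hj hv.1
      · rw [move_delta] at hm
        rcases hm with ⟨_, -, hm⟩ | ⟨_, -, hm⟩ <;> cases hm
    · rcases v with (i | i | i) | δ
      · rw [move_alpha] at hm
        cases hm
      · rw [move_beta] at hm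
        rcases hm with hm | ⟨_, hi, hm⟩ <;> cases hm
        rw [mem_diff_transient_beta] at hv
        omega
      · rw [move_gamma] at hm
        rcases hm with hm | hm | ⟨_, hi, hm⟩ | ⟨_, -, hm⟩ <;> cases hm
        omega
      · rw [move_delta] at hm
        rcases hm with ⟨_, -, hm⟩ | ⟨_, -, hm⟩ <;> cases hm

end Transient

end SCCFamily

/-! ### Attractors in closed parts and uniqueness of terminal components. -/

namespace ParityGame

variable {V : Type*} {G : ParityGame V}

theorem attr_eq_inter_of_closed {U C : Set V} (hC : C ⊆ U)
    (hc : ∀ v ∈ C, ∀ w ∈ U, G.move v w → w ∈ C) (p : Player) (X : Set V) :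
    G.attr C p X = G.attr U p X ∩ C := by
  refine Set.Subset.antisymm (Set.subset_inter (attr_subset_of_closed
    (fun v hv => subset_attr U p X ⟨hv.1, hC hv.2⟩) ?_) (attr_subset C p X)) ?_
  · rintro v (⟨hv, ho, w, hw, hm, hA⟩ | ⟨hv, ho, hall⟩)
    · exact mem_attr_own (hC hv) ho hm hA
    · exact mem_attr_opp (hC hv) ho fun w hw hm => hall w (hc v hv w hw hm) hm
  · have : G.attr U p X ⊆ {v | v ∈ C → v ∈ G.attr C p X} := by
      refine attr_subset_of_closed (fun v hv hvC => subset_attr C p X ⟨hv.1, hvC⟩) ?_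
      rintro v (⟨hv, ho, w, hw, hm, hA⟩ | ⟨hv, ho, hall⟩) hvC
      · exact mem_attr_own hvC ho hm (hA (hc v hvC w hw hm))
      · exact mem_attr_opp hvC ho fun w hw hm => hall w (hC hw) hm hw
    exact fun v hv => this hv.1 hv.2

/-- This lets the algorithm work on a terminal component `C` instead of `U`: positions outside `C`
would have been removed with the attractor anyway. -/
theorem minus_attr_of_closed {U C : Set V} (hU : G.IsSubgame U) (hC : C ⊆ U)
    (hc : ∀ v ∈ C, ∀ w ∈ U, G.move v w → w ∈ C) {p : Player} {X : Set V}
    (hX : U \ C ⊆ G.attr U p X) : G.minus C (G.attr C p X) = U \ G.attr U p X := by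
  have hCs : G.IsSubgame C := fun v hv => by
    obtain ⟨w, hw, hm⟩ := hU v (hC hv)
    exact ⟨w, hc v hv w hw hm, hm⟩
  rw [minus_attr hCs, attr_eq_inter_of_closed hC hc]
  ext v
  simp only [Set.mem_sdiff, Set.mem_inter_iff, not_and]
  refine ⟨fun hv => ⟨hC hv.1, fun hA => hv.2 hA hv.1⟩, fun hv => ?_⟩
  have hvC : v ∈ C := by
    by_contra hn
    exact hv.2 (hX ⟨hv.1, hn⟩)
  exact ⟨hvC, fun hA => absurd hA hv.2⟩

theorem IsTerminalSCC.subset_of_mem {U C C' : Set V} (hC : G.IsTerminalSCC U C)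
    (hC' : G.IsTerminalSCC U C') {v : V} (hv : v ∈ C) (hv' : v ∈ C') : C ⊆ C' := by
  intro w hw
  have := hC.2.1.2 v hv w hw
  induction this with
  | refl => exact hv'
  | tail _ hm ih => exact hC'.2.2 _ (ih hm.1) _ (hC.1 hm.2.1) hm.2.2

theorem IsTerminalSCC.eq_of_mem {U C C' : Set V} (hC : G.IsTerminalSCC U C)
    (hC' : G.IsTerminalSCC U C') {v : V} (hv : v ∈ C) (hv' : v ∈ C') : C = C' :=
  (hC.subset_of_mem hC' hv hv').antisymm (hC'.subset_of_mem hC hv' hv)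

theorem StronglyConnected.eq_of_isTerminalSCC {U C : Set V} (hU : G.StronglyConnected U)
    (hC : G.IsTerminalSCC U C) : C = U := by
  obtain ⟨v, hv⟩ := hC.2.1.1
  exact hC.eq_of_mem ⟨subset_rfl, hU, fun _ _ w hw _ => hw⟩ hv (hC.1 hv)

end ParityGame

namespace SCCFamily

open Sum CorePos ParityGame

variable {k : ℕ}

/-! ### The nodes of the subgame tree -/

/-- The child of `U` before the attractor of the second priority is removed. -/
def hatSide (z : ℕ) (U : Set (SCCPos k)) : Dir → Set (SCCPos k)
  | .L => hatLeft z U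
  | .R => hatRight z U

theorem TreeInv.hatChild_eq {l : ℕ} {U : Set (SCCPos k)} (h : TreeInv (2 * (k - l)) U) (x : Dir) :
    hatChild (sccGame k) inl l U x = hatSide (2 * (k - l)) U x := by
  cases x
  · exact h.minus_left
  · change (sccGame k).minus U ((sccGame k).attr U 0 ((sccGame k).win ((sccGame k).minus U
      ((sccGame k).attr U 1 (alphaSet inl (2 * (k - l))))) 0)) = _
    rw [h.minus_left, h.win_hatLeft, minus_attr h.isSubgame, h.diff_attr_win]
    rfl

theorem TreeInv.isSubgame_hatSide {z : ℕ} {U : Set (SCCPos k)} (h : TreeInv z U) (x : Dir) :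
    (sccGame k).IsSubgame (hatSide z U x) := by
  cases x
  · exact h.isSubgame_hatLeft
  · exact h.isSubgame_hatRight

theorem TreeInv.mem_hatSide_alpha {z : ℕ} {U : Set (SCCPos k)} (h : TreeInv z U) (x : Dir)
    (i : Fin (2 * k + 1)) : inl (alpha i) ∈ hatSide z U x ↔ i.val < z := by
  cases x
  · exact h.mem_hatLeft_alpha i
  · exact h.mem_hatRight_alpha i

theorem TreeInv.dropAlpha_hatSide {z : ℕ} {U : Set (SCCPos k)} (h : TreeInv (z + 2) U) (x : Dir) :
    TreeInv z (dropAlpha z (hatSide (z + 2) U x)) := by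
  cases x
  · exact h.left
  · exact h.right

theorem mem_dropAlpha_hatSide_gamma {z : ℕ} {U : Set (SCCPos k)} (x : Dir)
    {i : Fin (2 * k + 1)} (hi : i.val % 2 = 1) :
    inl (gamma i) ∈ dropAlpha z (hatSide (z + 2) U x) ↔
      inl (gamma i) ∈ U ∧ (x = Dir.R → i.val ≠ z + 1) := by
  rw [mem_dropAlpha_gamma]
  cases x
  · simp [hatSide, mem_hatLeft_gamma]
  · simp only [hatSide, mem_hatRight_gamma]
    refine and_congr_right fun _ => ⟨fun h _ => by omega, fun h => ⟨by omega, ?_⟩⟩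
    have := h trivial
    omega

theorem treeInv_treeGame {w : List Dir} (hw : w.length ≤ k) :
    TreeInv (2 * (k - w.length)) (treeGame (sccGame k) inl w) := by
  induction w with
  | nil => exact treeInv_univ
  | cons x w ih =>
    rw [List.length_cons] at hw
    have h := ih (by omega)
    rw [treeGame, h.hatChild_eq, List.length_cons]
    rw [show 2 * (k - w.length) = 2 * (k - (w.length + 1)) + 2 by omega] at h ⊢
    rw [minus_dropAlpha (by omega) (h.isSubgame_hatSide x) (h.mem_hatSide_alpha x)]
    exact h.dropAlpha_hatSide x

theorem treeGame_cons {w : List Dir} (hw : w.length < k) (x : Dir) :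
    treeGame (sccGame k) inl (x :: w) = dropAlpha (2 * (k - (w.length + 1)))
      (hatSide (2 * (k - (w.length + 1)) + 2) (treeGame (sccGame k) inl w) x) := by
  have h := treeInv_treeGame (k := k) hw.le
  rw [treeGame, h.hatChild_eq]
  rw [show 2 * (k - w.length) = 2 * (k - (w.length + 1)) + 2 by omega] at h ⊢
  rw [minus_dropAlpha (by omega) (h.isSubgame_hatSide x) (h.mem_hatSide_alpha x)]

/-- Each level of the tree decides about one odd `γ`, and different levels about different ones;
this is how a node stores its word. -/
theorem mem_treeGame_gamma {w : List Dir} (hw : w.length < k) (x : Dir)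
    {i : Fin (2 * k + 1)} (hi : i.val % 2 = 1) :
    inl (gamma i) ∈ treeGame (sccGame k) inl (x :: w) ↔
      inl (gamma i) ∈ treeGame (sccGame k) inl w ∧
        (x = Dir.R → i.val ≠ 2 * (k - (w.length + 1)) + 1) := by
  rw [treeGame_cons hw, mem_dropAlpha_hatSide_gamma x hi]

/-- The odd positions `γ` of `G_w` determine `w`. -/
theorem treeGame_gamma_injective {w w' : List Dir} (hw : w.length ≤ k)
    (hl : w.length = w'.length)
    (h : ∀ i : Fin (2 * k + 1), i.val % 2 = 1 →
      (inl (gamma i) ∈ treeGame (sccGame k) inl w ↔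
        inl (gamma i) ∈ treeGame (sccGame k) inl w')) : w = w' := by
  induction w generalizing w' with
  | nil => exact (List.length_eq_zero_iff.1 hl.symm).symm
  | cons x w ih =>
    rcases w' with _ | ⟨y, w'⟩
    · simp at hl
    rw [List.length_cons] at hw
    have hl' : w.length = w'.length := by simpa using hl
    have hmem : ∀ u : List Dir, u.length = w.length → ∀ i : Fin (2 * k + 1),
        i.val = 2 * (k - (w.length + 1)) + 1 → inl (gamma i) ∈ treeGame (sccGame k) inl u :=
      fun u hu i hi => (treeInv_treeGame (by omega)).gamma_low i (by rw [hu]; omega)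
    have h' : ∀ i : Fin (2 * k + 1), i.val % 2 = 1 →
        ((inl (gamma i) ∈ treeGame (sccGame k) inl w ∧
          (x = Dir.R → i.val ≠ 2 * (k - (w.length + 1)) + 1)) ↔
        (inl (gamma i) ∈ treeGame (sccGame k) inl w' ∧
          (y = Dir.R → i.val ≠ 2 * (k - (w.length + 1)) + 1))) := by
      intro i hi
      have := h i hi
      rwa [mem_treeGame_gamma (by omega) x hi, mem_treeGame_gamma (by omega) y hi, ← hl'] at this
    -- The `γ` decided by the last letter is present in both parents, and all other odd `γ` pass
    -- through the last level unchanged. So the children determine the parents, and that one `γ`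
    -- then determines the letter.
    have hw' : w = w' := by
      refine ih (by omega) hl' fun i hi => ?_
      by_cases hi' : i.val = 2 * (k - (w.length + 1)) + 1
      · exact iff_of_true (hmem w rfl i hi') (hmem w' hl'.symm i hi')
      · simpa [hi'] using h' i hi
    have hxy := h' ⟨2 * (k - (w.length + 1)) + 1, by omega⟩
      (show (2 * (k - (w.length + 1)) + 1) % 2 = 1 by omega)
    simp only [hmem w rfl ⟨2 * (k - (w.length + 1)) + 1, by omega⟩ rfl,
      hmem w' hl'.symm ⟨2 * (k - (w.length + 1)) + 1, by omega⟩ rfl, true_and, ne_eq,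
      not_true_eq_false, imp_false] at hxy
    subst hw'
    cases x <;> cases y <;> simp at hxy ⊢

/-- A letter `L` spares the odd `γ` of its level, and deeper levels decide only about smaller
indices. -/
theorem exists_odd_gamma {w : List Dir} (hw : w.length ≤ k) (hL : Dir.L ∈ w) :
    ∃ i : Fin (2 * k + 1), i.val % 2 = 1 ∧ 2 * (k - w.length) < i.val ∧
      inl (gamma i) ∈ treeGame (sccGame k) inl w := by
  induction w with
  | nil => simp at hL
  | cons x w ih =>
    rw [List.length_cons] at hw ⊢
    rcases List.mem_cons.1 hL with rfl | hL
    · have hodd : (2 * (k - (w.length + 1)) + 1) % 2 = 1 := by omega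
      refine ⟨⟨2 * (k - (w.length + 1)) + 1, by omega⟩, hodd, Nat.lt_succ_self _,
        (mem_treeGame_gamma (by omega) _ hodd).2 ⟨?_, fun h => by cases h⟩⟩
      refine (treeInv_treeGame (by omega)).gamma_low _ ?_
      change 2 * (k - (w.length + 1)) + 1 ≤ 2 * (k - w.length)
      omega
    · obtain ⟨i, h1, h2, h3⟩ := ih (by omega) hL
      exact ⟨i, h1, by omega, (mem_treeGame_gamma (by omega) x h1).2 ⟨h3, by omega⟩⟩

theorem notMem_treeGame_replicate {n : ℕ} (hn : n ≤ k) {i : Fin (2 * k + 1)} (hi : i.val % 2 = 1)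
    (hz : 2 * (k - n) < i.val) :
    inl (gamma i) ∉ treeGame (sccGame k) inl (List.replicate n Dir.R) := by
  induction n with
  | zero => omega
  | succ n ih =>
    rw [List.replicate_succ, mem_treeGame_gamma (by simpa using hn) _ hi, List.length_replicate]
    rintro ⟨h1, h2⟩
    have := h2 rfl
    exact ih (by omega) (by omega) h1

theorem hatGame_eq {w : List Dir} (hw : w.length ≤ k) (x : Dir) :
    hatGame (sccGame k) inl w x =
      hatSide (2 * (k - w.length)) (treeGame (sccGame k) inl w) x :=
  (treeInv_treeGame hw).hatChild_eq x

theorem exists_L_of_ne_replicate {w : List Dir} (h : w ≠ List.replicate w.length Dir.R) :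
    Dir.L ∈ w := by
  by_contra hL
  refine h (List.eq_replicate_of_mem fun x hx => ?_)
  cases x
  · exact absurd hx hL
  · rfl

theorem stronglyConnected_hatGame {w : List Dir} {x : Dir} (hw : w.length ≤ k)
    (hne : x :: w ≠ List.replicate (k + 1) Dir.R) :
    (sccGame k).StronglyConnected (hatGame (sccGame k) inl w x) := by
  have h := treeInv_treeGame hw
  rw [hatGame_eq hw]
  cases x
  · exact h.stronglyConnected_hatLeft
  · refine h.stronglyConnected_hatRight ?_
    rcases eq_or_lt_of_le hw with hk | hk
    · right
      have hL : Dir.L ∈ w := by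
        refine exists_L_of_ne_replicate fun he => hne ?_
        rw [List.replicate_succ, ← hk, ← he]
      obtain ⟨i, h1, -, h3⟩ := exists_odd_gamma hw hL
      exact ⟨i, h1, h3⟩
    · left
      omega

theorem hatGame_replicate {w : List Dir} {x : Dir} (hw : w.length ≤ k)
    (he : x :: w = List.replicate (k + 1) Dir.R) :
    hatGame (sccGame k) inl w x = ∅ := by
  rw [List.replicate_succ, List.cons.injEq] at he
  obtain ⟨rfl, rfl⟩ := he
  have h := treeInv_treeGame hw
  rw [hatGame_eq hw]
  rw [List.length_replicate, Nat.sub_self, Nat.mul_zero] at h ⊢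
  exact h.hatRight_eq_empty fun i hi => notMem_treeGame_replicate le_rfl hi (by omega)

theorem stronglyConnected_treeGame_left {w : List Dir} (hw : w.length < k) :
    (sccGame k).StronglyConnected (treeGame (sccGame k) inl (Dir.L :: w)) := by
  refine (treeInv_treeGame (by simpa using hw)).stronglyConnected (by omega) fun i hi => ?_
  rw [List.length_cons] at hi
  rw [mem_treeGame_gamma hw _ (by omega)]
  exact ⟨(treeInv_treeGame hw.le).gamma_low i (by omega), fun h => by cases h⟩

theorem gamma_notMem_treeGame_right {w : List Dir} (hw : w.length < k) (i : Fin (2 * k + 1))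
    (hi : i.val = 2 * (k - (w.length + 1)) + 1) :
    inl (gamma i) ∉ treeGame (sccGame k) inl (Dir.R :: w) := by
  rw [mem_treeGame_gamma hw _ (by omega)]
  exact fun h => h.2 rfl hi

/-! ### The calls on the SCC family -/

/-- Every `α` has priority above `2k`, every other position at most `2k`. -/
theorem maxPrio_eq {m : ℕ} {S : Set (SCCPos k)} (hm : m < 2 * k + 1)
    (h1 : inl (alpha ⟨m, hm⟩) ∈ S)
    (h2 : ∀ i : Fin (2 * k + 1), inl (alpha i) ∈ S → i.val ≤ m) :
    (sccGame k).maxPrio S = 2 * k + m + 1 := by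
  refine le_antisymm (csSup_le ⟨_, _, h1, rfl⟩ ?_) (prio_le_maxPrio (G := sccGame k) h1)
  rintro n ⟨((i | i | i) | δ), hv, rfl⟩
  · rw [prio_alpha]
    have := h2 i hv
    omega
  · rw [prio_beta]; omega
  · rw [prio_gamma]; omega
  · rw [prio_delta]; omega

theorem topPos_eq {m : ℕ} {S : Set (SCCPos k)} (hm : m < 2 * k + 1)
    (h1 : inl (alpha ⟨m, hm⟩) ∈ S)
    (h2 : ∀ i : Fin (2 * k + 1), inl (alpha i) ∈ S → i.val ≤ m) :
    (sccGame k).topPos S = alphaSet (k := k) inl m := by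
  ext v
  rw [topPos, Set.mem_ofPred_eq, maxPrio_eq hm h1 h2]
  constructor
  · rintro ⟨hv, hp⟩
    rcases v with (i | i | i) | δ
    · rw [prio_alpha] at hp
      exact ⟨i, by omega, rfl⟩
    · rw [prio_beta] at hp; omega
    · rw [prio_gamma] at hp; omega
    · rw [prio_delta] at hp; omega
  · rintro ⟨i, rfl, rfl⟩
    exact ⟨h1, rfl⟩

/-- The left subgame of a node `Ĝ_w`. -/
theorem leftGame_hat {z : ℕ} {S : Set (SCCPos k)} (hz : z % 2 = 0) (hzk : z + 2 ≤ 2 * k)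
    (hS : (sccGame k).IsSubgame S)
    (ha : ∀ i : Fin (2 * k + 1), inl (alpha i) ∈ S ↔ i.val < z + 2) :
    (sccGame k).leftGame S = dropAlpha z S := by
  have hm : z + 1 < 2 * k + 1 := by omega
  have h1 : inl (alpha ⟨z + 1, hm⟩) ∈ S := (ha _).2 (Nat.lt_succ_self _)
  have h2 : ∀ i : Fin (2 * k + 1), inl (alpha i) ∈ S → i.val ≤ z + 1 := fun i hi => by
    have := (ha i).1 hi
    omega
  rw [leftGame, topPos_eq hm h1 h2, maxPrio_eq hm h1 h2,
    (natCast_player_eq_zero _).2 (by omega), minus_dropAlpha hz hS ha]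

/-- The part of a node `U = G_w` that is a single component. -/
structure MainComponent (z : ℕ) (U C : Set (SCCPos k)) : Prop where
  terminal : (sccGame k).IsTerminalSCC U C
  diff : ∀ v ∈ U, v ∉ C → z ≠ 0 → v ∈ betaSet (k := k) inl (z + 1)
  gamma_mem : ∀ i, inl (gamma i) ∈ C ↔ inl (gamma i) ∈ U
  gamma_high : ∀ i : Fin (2 * k + 1), inl (beta i) ∈ U → inl (beta i) ∉ C → inl (gamma i) ∉ U

/-- The explored family contains some terminal component of `U`, chosen by an unknown rule. From a
transient position the moves `β_{z+1} → α_z → β_z` lead into the large component, so the choice was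
forced. -/
theorem TreeInv.exists_mainComponent {z : ℕ} {U : Set (SCCPos k)} (h : TreeInv z U) (hk : 1 ≤ k)
    {T : Set (Set (SCCPos k))} (hT : (sccGame k).ExploredFamily T) (hU : U ∈ T) :
    ∃ C ∈ T, MainComponent z U C := by
  have hU0 : inl (gamma 0) ∈ U := h.gamma_low 0 (by simp)
  by_cases hg : ∀ i : Fin (2 * k + 1), i.val = z + 1 → inl (gamma i) ∈ U
  · exact ⟨U, hU, ⟨subset_rfl, h.stronglyConnected hk hg, fun _ _ _ hw _ => hw⟩,
      fun v hv hn => absurd hv hn, fun _ => Iff.rfl, fun i hi hn => absurd hi hn⟩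
  · push Not at hg
    obtain ⟨c, hc, hcU⟩ := hg
    have hze := h.even
    have hzk := h.le
    have hgam : ∀ i : Fin (2 * k + 1), i.val = z + 1 → inl (gamma i) ∉ U := fun i hi => by
      rwa [Fin.ext (hi.trans hc.symm)]
    have hterm := h.isTerminalSCC (by omega) hgam
    have hcβ : inl (beta c) ∈ U := h.beta_low c hc.le
    have hnsc : ¬ (sccGame k).StronglyConnected U := by
      intro hsc
      have := hsc.eq_of_isTerminalSCC hterm
      rw [← this, mem_diff_transient_beta] at hcβ
      exact hcβ.2 hc
    obtain ⟨C, hC, hCT⟩ := hT.comp U hU ⟨_, hU0⟩ hnsc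
    have hα : ∀ i : Fin (2 * k + 1), i.val = z → inl (alpha i) ∈ C →
        ∃ v ∈ C, v ∈ U \ transientPos (k := k) inl z := by
      intro i hi hiC
      refine ⟨inl (beta i), hC.2.2 _ hiC _ (h.beta_low i (by omega)) (move_alpha.2 rfl), ?_⟩
      rw [mem_diff_transient_beta]
      exact ⟨h.beta_low i (by omega), by omega⟩
    have hex : ∃ v ∈ C, v ∈ U \ transientPos (k := k) inl z := by
      obtain ⟨v, hv⟩ := hC.2.1.1
      by_cases ht : v ∈ transientPos (k := k) inl z
      · rcases ht with ⟨i, hi, rfl⟩ | ⟨h0, i, hi, rfl⟩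
        · refine hα ⟨z, by omega⟩ rfl (hC.2.2 _ hv _ ((h.alpha_mem _).2 le_rfl)
            (move_beta.2 (Or.inr ⟨_, hi.symm, rfl⟩)))
        · exact hα i (by omega) hv
      · exact ⟨v, hv, hC.1 hv, ht⟩
    obtain ⟨v, hv, hv'⟩ := hex
    have heq := hC.eq_of_mem hterm hv hv'
    refine ⟨C, hCT, hC, ?_, ?_, ?_⟩
    · intro v hv hn hz
      rw [heq] at hn
      have ht : v ∈ transientPos (k := k) inl z := by
        by_contra ht
        exact hn ⟨hv, ht⟩
      rcases ht with ht | ht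
      · exact ht
      · exact absurd ht.1 hz
    · intro i
      rw [heq, mem_diff_transient_gamma]
    · intro i hi hn
      rw [heq, mem_diff_transient_beta] at hn
      exact hgam i (by_contra fun h => hn ⟨hi, h⟩)

/-! ### From the component of a node to its two children. -/

section Trace

variable {z : ℕ} {U C : Set (SCCPos k)} (h : TreeInv (z + 2) U) (hC : MainComponent (z + 2) U C)
include h hC

theorem MainComponent.alpha_mem (i : Fin (2 * k + 1)) : inl (alpha i) ∈ C ↔ i.val ≤ z + 2 := by
  rw [← h.alpha_mem]
  refine ⟨fun hi => hC.terminal.1 hi, fun hi => ?_⟩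
  by_contra hn
  simpa using hC.diff _ hi hn (by omega)

theorem MainComponent.maxPrio_cast : ((sccGame k).maxPrio C : Player) = 1 := by
  have hz := h.even
  have hzk := h.le
  rw [maxPrio_eq (m := z + 2) (by omega) ((hC.alpha_mem h _).2 le_rfl)
    (fun i hi => (hC.alpha_mem h i).1 hi), natCast_player_eq_one]
  omega

theorem MainComponent.leftGame_eq : (sccGame k).leftGame C = hatLeft (z + 2) U := by
  have hzk := h.le
  rw [leftGame, hC.maxPrio_cast h, topPos_eq (m := z + 2) (by omega)
    ((hC.alpha_mem h _).2 le_rfl) (fun i hi => (hC.alpha_mem h i).1 hi),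
    minus_attr_of_closed h.isSubgame hC.terminal.1 hC.terminal.2.2, ← minus_attr h.isSubgame,
    h.minus_left]
  rw [h.attr_alphaSet]
  exact fun v hv => ⟨hv.1, Or.inr (hC.diff v hv.1 hv.2 (by omega))⟩

omit hC in
theorem TreeInv.hatLeftWin_zero :
    hatLeftWin (z + 2) U 0 = {v | v ∈ U ∧ WinPred (z + 2) U v} := by
  rw [← h.win_hatLeft, h.isSolution_hatLeftWin.win_eq h.isSubgame_hatLeft]

/-- A position of `U` outside `C` is `β_{z+3}` with `γ_{z+3}` missing, and this is attracted through
its only move, to `α_{z+2}`. -/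
theorem MainComponent.rightGame_eq :
    (sccGame k).rightGame C (hatLeftWin (z + 2) U 0) = hatRight (z + 2) U := by
  rw [rightGame, hC.maxPrio_cast h, h.hatLeftWin_zero, show (1 : Player) + 1 = 0 from rfl,
    minus_attr_of_closed h.isSubgame hC.terminal.1 hC.terminal.2.2, h.diff_attr_win]
  rw [h.attr_win]
  rintro v ⟨hv, hn⟩
  obtain ⟨i, hi, rfl⟩ := hC.diff v hv hn (by omega)
  exact ⟨hv, Or.inr ⟨hi, hC.gamma_high i hv hn⟩⟩

/-- The right call is forced: player `0` owns `α_{z+2}` and moves to `β_{z+2}`, which it wins, while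
`α_{z+2}` is not in the left subgame. -/
theorem MainComponent.pre_nonempty :
    ((sccGame k).pre C 0 (hatLeftWin (z + 2) U 0) \ hatLeftWin (z + 2) U 0).Nonempty := by
  have hz := h.even
  have hzk := h.le
  rw [h.hatLeftWin_zero]
  have ha := (hC.alpha_mem h ⟨z + 2, by omega⟩).2 le_rfl
  have hb := h.beta_low ⟨z + 2, by omega⟩ (Nat.le_succ _)
  exact ⟨_, Or.inl ⟨ha, owner_alpha_zero.2 hz, _, hC.terminal.2.2 _ ha _ hb (move_alpha.2 rfl),
    move_alpha.2 rfl, hb, rfl⟩, fun hW => hW.2⟩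

/-- One level of the tree costs two nested calls: on `C`, giving the left or right subgame, and on
that subgame, whose own left subgame is the next node. -/
theorem MainComponent.dropAlpha_mem {T : Set (Set (SCCPos k))}
    (hT : (sccGame k).ExploredFamily T) (hCT : C ∈ T) (x : Dir) :
    dropAlpha z (hatSide (z + 2) U x) ∈ T := by
  have hz := h.even
  have hzk := h.le
  have hsc : (sccGame k).StronglyConnected (hatSide (z + 2) U x) := by
    cases x
    · exact h.stronglyConnected_hatLeft
    · exact h.stronglyConnected_hatRight (Or.inl (by omega))
  have hmem : hatSide (z + 2) U x ∈ T := by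
    cases x
    · have := hT.left C hCT hC.terminal.2.1
      rw [hC.leftGame_eq h] at this
      exact this hsc.1
    · have := hT.right C hCT hC.terminal.2.1 (hatLeftWin (z + 2) U)
      rw [hC.leftGame_eq h, hC.maxPrio_cast h, show (1 : Player) + 1 = 0 from rfl,
        hC.rightGame_eq h] at this
      exact this h.isSolution_hatLeftWin (hC.pre_nonempty h) hsc.1
  have := hT.left _ hmem hsc
  rw [leftGame_hat (by omega) hzk (h.isSubgame_hatSide x) (h.mem_hatSide_alpha x)] at this
  exact this ⟨_, (h.dropAlpha_hatSide x).gamma_low 0 (by simp)⟩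

end Trace

theorem exists_mainComponent_treeGame (hk : 1 ≤ k) {T : Set (Set (SCCPos k))}
    (hT : (sccGame k).ExploredFamily T) (hU : Set.univ ∈ T) {w : List Dir} (hw : w.length ≤ k) :
    ∃ C ∈ T, MainComponent (2 * (k - w.length)) (treeGame (sccGame k) inl w) C := by
  induction w with
  | nil => exact treeInv_univ.exists_mainComponent hk hT hU
  | cons x w ih =>
    rw [List.length_cons] at hw
    obtain ⟨C, hCT, hC⟩ := ih (by omega)
    have h := treeInv_treeGame (k := k) (w := w) (by omega)
    have h' := treeInv_treeGame (k := k) (w := x :: w) hw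
    rw [treeGame_cons (by omega)] at h' ⊢
    rw [show 2 * (k - w.length) = 2 * (k - (w.length + 1)) + 2 by omega] at h hC
    exact h'.exists_mainComponent hk hT (hC.dropAlpha_mem h hT hCT x)

/-- An explored family of the SCC family has at least `2 ^ k` single components. -/
theorem two_pow_le_ncard (hk : 1 ≤ k) {T : Set (Set (SCCPos k))}
    (hT : (sccGame k).ExploredFamily T) (hU : Set.univ ∈ T) :
    2 ^ k ≤ {U | U ∈ T ∧ (sccGame k).StronglyConnected U}.ncard := by
  classical
  let word : (Fin k → Bool) → List Dir := fun f =>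
    List.ofFn fun i => if f i then Dir.L else Dir.R
  have hlen : ∀ f, (word f).length = k := fun f => List.length_ofFn
  have hinj : Function.Injective word := by
    intro f g hfg
    have := List.ofFn_injective hfg
    funext i
    have hi := congrFun this i
    cases hf : f i <;> cases hg : g i <;> simp [hf, hg] at hi ⊢
  choose C hCT hC using fun f => exists_mainComponent_treeGame hk hT hU (hlen f).le
  have hCinj : Function.Injective C := by
    intro f g hfg
    refine hinj (treeGame_gamma_injective (hlen f).le ((hlen f).trans (hlen g).symm)
      fun i _ => ?_)
    rw [← (hC f).gamma_mem, ← (hC g).gamma_mem, hfg]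
  have hsub : Set.range C ⊆ {U | U ∈ T ∧ (sccGame k).StronglyConnected U} := by
    rintro _ ⟨f, rfl⟩
    exact ⟨hCT f, (hC f).terminal.2.1⟩
  calc 2 ^ k = Nat.card (Fin k → Bool) := by simp
    _ = (Set.range C).ncard := by
      rw [← Set.image_univ, Set.ncard_image_of_injective _ hCinj, Set.ncard_univ]
    _ ≤ _ := Set.ncard_le_ncard hsub (Set.toFinite _)

end SCCFamily

namespace ParityGame

/-! ### Embedded games -/

/-- The injection `ι` identifies `G` with a part of `G'`. -/
structure IsEmbedding {V V' : Type*} (G : ParityGame V) (G' : ParityGame V') (ι : V → V') :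
    Prop where
  inj : Function.Injective ι
  owner : ∀ v, G'.owner (ι v) = G.owner v
  prio : ∀ v, G'.prio (ι v) = G.prio v
  move : ∀ v w, G'.move (ι v) (ι w) ↔ G.move v w

namespace IsEmbedding

variable {V V' : Type*} {G : ParityGame V} {G' : ParityGame V'} {ι : V → V'}
  (h : G.IsEmbedding G' ι)
include h

theorem isSubgame_preimage {Y : Set V'} {U : Set V} (hY : Y ⊆ ι '' U) (hs : G'.IsSubgame Y) :
    G.IsSubgame (ι ⁻¹' Y) := by
  intro v hv
  obtain ⟨w', hw, hm⟩ := hs _ hv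
  obtain ⟨w, -, rfl⟩ := hY hw
  exact ⟨w, hw, (h.move v w).1 hm⟩

theorem isSubgame_image {U : Set V} (hU : G.IsSubgame U) : G'.IsSubgame (ι '' U) := by
  rintro _ ⟨v, hv, rfl⟩
  obtain ⟨w, hw, hm⟩ := hU v hv
  exact ⟨ι w, ⟨w, hw, rfl⟩, (h.move v w).2 hm⟩

theorem minus_image (U X : Set V) : G'.minus (ι '' U) (ι '' X) = ι '' G.minus U X := by
  refine Set.Subset.antisymm ?_ ?_
  · rintro v' ⟨Y, ⟨hY, hs⟩, hv⟩
    obtain ⟨v, -, rfl⟩ := (hY hv).1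
    refine ⟨v, subset_minus (fun u hu => ?_)
      (h.isSubgame_preimage (fun x hx => (hY hx).1) hs) hv, rfl⟩
    obtain ⟨⟨u', hu', he⟩, hX⟩ := hY hu
    rw [h.inj he] at hu'
    exact ⟨hu', fun hx => hX ⟨u, hx, rfl⟩⟩
  · refine subset_minus ?_ (h.isSubgame_image (isSubgame_minus U X))
    rw [← Set.image_sdiff h.inj]
    exact Set.image_mono (G.minus_subset U X)

theorem pre_image (U : Set V) (p : Player) (X : Set V) :
    G'.pre (ι '' U) p (ι '' X) = ι '' G.pre U p X := by
  ext v'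
  constructor
  · rintro (⟨⟨v, hv, rfl⟩, ho, _, ⟨w, hw, rfl⟩, hm, hX⟩ | ⟨⟨v, hv, rfl⟩, ho, hall⟩)
    · exact ⟨v, Or.inl ⟨hv, (h.owner v).symm.trans ho, w, hw, (h.move v w).1 hm,
        (h.inj.mem_set_image).1 hX⟩, rfl⟩
    · rw [h.owner] at ho
      exact ⟨v, Or.inr ⟨hv, ho, fun w hw hm => (h.inj.mem_set_image).1
        (hall _ ⟨w, hw, rfl⟩ ((h.move v w).2 hm))⟩, rfl⟩
  · rintro ⟨v, ⟨hv, ho, w, hw, hm, hX⟩ | ⟨hv, ho, hall⟩, rfl⟩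
    · exact Or.inl ⟨⟨v, hv, rfl⟩, (h.owner v).trans ho, ι w, ⟨w, hw, rfl⟩, (h.move v w).2 hm,
        ⟨w, hX, rfl⟩⟩
    · refine Or.inr ⟨⟨v, hv, rfl⟩, by rwa [h.owner], ?_⟩
      rintro _ ⟨w, hw, rfl⟩ hm
      exact ⟨w, hall w hw ((h.move v w).1 hm), rfl⟩

theorem attr_image (U : Set V) (p : Player) (X : Set V) :
    G'.attr (ι '' U) p (ι '' X) = ι '' G.attr U p X := by
  refine Set.Subset.antisymm (attr_subset_of_closed ?_ ?_) ?_
  · rw [← Set.image_inter h.inj]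
    exact Set.image_mono (subset_attr U p X)
  · rw [h.pre_image]
    exact Set.image_mono (pre_attr_subset U p X)
  · rw [Set.image_subset_iff]
    refine attr_subset_of_closed
      (fun v hv => subset_attr (ι '' U) p (ι '' X) ⟨⟨v, hv.1, rfl⟩, ⟨v, hv.2, rfl⟩⟩) ?_
    intro v hv
    refine pre_attr_subset (ι '' U) p (ι '' X) ?_
    have hsub : ι '' (ι ⁻¹' G'.attr (ι '' U) p (ι '' X)) ⊆ G'.attr (ι '' U) p (ι '' X) :=
      Set.image_preimage_subset _ _
    refine G'.pre_mono (ι '' U) p hsub ?_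
    rw [h.pre_image]
    exact ⟨v, hv, rfl⟩

theorem maxPrio_image (U : Set V) : G'.maxPrio (ι '' U) = G.maxPrio U := by
  rw [maxPrio, Set.image_image]
  simp only [h.prio]
  rfl

theorem topPos_image (U : Set V) : G'.topPos (ι '' U) = ι '' G.topPos U := by
  ext v'
  rw [topPos, h.maxPrio_image]
  constructor
  · rintro ⟨⟨v, hv, rfl⟩, hp⟩
    exact ⟨v, ⟨hv, (h.prio v).symm.trans hp⟩, rfl⟩
  · rintro ⟨v, ⟨hv, hp⟩, rfl⟩
    exact ⟨⟨v, hv, rfl⟩, (h.prio v).trans hp⟩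

theorem leftGame_image (U : Set V) : G'.leftGame (ι '' U) = ι '' G.leftGame U := by
  rw [leftGame, h.maxPrio_image, h.topPos_image, h.attr_image, h.minus_image]; rfl

theorem rightGame_image (U W : Set V) :
    G'.rightGame (ι '' U) (ι '' W) = ι '' G.rightGame U W := by
  rw [rightGame, h.maxPrio_image, h.attr_image, h.minus_image]; rfl

theorem stronglyConnected_image {U : Set V} :
    G'.StronglyConnected (ι '' U) ↔ G.StronglyConnected U := by
  constructor
  · rintro ⟨hne, hr⟩
    refine ⟨Set.image_nonempty.1 hne, fun v hv w hw => ?_⟩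
    have := hr (ι v) ⟨v, hv, rfl⟩ (ι w) ⟨w, hw, rfl⟩
    have key : ∀ x, Relation.ReflTransGen
        (fun a b => a ∈ ι '' U ∧ b ∈ ι '' U ∧ G'.move a b) (ι v) x → ∀ u, ι u = x →
        Relation.ReflTransGen (fun a b => a ∈ U ∧ b ∈ U ∧ G.move a b) v u := by
      intro x hx
      induction hx with
      | refl =>
        intro u hu
        rw [h.inj hu]
      | tail _ hm ih =>
        rintro u rfl
        obtain ⟨⟨a, ha, rfl⟩, hb, hm⟩ := hm
        exact (ih a rfl).tail ⟨ha, (h.inj.mem_set_image).1 hb, (h.move a u).1 hm⟩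
    exact key _ this w rfl
  · rintro ⟨hne, hr⟩
    refine ⟨hne.image ι, ?_⟩
    rintro _ ⟨v, hv, rfl⟩ _ ⟨w, hw, rfl⟩
    exact (hr v hv w hw).lift ι fun a b hab =>
      ⟨⟨a, hab.1, rfl⟩, ⟨b, hab.2.1, rfl⟩, (h.move a b).2 hab.2.2⟩

theorem isTerminalSCC_of_image {U C : Set V} (hC : G'.IsTerminalSCC (ι '' U) (ι '' C)) :
    G.IsTerminalSCC U C :=
  ⟨(Set.image_subset_image_iff h.inj).1 hC.1, h.stronglyConnected_image.1 hC.2.1,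
    fun v hv w hw hm => (h.inj.mem_set_image).1
      (hC.2.2 _ ⟨v, hv, rfl⟩ _ ⟨w, hw, rfl⟩ ((h.move v w).2 hm))⟩

theorem strongDominion_image {U D : Set V} {p : Player} (hD : G.StrongDominion U p D) :
    G'.StrongDominion (ι '' U) p (ι '' D) := by
  obtain ⟨hDU, hDc, s, hs, hw⟩ := hD
  have hext : ∀ v, Function.extend ι (ι ∘ s) id (ι v) = ι (s v) := fun v =>
    h.inj.extend_apply _ _ v
  refine ⟨Set.image_mono hDU, ?_, Function.extend ι (ι ∘ s) id, ?_, ?_⟩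
  · rintro _ ⟨v, hv, rfl⟩ ho _ ⟨w, hw, rfl⟩ hm
    rw [h.owner] at ho
    exact ⟨w, hDc v hv ho w hw ((h.move v w).1 hm), rfl⟩
  · rintro _ ⟨v, hv, rfl⟩ ho
    rw [h.owner] at ho
    rw [hext]
    obtain ⟨h1, h2⟩ := hs v hv ho
    exact ⟨⟨_, h1, rfl⟩, (h.move _ _).2 h2⟩
  · intro π hπ
    choose ρ hρ using hπ.mem
    have hp : G'.pathPrio π = G.pathPrio ρ := by
      unfold pathPrio
      congr 1
      funext n
      rw [← (hρ n).2, h.prio]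
    rw [hp]
    refine hw ρ ⟨fun n => (hρ n).1, fun n => ?_, fun n ho => ?_⟩
    · rw [← h.move, (hρ n).2, (hρ _).2]
      exact hπ.move n
    · apply h.inj
      rw [(hρ _).2, hπ.own n (by rw [← (hρ n).2, h.owner]; exact ho), ← (hρ n).2, hext]

theorem isSolution_image {U : Set V} {W : Player → Set V} (hW : G.IsSolution U W) :
    G'.IsSolution (ι '' U) (fun p => ι '' W p) :=
  ⟨fun p => h.strongDominion_image (hW.1 p), fun p => by
    rw [← Set.image_union]
    exact Set.image_mono (hW.2 p)⟩

theorem exploredFamily_preimage {T : Set (Set V')} (hT : G'.ExploredFamily T) :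
    G.ExploredFamily {U | ι '' U ∈ T} where
  left U hU hsc hne := by
    have := hT.left _ hU (h.stronglyConnected_image.2 hsc)
    rw [h.leftGame_image] at this
    exact this (hne.image ι)
  right U hU hsc W hW hpre hne := by
    have := hT.right _ hU (h.stronglyConnected_image.2 hsc) (fun p => ι '' W p)
    simp only [h.leftGame_image, h.maxPrio_image, h.pre_image, h.rightGame_image,
      ← Set.image_sdiff h.inj, Set.image_nonempty] at this
    exact this (h.isSolution_image hW) hpre hne
  comp U hU hne hsc := by
    obtain ⟨C', hC', hT'⟩ := hT.comp _ hU (hne.image ι)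
      (fun hsc' => hsc (h.stronglyConnected_image.1 hsc'))
    obtain ⟨C, -, rfl⟩ := Set.subset_image_iff.1 hC'.1
    exact ⟨C, h.isTerminalSCC_of_image hC', hT'⟩

end IsEmbedding

/-! ### Padding with isolated positions -/

section Pad

variable {V : Type*} (G : ParityGame V) (m : ℕ)

/-- The moves of the padded game. -/
def padMove : V ⊕ Fin m → V ⊕ Fin m → Prop
  | .inl v, .inl w => G.move v w
  | .inr a, .inr b => a = b
  | _, _ => False

/-- The game `G` with `m` additional isolated positions. -/
def pad : ParityGame (V ⊕ Fin m) where
  owner := Sum.elim G.owner fun _ => 0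
  move := G.padMove m
  prio := Sum.elim G.prio fun _ => 0
  total v := by
    rcases v with v | a
    · obtain ⟨w, hw⟩ := G.total v
      exact ⟨.inl w, hw⟩
    · exact ⟨.inr a, rfl⟩

theorem isEmbedding_pad : G.IsEmbedding (G.pad m) Sum.inl where
  inj := Sum.inl_injective
  owner _ := rfl
  prio _ := rfl
  move _ _ := Iff.rfl

variable {G m}

theorem pad_move_inl {v : V} {w : V ⊕ Fin m} (h : (G.pad m).move (.inl v) w) :
    w ∈ Set.range (Sum.inl : V → V ⊕ Fin m) := by
  rcases w with w | b
  · exact ⟨w, rfl⟩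
  · exact h.elim

theorem pad_move_inr {a : Fin m} {w : V ⊕ Fin m} (h : (G.pad m).move (.inr a) w) :
    w = .inr a := by
  rcases w with w | b
  · exact h.elim
  · exact congrArg Sum.inr (Eq.symm h)

theorem isTerminalSCC_pad_inr {X : Set (V ⊕ Fin m)} {a : Fin m} (ha : Sum.inr a ∈ X) :
    (G.pad m).IsTerminalSCC X {Sum.inr a} := by
  refine ⟨Set.singleton_subset_iff.2 ha, ⟨Set.singleton_nonempty _, ?_⟩, ?_⟩
  · rintro _ rfl _ rfl
    exact .refl
  · rintro _ rfl w _ hm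
    exact pad_move_inr hm

/-- A run on the padded game solves the subgame `G`. -/
theorem range_inl_mem_of_pad [Finite V] (hG : G.StronglyConnected Set.univ)
    {T : Set (Set (V ⊕ Fin m))} (hT : (G.pad m).RestClosed T) (hU : Set.univ ∈ T) :
    Set.range Sum.inl ∈ T := by
  have hrange : Set.range (Sum.inl : V → V ⊕ Fin m) = Sum.inl '' Set.univ := Set.image_univ.symm
  have hsc : (G.pad m).StronglyConnected (Set.range Sum.inl) := by
    rw [hrange]
    exact (G.isEmbedding_pad m).stronglyConnected_image.2 hG
  have hsub : (G.pad m).IsSubgame (Set.range Sum.inl) := by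
    rintro _ ⟨v, rfl⟩
    obtain ⟨w, hw⟩ := G.total v
    exact ⟨.inl w, ⟨w, rfl⟩, hw⟩
  suffices key : ∀ n, ∀ X ∈ T, X.ncard = n → Set.range Sum.inl ⊆ X → Set.range Sum.inl ∈ T from
    key _ _ hU rfl (Set.subset_univ _)
  intro n
  induction n using Nat.strong_induction_on with
  | _ n ih =>
  intro X hX hn hr
  subst hn
  have hterm : (G.pad m).IsTerminalSCC X (Set.range Sum.inl) := by
    refine ⟨hr, hsc, ?_⟩
    rintro _ ⟨v, rfl⟩ w _ hm
    exact pad_move_inl hm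
  by_cases hXsc : (G.pad m).StronglyConnected X
  · rwa [hXsc.eq_of_isTerminalSCC hterm]
  -- The component chosen is either all of `G` or a single loop. A loop and its attractors leave `G`
  -- intact, so the induction continues with fewer positions.
  obtain ⟨C, W, hC, hW, hCT, hrest⟩ := hT X hX (hsc.1.mono hr) hXsc
  obtain ⟨v, hv⟩ := hC.2.1.1
  rcases v with v | a
  · rwa [hterm.eq_of_mem hC ⟨v, rfl⟩ hv]
  have hCa : C = {Sum.inr a} :=
    hC.eq_of_mem (isTerminalSCC_pad_inr (hC.1 hv)) hv rfl
  -- A position of `G` has a move inside `G` and none into the padding, so neither player can be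
  -- forced or move from `G` into the attractor.
  have hA : ∀ p, (G.pad m).attr X p (W p) ⊆ Set.range Sum.inr := by
    intro p
    refine attr_subset_of_closed (fun u hu => ?_) ?_
    · have := hW.subset p hu.1
      rw [hCa] at this
      exact ⟨a, this.symm⟩
    · rintro (u | b) hu
      · exfalso
        rcases hu with ⟨-, -, w, -, hm, ⟨b, rfl⟩⟩ | ⟨-, -, hall⟩
        · exact hm
        · obtain ⟨w, hw⟩ := G.total u
          obtain ⟨b, hb⟩ := hall (.inl w) (hr ⟨w, rfl⟩) hw
          cases hb
      · exact ⟨b, rfl⟩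
  have hmin : Set.range Sum.inl ⊆ (G.pad m).restGame X C W := by
    refine subset_minus ?_ hsub
    rintro _ ⟨u, rfl⟩
    refine ⟨hr ⟨u, rfl⟩, ?_⟩
    rintro ((hu | hu) | hu)
    · rw [hCa] at hu
      cases hu
    · obtain ⟨b, hb⟩ := hA _ hu
      cases hb
    · obtain ⟨b, hb⟩ := hA _ hu
      cases hb
  exact ih _ (minus_ncard_lt _ (hC.1 hv) (Or.inl (Or.inl hv))) _ (hrest (hsc.1.mono hmin)) rfl hmin

end Pad

end ParityGame

namespace SCCFamily

open Sum CorePos ParityGame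

variable {k : ℕ}

theorem stronglyConnected_univ (hk : 1 ≤ k) : (sccGame k).StronglyConnected Set.univ :=
  treeInv_univ.stronglyConnected hk fun _ _ => trivial

theorem two_pow_le_distinctCalls (hk : 1 ≤ k) (σ : (sccGame k).SCCRule) (memo : Bool) :
    2 ^ k ≤ (sccGame k).distinctCalls σ memo := by
  have : Nonempty (SCCPos k) := ⟨inl (alpha 0)⟩
  obtain ⟨T, hT, -, hU, hle⟩ := exists_exploredFamily σ memo
  exact (two_pow_le_ncard hk hT hU).trans hle

theorem two_pow_le_distinctCalls_pad (hk : 1 ≤ k) (m : ℕ) (σ : ((sccGame k).pad m).SCCRule)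
    (memo : Bool) : 2 ^ k ≤ ((sccGame k).pad m).distinctCalls σ memo := by
  have : Nonempty (SCCPos k) := ⟨inl (alpha 0)⟩
  obtain ⟨T, hT, hR, hU, hle⟩ := exists_exploredFamily σ memo
  have h := (sccGame k).isEmbedding_pad m
  have hmem := range_inl_mem_of_pad (stronglyConnected_univ hk) hR hU
  rw [← Set.image_univ] at hmem
  refine (two_pow_le_ncard hk (h.exploredFamily_preimage hT) hmem).trans (le_trans ?_ hle)
  rw [← Set.ncard_image_of_injective _ h.inj.image_injective]
  refine Set.ncard_le_ncard ?_ (Set.toFinite _)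
  rintro _ ⟨U, ⟨h1, h2⟩, rfl⟩
  exact ⟨h1, h.stronglyConnected_image.2 h2⟩

/-! ### The SCC family as a core extension -/

theorem isCoreExtension_sccGame : IsCoreExtension k (sccGame k) inl := by
  refine ⟨inl_injective, ⟨?_, fun c => ⟨rfl, rfl, fun d => Iff.rfl⟩⟩, ?_, ?_, ?_⟩
  · have he : Set.univ \ (Set.range (inl : CorePos k → SCCPos k))ᶜ = Set.range inl :=
      Set.ext fun _ => ⟨fun h => not_not.1 h.2, fun h => ⟨trivial, not_not.2 h⟩⟩
    rw [minus_eq_diff (by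
      rw [he]
      rintro _ ⟨c, rfl⟩
      obtain ⟨d, hd⟩ := (coreGame k).total c
      exact ⟨inl d, ⟨d, rfl⟩, hd⟩), he]
  · rintro (c | δ) hv
    · exact absurd ⟨c, rfl⟩ hv
    · rw [prio_delta, prio_alpha]
      omega
  · rintro (c | δ) hv i
    · exact absurd ⟨c, rfl⟩ hv
    · simp only [move_alpha, move_beta, move_delta]
      simp
  · rintro (c | δ) hv i hm
    · exact absurd ⟨c, rfl⟩ hv
    · have hm : gammaDelta i δ := hm
      exact ⟨hm.2.symm, hm, Nat.zero_le _⟩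

/-! ### The number of positions -/

/-- The number of additional positions with doubleton `{i, j}`. -/
def deltaCount (i j : ℕ) : ℕ := if i < j then (if i % 2 = j % 2 then 1 else 2) else 0

/-- The second summand counts the `i < n` of parity other than `c`. -/
theorem sum_parity (n c : ℕ) (hc : c < 2) :
    ∑ i ∈ Finset.range n, (if i % 2 = c then 1 else 2) = n + (n + c) / 2 := by
  induction n with
  | zero => simp; omega
  | succ n ih =>
    rw [Finset.sum_range_succ, ih]
    split_ifs <;> omega

/-- The new row vanishes because of the condition `i < j`; the new column pairs `n` with all smaller
indices, those of opposite parity counting twice. -/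
theorem sum_deltaCount_succ (n : ℕ) :
    ∑ i ∈ Finset.range (n + 1), ∑ j ∈ Finset.range (n + 1), deltaCount i j =
      (∑ i ∈ Finset.range n, ∑ j ∈ Finset.range n, deltaCount i j) + (n + (n + 1) / 2) := by
  have h1 : ∀ i, ∑ j ∈ Finset.range (n + 1), deltaCount i j =
      ∑ j ∈ Finset.range n, deltaCount i j + deltaCount i n := fun i =>
    Finset.sum_range_succ _ _
  have h2 : ∑ j ∈ Finset.range n, deltaCount n j = 0 := by
    refine Finset.sum_eq_zero fun j hj => if_neg ?_
    rw [Finset.mem_range] at hj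
    omega
  have h3 : ∑ i ∈ Finset.range n, deltaCount i n = n + (n + 1) / 2 := by
    rw [show (n + 1) / 2 = (n + n % 2) / 2 by omega, ← sum_parity n (n % 2) (by omega)]
    exact Finset.sum_congr rfl fun i hi => if_pos (Finset.mem_range.1 hi)
  rw [Finset.sum_range_succ]
  simp only [h1, Finset.sum_add_distrib, h2, h3]
  simp [deltaCount]

theorem sum_deltaCount (k : ℕ) :
    ∑ i ∈ Finset.range (2 * k + 1), ∑ j ∈ Finset.range (2 * k + 1), deltaCount i j =
      3 * k ^ 2 + 2 * k := by
  induction k with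
  | zero => simp [deltaCount]
  | succ k ih =>
    rw [show 2 * (k + 1) + 1 = 2 * k + 1 + 1 + 1 by ring, sum_deltaCount_succ,
      sum_deltaCount_succ, ih, show (2 * k + 1 + 1) / 2 = k + 1 by omega,
      show (2 * k + 1 + 1 + 1) / 2 = k + 1 by omega]
    ring

theorem card_deltaPos (k : ℕ) : Nat.card (DeltaPos k) = 3 * k ^ 2 + 2 * k := by
  classical
  rw [Nat.card_eq_fintype_card, Fintype.card_subtype, Finset.card_filter,
    Fintype.sum_prod_type, ← sum_deltaCount, ← Fin.sum_univ_eq_sum_range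
      (fun i => ∑ j ∈ Finset.range (2 * k + 1), deltaCount i j)]
  refine Finset.sum_congr rfl fun i _ => ?_
  rw [Fintype.sum_prod_type, ← Fin.sum_univ_eq_sum_range (fun j => deltaCount i j)]
  refine Finset.sum_congr rfl fun j _ => ?_
  have hsum : ∀ f : Player → ℕ, ∑ p, f p = f 0 + f 1 := fun f => Fin.sum_univ_two f
  rw [hsum]
  simp only [deltaCount, ← natCast_player_eq_iff, Fin.lt_def]
  by_cases hij : i.val < j.val
  · simp only [hij, true_and, if_true]
    rcases player_zero_or_one (i.val : Player) with h1 | h1 <;>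
    rcases player_zero_or_one (j.val : Player) with h2 | h2 <;> simp [h1, h2]
  · simp [hij]

theorem card_corePos (k : ℕ) : Nat.card (CorePos k) = 3 * (2 * k + 1) := by
  let e : CorePos k ≃ Fin (2 * k + 1) ⊕ Fin (2 * k + 1) ⊕ Fin (2 * k + 1) :=
    { toFun := fun c => match c with
        | .alpha i => .inl i
        | .beta i => .inr (.inl i)
        | .gamma i => .inr (.inr i)
      invFun := fun c => match c with
        | .inl i => .alpha i
        | .inr (.inl i) => .beta i
        | .inr (.inr i) => .gamma i
      left_inv := fun c => by cases c <;> rfl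
      right_inv := fun c => by rcases c with i | i | i <;> rfl }
  rw [Nat.card_congr e]
  simp
  ring

theorem card_sccPos (k : ℕ) : Nat.card (SCCPos k) = 3 * k ^ 2 + 8 * k + 3 := by
  rw [Nat.card_sum, card_deltaPos, card_corePos]
  ring

/-! ### The numerical bounds -/

theorem two_rpow_sqrt_le {x : ℝ} {k c : ℕ} (h : x ≤ ((k : ℝ) + c) ^ 2) {N : ℕ} (hN : 2 ^ k ≤ N) :
    ((2 : ℝ) ^ c)⁻¹ * (2 : ℝ) ^ Real.sqrt x ≤ N := by
  have h1 : Real.sqrt x ≤ (k : ℝ) + c := Real.sqrt_le_iff.2 ⟨by positivity, h⟩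
  have h2 : (2 : ℝ) ^ Real.sqrt x ≤ (2 : ℝ) ^ c * 2 ^ k := by
    refine (Real.rpow_le_rpow_of_exponent_le one_le_two h1).trans_eq ?_
    rw [Real.rpow_add two_pos, Real.rpow_natCast, Real.rpow_natCast, mul_comm]
  have h3 : (2 : ℝ) ^ k ≤ N := by exact_mod_cast hN
  rw [inv_mul_le_iff₀ (by positivity)]
  exact h2.trans (by gcongr)

theorem exists_index {n : ℕ} (hn : 14 ≤ n) : ∃ k, 1 ≤ k ∧ 3 * k ^ 2 + 8 * k + 3 ≤ n ∧
    n < 3 * (k + 1) ^ 2 + 8 * (k + 1) + 3 := by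
  classical
  have hex : ∃ k, n < 3 * (k + 1) ^ 2 + 8 * (k + 1) + 3 := ⟨n, by nlinarith⟩
  rcases hk : Nat.find hex with _ | k
  · have := Nat.find_spec hex
    rw [hk] at this
    omega
  · refine ⟨k + 1, by omega, ?_, hk ▸ Nat.find_spec hex⟩
    exact not_lt.1 (Nat.find_min hex (m := k) (by omega))

end SCCFamily

open SCCFamily

theorem theorem2 :
    -- the SCC family: number of positions, core extension, strong connectivity in the subgame tree
    (∀ k : ℕ, 1 ≤ k →
      Nat.card (SCCPos k) = 3 * k ^ 2 + 8 * k + 3 ∧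
      IsCoreExtension k (sccGame k) Sum.inl ∧
      (∀ (w : List Dir) (x : Dir), w.length ≤ k →
        (x :: w ≠ List.replicate (k + 1) Dir.R →
          (sccGame k).StronglyConnected (hatGame (sccGame k) Sum.inl w x)) ∧
        (x :: w = List.replicate (k + 1) Dir.R →
          hatGame (sccGame k) Sum.inl w x = ∅)) ∧
      (sccGame k).StronglyConnected (treeGame (sccGame k) (Sum.inl : CorePos k → SCCPos k) []) ∧
      (∀ w : List Dir, w.length < k →
        (sccGame k).StronglyConnected (treeGame (sccGame k) Sum.inl (Dir.L :: w))) ∧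
      (∀ w : List Dir, w.length < k →
        transientPos Sum.inl (2 * (k - (w.length + 1))) ⊆
            treeGame (sccGame k) Sum.inl (Dir.R :: w) ∧
        (sccGame k).IsTerminalSCC (treeGame (sccGame k) Sum.inl (Dir.R :: w))
          (treeGame (sccGame k) Sum.inl (Dir.R :: w) \
            transientPos Sum.inl (2 * (k - (w.length + 1)))))) ∧
    -- the lower bound on the SCC family
    (∃ c : ℝ, 0 < c ∧ ∀ k : ℕ, 1 ≤ k →
      ∀ (σ : (sccGame k).SCCRule) (memo : Bool),
        c * (2 : ℝ) ^ Real.sqrt ((Nat.card (SCCPos k) : ℝ) / 3) ≤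
          ((sccGame k).distinctCalls σ memo : ℝ)) ∧
    -- the lower bound on the worst case over all games with `n` positions
    (∃ c : ℝ, 0 < c ∧ ∀ᶠ n : ℕ in Filter.atTop,
      ∃ (V : Type) (_ : Finite V) (G : ParityGame V), Nat.card V = n ∧
        ∀ (σ : G.SCCRule) (memo : Bool),
          c * (2 : ℝ) ^ Real.sqrt ((n : ℝ) / 3) ≤ (G.distinctCalls σ memo : ℝ)) := by
  refine ⟨fun k hk => ⟨card_sccPos k, isCoreExtension_sccGame, fun w x hw =>
    ⟨stronglyConnected_hatGame hw, hatGame_replicate hw⟩, stronglyConnected_univ hk,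
    fun w hw => stronglyConnected_treeGame_left hw, fun w hw => ?_⟩,
    -- The exponent `2` comes from `k² + 8k/3 + 1 ≤ (k + 2)²`.
    ⟨((2 : ℝ) ^ 2)⁻¹, by positivity, fun k hk σ memo =>
      two_rpow_sqrt_le ?_ (two_pow_le_distinctCalls hk σ memo)⟩,
    -- `14` is the size of the game for `k = 1`. For general `n` the largest game that fits is
    -- padded; `n` is below the size for `k + 1`, which is `3k² + 14k + 14 ≤ 3 (k + 3)²`.
    ⟨((2 : ℝ) ^ 3)⁻¹, by positivity, eventually_atTop.2 ⟨14, fun n hn => ?_⟩⟩⟩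
  · have h := treeInv_treeGame (k := k) (w := Dir.R :: w) (by simpa using hw)
    rw [List.length_cons] at h
    exact ⟨h.transientPos_subset,
      h.isTerminalSCC (by omega) (gamma_notMem_treeGame_right hw)⟩
  · rw [card_sccPos]
    push_cast
    nlinarith [(Nat.cast_nonneg k : (0 : ℝ) ≤ k)]
  · obtain ⟨k, hk, h1, h2⟩ := exists_index hn
    refine ⟨SCCPos k ⊕ Fin (n - (3 * k ^ 2 + 8 * k + 3)), inferInstance, (sccGame k).pad _, ?_,
      fun σ memo => two_rpow_sqrt_le (k := k) ?_ (two_pow_le_distinctCalls_pad hk _ σ memo)⟩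
    · rw [Nat.card_sum, card_sccPos, Nat.card_fin]
      omega
    · have h3 : (n : ℝ) ≤ 3 * (k + 1) ^ 2 + 8 * (k + 1) + 3 := by exact_mod_cast h2.le
      push_cast
      nlinarith [(Nat.cast_nonneg k : (0 : ℝ) ≤ k)]
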